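/- **Setting.** Let $E$ be a locally compact, second countable metric space with Borel $\sigma$-algebra, and let $\mu$ be a probability measure on $E$. On one probability space $(\Omega,\mathcal F,\mathbb P)$ let - $(U_i)_{i\ge1}$ be i.i.d. random elements of $E$ with law $\mu$; - $(\varepsilon_\ell)_{\ell\ge1}$ be i.i.d. non-negative random variables; - $(Y_i)_{i\ge1}$ be i.i.d. $\mathbb N$-valued random variables; - $(Z_i)_{i\ge1}$ be i.i.d. non-negative random variables, distributed as $Z$; - $N(n)$ be, for each $n$, a Poisson random variable with mean $n$; - $0<\Gamma_1<\Gamma_2<\cdots$ be the arrival times of a standard Poisson process on $\mathbb R_+$ (partial sums of i.i.d. standard exponential variables). For each $n$, the five families $(U_i),(\varepsilon_\ell),(Y_i),(Z_i),N(n)$ are independent, and the four families $(U_i),(\varepsilon_\ell),(Y_i),(\Gamma_\ell)$ are independent. Write $\mathbb E_{\varepsilon}$ for conditional expectation given $\sigma(\varepsilon_1,\varepsilon_2,\dots)$, and $\varepsilon_Y:=\varepsilon_{Y_1}$. Let $\mathfrak M_p((0,\infty]\times E)$ be the space of Radon point measures on $(0,\infty]\times E$ with the vague topology; points with first coordinate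 $0$ are not counted. Let $\mathrm{SM}(E)$ be the space of $[0,\infty]$-valued sup-measures on $E$ with the sup-vague topology, in which $m_n\to m$ iff $\limsup_n m_n(K)\le m(K)$ for every compact $K$ and $\liminf_n m_n(G)\ge m(G)$ for every open $G$. Define the random sup-measures (with $\sup\emptyset=0$), for open sets $G \subset E$, $$M_n(G)=\sup\{\varepsilon_{Y_i}Z_i: 1\le i\le N(n),\ U_i\in G\},\qquad \mathcal M^{\rm is}_{a}(G)=\sup\{\Gamma_\ell^{-1/a}:\ \ell\ge1,\ U_\ell\in G\},$$ so that $\mathcal M^{\rm is}_a$ is the independently scattered $a$-Fréchet random sup-measure with control measure $\mu$. For random elements $X_n, X$ of a topological space $S$ (with its Borel $\sigma$-algebra), "conditionally on $\varepsilon$, $X_n\Rightarrow X$ almost surely" means that for every bounded continuous $f:S\to\mathbb R$, $\mathbb E_\varepsilon f(X_n)\to\mathbb E_\varepsilon f(X)$ almost surely as $n\to\infty$. **Theorem 3.1 (noise-dominance regime).** Let $\alpha'>0$. Assume that $x\mapsto\mathbb P(Z>x)$ is regularly varying at infinity with index $-\alpha'$ and that, for some $\epsilon>0$, $\mathbb E_\varepsilon\,\varepsilon_Y^{\alpha'+\epsilon}<\infty$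 almost surely. Let $(c_n)$ be any real sequence with $\lim_{n\to\infty}n\,\mathbb P(Z>c_n)=1$. Then $\sum_{\ell\ge1}\delta_{(\varepsilon_{Y_\ell}\Gamma_\ell^{-1/\alpha'},\,U_\ell)}$ is almost surely a Radon point measure on $(0,\infty]\times E$ and, conditionally on $\varepsilon$, $$\sum_{i=1}^{N(n)}\delta_{(\varepsilon_{Y_i}Z_i/c_n,\;U_i)}\ \Rightarrow\ \sum_{\ell=1}^\infty\delta_{(\varepsilon_{Y_\ell}\Gamma_\ell^{-1/\alpha'},\;U_\ell)}\quad\text{in }\mathfrak M_p((0,\infty]\times E)\text{, almost surely.}$$ Moreover $\mathbb E_\varepsilon\,\varepsilon_Y^{\alpha'}<\infty$ almost surely and, conditionally on $\varepsilon$, $$\frac1{c_n}M_n\ \Rightarrow\ \bigl(\mathbb E_\varepsilon\,\varepsilon_Y^{\alpha'}\bigr)^{1/\alpha'}\cdot\mathcal M^{\rm is}_{\alpha'}\quad\text{in }\mathrm{SM}(E)\text{, almost surely.}$$ (Finitely many $c_n$ may be non-positive; for these $n$ the left-hand sides may be defined arbitrarily.) -/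

import Mathlib

open MeasureTheory ProbabilityTheory Filter Topology
open scoped ENNReal NNReal BoundedContinuousFunction CompactlySupported

noncomputable section

/-! ### Radon point measures with the vague topology -/

/-- A Radon point measure on `X`: a measure of the form `∑ δ_{x_i}` over countably many (possibly
finitely many or no, possibly repeated) points, with finite mass on compact sets. -/
def IsRadonPointMeasure {X : Type*} [TopologicalSpace X] [MeasurableSpace X] (m : Measure X) :
    Prop :=
  IsFiniteMeasureOnCompacts m ∧
    ∃ (S : Set ℕ) (x : S → X), m = Measure.sum fun i => Measure.dirac (x i)

/-- The space `𝔐_p(X)` of Radon point measures on `X`. -/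
def PointMeasure (X : Type*) [TopologicalSpace X] [MeasurableSpace X] : Type _ :=
  {m : Measure X // IsRadonPointMeasure m}

/-- The vague topology: the coarsest one for which `m ↦ ∫ φ dm` is continuous for every continuous
compactly supported `φ`. -/
instance PointMeasure.instTopologicalSpace (X : Type*) [TopologicalSpace X] [MeasurableSpace X] :
    TopologicalSpace (PointMeasure X) :=
  TopologicalSpace.induced (fun m (φ : C_c(X, ℝ)) => ∫ x, φ x ∂m.1) inferInstance

/-- The Borel σ-algebra of the vague topology. -/
instance PointMeasure.instMeasurableSpace (X : Type*) [TopologicalSpace X] [MeasurableSpace X] :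
    MeasurableSpace (PointMeasure X) := borel _

theorem isRadonPointMeasure_zero (X : Type*) [TopologicalSpace X] [MeasurableSpace X] :
    IsRadonPointMeasure (0 : Measure X) := by
  refine ⟨⟨fun K _ => by simp⟩, ∅, fun i => i.2.elim, ?_⟩
  simp

open Classical in
/-- A measure as an element of `𝔐_p(X)`. (If it is not a Radon point measure, the null measure;
this is only used for measures which are Radon point measures, at least almost surely.) -/
def PointMeasure.ofMeasure {X : Type*} [TopologicalSpace X] [MeasurableSpace X] (m : Measure X) :
    PointMeasure X :=
  if h : IsRadonPointMeasure m then ⟨m, h⟩ else ⟨0, isRadonPointMeasure_zero X⟩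

/-- The half-open interval `(0, ∞]`, as a subspace of `[0, ∞]`. -/
abbrev PosExt : Type := {x : ℝ≥0∞ // 0 < x}

/-- The point measure `∑_{i ∈ I} δ_{(x_i, u_i)}` on `(0, ∞] × E`; the indices with `x_i = 0`
do not give a point of `(0, ∞] × E` and do not contribute. -/
def pointSum {E : Type*} [MeasurableSpace E] (I : Set ℕ) (x : ℕ → ℝ≥0∞) (u : ℕ → E) :
    Measure (PosExt × E) :=
  Measure.sum fun i : {i : ℕ | i ∈ I ∧ 0 < x i} =>
    Measure.dirac ((⟨x i, i.2.2⟩ : PosExt), u i)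

/-- A finite sum of unit masses is a Radon point measure. -/
theorem isRadonPointMeasure_pointSum {E : Type*} [TopologicalSpace E] [MeasurableSpace E]
    {I : Set ℕ} (hI : I.Finite) (x : ℕ → ℝ≥0∞) (u : ℕ → E) :
    IsRadonPointMeasure (pointSum I x u) := by
  refine ⟨⟨fun K _ => ?_⟩, _, _, rfl⟩
  have : Finite {i : ℕ | i ∈ I ∧ 0 < x i} := (hI.subset fun i hi => hi.1).to_subtype
  have := Fintype.ofFinite {i : ℕ | i ∈ I ∧ 0 < x i}
  refine (measure_mono (Set.subset_univ K)).trans_lt ?_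
  rw [pointSum, Measure.sum_apply _ MeasurableSet.univ, tsum_fintype]
  simp

/-! ### Sup-measures with the sup-vague topology -/

/-- A sup-measure on `E` with values in `[0, ∞]`, given by its values on open sets. -/
structure SupMeasure (E : Type*) [TopologicalSpace E] where
  /-- The value on an open set. -/
  onOpen : TopologicalSpace.Opens E → ℝ≥0∞
  onOpen_sSup : ∀ S : Set (TopologicalSpace.Opens E), onOpen (sSup S) = ⨆ G ∈ S, onOpen G

/-- The canonical extension of a sup-measure to arbitrary sets. -/
def SupMeasure.onSet {E : Type*} [TopologicalSpace E] (m : SupMeasure E) (A : Set E) : ℝ≥0∞ :=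
  ⨅ (G : TopologicalSpace.Opens E) (_ : A ⊆ G), m.onOpen G

/-- The sup-vague topology: `m_n → m` iff `limsup m_n(K) ≤ m(K)` for all compact `K` and
`liminf m_n(G) ≥ m(G)` for all open `G`. -/
instance SupMeasure.instTopologicalSpace (E : Type*) [TopologicalSpace E] :
    TopologicalSpace (SupMeasure E) :=
  TopologicalSpace.generateFrom
    ({V | ∃ (K : Set E) (x : ℝ≥0∞), IsCompact K ∧ V = {m | m.onSet K < x}} ∪
      {V | ∃ (G : TopologicalSpace.Opens E) (x : ℝ≥0∞), V = {m | x < m.onOpen G}})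

/-- The Borel σ-algebra of the sup-vague topology. -/
instance SupMeasure.instMeasurableSpace (E : Type*) [TopologicalSpace E] :
    MeasurableSpace (SupMeasure E) := borel _

/-- Multiplication of a sup-measure by a constant. -/
instance SupMeasure.instSMul (E : Type*) [TopologicalSpace E] : SMul ℝ≥0∞ (SupMeasure E) where
  smul a m :=
    { onOpen := fun G => a * m.onOpen G
      onOpen_sSup := fun S => by simp only [m.onOpen_sSup, ENNReal.mul_iSup] }

/-- The sup-measure `G ↦ sup {x_i : i ∈ I, u_i ∈ G}` (with `sup ∅ = 0`). -/
def supOfPoints {E : Type*} [TopologicalSpace E] (I : Set ℕ) (x : ℕ → ℝ≥0∞) (u : ℕ → E) :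
    SupMeasure E where
  onOpen G := ⨆ i ∈ {i | i ∈ I ∧ u i ∈ G}, x i
  onOpen_sSup S := by
    apply le_antisymm
    · refine iSup₂_le fun i hi => ?_
      obtain ⟨G, hG, hiG⟩ := TopologicalSpace.Opens.mem_sSup.1 hi.2
      exact (le_iSup₂ (f := fun i (_ : i ∈ {i | i ∈ I ∧ u i ∈ G}) => x i) i ⟨hi.1, hiG⟩).trans
        (le_iSup₂ (f := fun G (_ : G ∈ S) => ⨆ i ∈ {i | i ∈ I ∧ u i ∈ G}, x i) G hG)
    · refine iSup₂_le fun G hG => iSup₂_le fun i hi => ?_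
      exact le_iSup₂ (f := fun i (_ : i ∈ {i | i ∈ I ∧ u i ∈ sSup S}) => x i) i
        ⟨hi.1, TopologicalSpace.Opens.mem_sSup.2 ⟨G, hG, hi.2⟩⟩

/-! ### Probabilistic notions -/

/-- `f ∈ RV_ρ`: `f` is measurable, eventually positive, and regularly varying at infinity with
index `ρ`. -/
def IsRegularlyVarying (f : ℝ → ℝ) (ρ : ℝ) : Prop :=
  Measurable f ∧ (∀ᶠ t in atTop, 0 < f t) ∧
    ∀ x : ℝ, 0 < x → Tendsto (fun t => f (t * x) / f t) atTop (𝓝 (x ^ ρ))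

variable {Ω : Type*}

/-- The tail function `x ↦ P(X > x)`. -/
def tail [MeasurableSpace Ω] (P : Measure Ω) (X : Ω → ℝ) (x : ℝ) : ℝ :=
  P.real {ω | x < X ω}

/-- The random elements `X 0, X 1, …` are independent and identically distributed. -/
structure IsIID {S : Type*} [MeasurableSpace S] [MeasurableSpace Ω] (X : ℕ → Ω → S)
    (P : Measure Ω) : Prop where
  measurable : ∀ i, Measurable (X i)
  indep : iIndepFun X P
  identDistrib : ∀ i, IdentDistrib (X i) (X 0) P P

/-- The σ-algebra `σ(X 0, X 1, …)` generated by a sequence. -/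
abbrev sigmaOf {S : Type*} [MeasurableSpace S] (X : ℕ → Ω → S) : MeasurableSpace Ω :=
  MeasurableSpace.comap (fun ω i => X i ω) MeasurableSpace.pi

/-- The arrival times `Γ_1 < Γ_2 < ⋯` (here `arrivalTime T 0, arrivalTime T 1, …`) with
interarrival times `T`. -/
def arrivalTime (T : ℕ → Ω → ℝ) (l : ℕ) (ω : Ω) : ℝ :=
  ∑ j ∈ Finset.range (l + 1), T j ω

/-- Almost sure weak convergence `X_n ⇒ Y`, conditionally on the σ-algebra `𝓖`: the `X_n` and `Y`
are random elements of `S` and `E[f(X_n) | 𝓖] → E[f(Y) | 𝓖]` almost surely, for every bounded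
continuous `f : S → ℝ`. -/
structure CondTendstoInDistribution (𝓖 : MeasurableSpace Ω) {S : Type*} [TopologicalSpace S]
    [MeasurableSpace S] [MeasurableSpace Ω] (P : Measure Ω) (X : ℕ → Ω → S) (Y : Ω → S) :
    Prop where
  aemeasurable : ∀ n, AEMeasurable (X n) P
  aemeasurable_limit : AEMeasurable Y P
  tendsto : ∀ f : S →ᵇ ℝ, ∀ᵐ ω ∂P,
    Tendsto (fun n => (P[fun ω' => f (X n ω') | 𝓖]) ω) atTop
      (𝓝 ((P[fun ω' => f (Y ω') | 𝓖]) ω))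

/-! ### The model -/

variable {E : Type*}

/-- The point process `∑_{i ≤ N} δ_{(ε_{Y_i} Z_i / c, U_i)}` on `(0, ∞] × E`. -/
def noisyPointProcess [MeasurableSpace E] (ε Z : ℕ → Ω → ℝ) (Y : ℕ → Ω → ℕ)
    (U : ℕ → Ω → E) (N : Ω → ℕ) (c : ℝ) (ω : Ω) : Measure (PosExt × E) :=
  pointSum (Set.Iio (N ω)) (fun i => ENNReal.ofReal (ε (Y i ω) ω * Z i ω / c)) (fun i => U i ω)

/-- The point process `∑_ℓ δ_{(ε_{Y_ℓ} Γ_ℓ^{-1/a}, U_ℓ)}` on `(0, ∞] × E`. -/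
def limitPointProcess [MeasurableSpace E] (a : ℝ) (ε T : ℕ → Ω → ℝ) (Y : ℕ → Ω → ℕ)
    (U : ℕ → Ω → E) (ω : Ω) : Measure (PosExt × E) :=
  pointSum Set.univ
    (fun l => ENNReal.ofReal (ε (Y l ω) ω * arrivalTime T l ω ^ (-(1 / a)))) (fun l => U l ω)

/-- The empirical random sup-measure `M(·) = sup {ε_{Y_i} Z_i : i ≤ N, U_i ∈ ·}`. -/
def noisySupMeasure [TopologicalSpace E] (ε Z : ℕ → Ω → ℝ) (Y : ℕ → Ω → ℕ)
    (U : ℕ → Ω → E) (N : Ω → ℕ) (ω : Ω) : SupMeasure E :=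
  supOfPoints (Set.Iio (N ω)) (fun i => ENNReal.ofReal (ε (Y i ω) ω * Z i ω)) (fun i => U i ω)

/-- The independently scattered `a`-Fréchet random sup-measure
`sup {Γ_ℓ^{-1/a} : U_ℓ ∈ ·}`. If `T` is i.i.d. standard exponential and independent of the i.i.d.
sequence `U` of law `μ`, then the points `(Γ_ℓ^{-1/a}, U_ℓ)` form a Poisson point process with
intensity `a x^{-a-1} dx dμ`, so that `μ` is the control measure. -/
def frechetSupMeasure [TopologicalSpace E] (a : ℝ) (T : ℕ → Ω → ℝ) (U : ℕ → Ω → E) (ω : Ω) :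
    SupMeasure E :=
  supOfPoints Set.univ (fun l => ENNReal.ofReal (arrivalTime T l ω ^ (-(1 / a))))
    (fun l => U l ω)

/-- `E[ε_Y^r | ε]`, the conditional expectation (with values in `[0, ∞]`) of `ε_Y^r` given the
whole sequence `ε`. -/
def condMoment [MeasurableSpace Ω] (P : Measure Ω) (ε : ℕ → Ω → ℝ) (Y : Ω → ℕ) (r : ℝ) :
    Ω → ℝ≥0∞ :=
  condLExp (sigmaOf ε) P fun ω => ENNReal.ofReal (ε (Y ω) ω) ^ r

end

/-!
Conditionally on the signal `ε`, the factors `ε_{Y_i}` are i.i.d. and independent of the noise and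
of the locations. Since the signal is independent of everything else, conditional expectations given
`ε` are obtained by freezing `ε` and integrating over the other variables
(`condExp_noisyPointProcess`, `condExp_limitPointProcess`), so that it suffices to treat a
deterministic signal `e`, non-negative and with `∫ e_Y ^ (α + δ) < ∞`.

For such a signal the proof compares Laplace functionals. The noisy process has a Poisson number of
i.i.d. points, so that its Laplace functional is `exp (-n E[1 - exp (-φ (e_Y Z / c_n, U))])`
(`integral_expNeg_noisy`); after integration over `U` the exponent is `n E[ψ (e_Y Z / c_n)]` with a
continuous function `ψ` on `[0, ∞]` which vanishes near `0`. Breiman's lemma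
(`tendsto_mul_integral_mul`: regular variation of the tail of `Z`, with a Potter bound for dominated
convergence) gives the limit `E[e_Y ^ α] ∫ ψ(x) α x ^ (-α - 1) dx`. This is the exponent of the
Laplace functional of the limiting process (`integral_expNeg_limit`). The latter is computed without
a theory of Poisson processes: the product of the contributions of the first `n` arrivals,
completed by the expected contribution of the later ones, has constant expectation
(`integral_eq_exp_of_tendsto_prod_arrivalTime`). The limiting process is Radon because only
finitely many points lie above a positive level, by Borel–Cantelli and the law of large numbers
(`ae_finite_le_mul_arrivalTime`).

Convergence of Laplace functionals implies weak convergence in the vague topology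
(`PointMeasure.tendsto_integral_of_tendsto_laplace`): a countable family of test functions
gives a map to a compact cube which induces the vague topology, and on the cube the
Stone–Weierstrass theorem applies.

For the sup-measures, the map which sends `∑ δ_{(x_i, u_i)}` to `G ↦ sup {x_i : u_i ∈ G}` is
continuous from the vague to the sup-vague topology (`continuous_toSup`), so that the second
convergence follows from the first one. Since the Laplace functional of the limit depends on the
signal only through `E[e_Y ^ α]`, the factors `e_{Y_l}` may be replaced by the constant
`E[e_Y ^ α] ^ (1 / α)` without a change of law (`integral_limitPointProcess_eq`), which turns the
limit into a multiple of the Fréchet sup-measure.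
-/

noncomputable section

/-! ### The vague topology and Laplace functionals -/

namespace PointMeasure

section VagueTopology

variable {X : Type*} [TopologicalSpace X] [MeasurableSpace X]

instance (m : PointMeasure X) : IsFiniteMeasureOnCompacts m.1 := m.2.1

instance : BorelSpace (PointMeasure X) := ⟨rfl⟩

theorem continuous_integral (φ : C_c(X, ℝ)) :
    Continuous fun m : PointMeasure X => ∫ x, φ x ∂m.1 := by
  have h : Continuous fun (m : PointMeasure X) (φ : C_c(X, ℝ)) => ∫ x, φ x ∂m.1 :=
    continuous_induced_dom
  exact (continuous_apply φ).comp h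

variable [BorelSpace X]

theorem integrable (m : PointMeasure X) (φ : C_c(X, ℝ)) : Integrable φ m.1 :=
  φ.continuous.integrable_of_hasCompactSupport φ.hasCompactSupport

variable [LocallyCompactSpace X] [SecondCountableTopology X] [T2Space X]

omit [MeasurableSpace X] [BorelSpace X] in
/-- There is a countable family of non-negative test functions which approximates every
non-negative test function uniformly, with an error dominated by a small multiple of a member of
the family. -/
theorem exists_countable_testFunctions :
    ∃ D : Set C_c(X, ℝ), D.Countable ∧ (∀ φ ∈ D, 0 ≤ φ) ∧
      ∀ ψ : C_c(X, ℝ), 0 ≤ ψ → ∃ χ ∈ D, ∀ η : ℝ, 0 < η → ∃ φ ∈ D, ∀ x, |ψ x - φ x| ≤ η * χ x := by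
  classical
  let K : CompactExhaustion X := default
  have hχ : ∀ m, ∃ χ : C_c(X, ℝ), 0 ≤ χ ∧ ∀ x ∈ K m, χ x = 1 := by
    intro m
    obtain ⟨f, h1, -, h2, h3⟩ := exists_continuous_one_zero_of_isCompact (K.isCompact m)
      isClosed_empty (Set.disjoint_empty _)
    exact ⟨⟨f, h2⟩, fun x => (h3 x).1, fun x hx => h1 hx⟩
  choose χ hχ0 hχ1 using hχ
  let A : ℕ → Set C(X, ℝ) := fun m => {f | (∀ x, 0 ≤ f x) ∧ ∀ x ∉ K m, f x = 0}
  have hA : ∀ m, ∃ s : Set C(X, ℝ), s.Countable ∧ s ⊆ A m ∧ A m ⊆ closure s := by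
    intro m
    obtain ⟨s, hs, hd⟩ := TopologicalSpace.exists_countable_dense (A m)
    refine ⟨(↑) '' s, hs.image _, by rintro _ ⟨f, -, rfl⟩; exact f.2, fun f hf => ?_⟩
    have := hd ⟨f, hf⟩
    rw [closure_subtype] at this
    exact this
  choose s hsc hsA hsd using hA
  have hcs : ∀ m, ∀ f ∈ A m, HasCompactSupport f := fun m f hf =>
    HasCompactSupport.intro (K.isCompact m) (fun x hx => hf.2 x hx)
  let D : Set C_c(X, ℝ) := (⋃ m, {χ m}) ∪ ⋃ m, Set.range
    (fun f : s m => (⟨f.1, hcs m f.1 (hsA m f.2)⟩ : C_c(X, ℝ)))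
  refine ⟨D, ?_, ?_, ?_⟩
  · refine (Set.countable_iUnion fun m => Set.countable_singleton _).union
      (Set.countable_iUnion fun m => ?_)
    have := (hsc m).to_subtype
    exact Set.countable_range _
  · rintro φ (h | h)
    · obtain ⟨m, rfl⟩ := Set.mem_iUnion.1 h
      exact hχ0 m
    · obtain ⟨m, f, rfl⟩ := Set.mem_iUnion.1 h
      exact fun x => (hsA m f.2).1 x
  · intro ψ hψ
    obtain ⟨m, hm⟩ := K.exists_superset_of_isCompact ψ.hasCompactSupport
    have hψA : (ψ : C(X, ℝ)) ∈ A m :=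
      ⟨fun x => hψ x, fun x hx => image_eq_zero_of_notMem_tsupport fun h => hx (hm h)⟩
    refine ⟨χ m, Or.inl (Set.mem_iUnion.2 ⟨m, rfl⟩), fun η hη => ?_⟩
    obtain ⟨u, hu, hlim⟩ := mem_closure_iff_seq_limit.1 (hsd m hψA)
    have := ContinuousMap.tendsto_iff_forall_isCompact_tendstoUniformlyOn.1 hlim (K m)
      (K.isCompact m)
    obtain ⟨n, hn⟩ := (Metric.tendstoUniformlyOn_iff.1 this η hη).exists
    refine ⟨_, Or.inr (Set.mem_iUnion.2 ⟨m, ⟨⟨u n, hu n⟩, rfl⟩⟩), fun x => ?_⟩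
    by_cases hx : x ∈ K m
    · rw [hχ1 m x hx, mul_one]
      exact (hn x hx).le
    · have h1 : (u n) x = 0 := (hsA m (hu n)).2 x hx
      have h2 : ψ x = 0 := hψA.2 x hx
      simp only [CompactlySupportedContinuousMap.coe_mk, h1, h2, sub_zero, abs_zero]
      exact mul_nonneg hη.le (hχ0 m x)

/-- A countable family of test functions generating the vague topology. -/
def testFunctions (X : Type*) [TopologicalSpace X] [LocallyCompactSpace X]
    [SecondCountableTopology X] [T2Space X] : Set C_c(X, ℝ) :=
  (exists_countable_testFunctions (X := X)).choose

omit [MeasurableSpace X] [BorelSpace X] in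
theorem countable_testFunctions : (testFunctions X).Countable :=
  (exists_countable_testFunctions (X := X)).choose_spec.1

omit [MeasurableSpace X] [BorelSpace X] in
theorem testFunctions_nonneg {φ : C_c(X, ℝ)} (h : φ ∈ testFunctions X) : 0 ≤ φ :=
  (exists_countable_testFunctions (X := X)).choose_spec.2.1 φ h

omit [MeasurableSpace X] [BorelSpace X] in
theorem exists_testFunctions_approx {ψ : C_c(X, ℝ)} (hψ : 0 ≤ ψ) :
    ∃ χ ∈ testFunctions X, ∀ η : ℝ, 0 < η → ∃ φ ∈ testFunctions X, ∀ x, |ψ x - φ x| ≤ η * χ x :=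
  (exists_countable_testFunctions (X := X)).choose_spec.2.2 ψ hψ

instance : Countable (testFunctions X) := countable_testFunctions.to_subtype

/-- The integrals against the countably many members of `testFunctions X`. -/
def evalTest (m : PointMeasure X) (φ : testFunctions X) : ℝ := ∫ x, φ.1 x ∂m.1

/-- If the integrals against the countable family converge, then so do those against every
non-negative test function. -/
theorem tendsto_integral_of_tendsto_evalTest {ι : Type*} {l : Filter ι} {m : ι → PointMeasure X}
    {m₀ : PointMeasure X} (h : Tendsto (fun i => evalTest (m i)) l (𝓝 (evalTest m₀)))
    {ψ : C_c(X, ℝ)} (hψ : 0 ≤ ψ) :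
    Tendsto (fun i => ∫ x, ψ x ∂(m i).1) l (𝓝 (∫ x, ψ x ∂m₀.1)) := by
  rw [tendsto_pi_nhds] at h
  obtain ⟨χ, hχ, happ⟩ := exists_testFunctions_approx hψ
  have key : ∀ (m : PointMeasure X) (η : ℝ) (φ : C_c(X, ℝ)), (∀ x, |ψ x - φ x| ≤ η * χ x) →
      |∫ x, ψ x ∂m.1 - ∫ x, φ x ∂m.1| ≤ η * ∫ x, χ x ∂m.1 := by
    intro m η φ hφ
    rw [← integral_sub (m.integrable ψ) (m.integrable φ), ← integral_const_mul]
    refine (abs_integral_le_integral_abs).trans (integral_mono ?_ ?_ hφ)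
    · exact ((m.integrable ψ).sub (m.integrable φ)).abs
    · exact (m.integrable χ).const_mul η
  rw [Metric.tendsto_nhds]
  intro δ hδ
  have hM0 : 0 ≤ ∫ x, χ x ∂m₀.1 := integral_nonneg (testFunctions_nonneg hχ)
  set M := ∫ x, χ x ∂m₀.1 with hM
  obtain ⟨φ, hφ, hφa⟩ := happ (δ / (3 * (M + 1))) (by positivity)
  filter_upwards [Metric.tendsto_nhds.1 (h ⟨φ, hφ⟩) (δ / 3) (by positivity),
    Metric.tendsto_nhds.1 (h ⟨χ, hχ⟩) 1 one_pos] with i h1 h2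
  simp only [evalTest, Real.dist_eq] at h1 h2 ⊢
  have h3 := key (m i) _ φ hφa
  have h4 := key m₀ _ φ hφa
  have e : δ / (3 * (M + 1)) * (M + 1) = δ / 3 := by field_simp
  have h5 : δ / (3 * (M + 1)) * ∫ x, χ x ∂(m i).1 < δ / 3 := by
    rw [← e]
    refine mul_lt_mul_of_pos_left ?_ (by positivity)
    have := (abs_lt.1 h2).2
    linarith
  have h6 : δ / (3 * (M + 1)) * M < δ / 3 := by
    rw [← e]
    exact mul_lt_mul_of_pos_left (by linarith) (by positivity)
  rw [abs_le] at h3 h4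
  rw [abs_lt] at h1 ⊢
  constructor <;> linarith [h3.1, h3.2, h4.1, h4.2, h1.1, h1.2]

theorem isInducing_evalTest : IsInducing (evalTest (X := X)) := by
  rw [isInducing_iff_nhds]
  intro m₀
  apply le_antisymm
  · rw [← tendsto_iff_comap]
    refine tendsto_pi_nhds.2 fun φ => (continuous_integral φ.1).tendsto m₀
  · have hid : Tendsto (fun m => evalTest (X := X) m) (comap evalTest (𝓝 (evalTest m₀)))
        (𝓝 (evalTest m₀)) := tendsto_comap
    rw [nhds_induced, ← tendsto_iff_comap]
    refine tendsto_pi_nhds.2 fun ψ => ?_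
    have e : ∀ m : PointMeasure X, ∫ x, ψ x ∂m.1
        = ∫ x, (ψ ⊔ 0) x ∂m.1 - ∫ x, (-ψ ⊔ 0) x ∂m.1 := by
      intro m
      rw [← integral_sub (m.integrable _) (m.integrable _)]
      congr 1 with x
      simp only [CompactlySupportedContinuousMap.sup_apply,
        CompactlySupportedContinuousMap.neg_apply, CompactlySupportedContinuousMap.zero_apply]
      exact (max_zero_sub_max_neg_zero_eq_self _).symm
    simp only [e]
    exact (tendsto_integral_of_tendsto_evalTest hid le_sup_right).sub
      (tendsto_integral_of_tendsto_evalTest hid le_sup_right)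

/-- A map into the space of point measures is measurable as soon as all integrals against
test functions are. -/
theorem measurable_of_integral {Ω : Type*} [MeasurableSpace Ω] {M : Ω → PointMeasure X}
    (h : ∀ φ : C_c(X, ℝ), 0 ≤ φ → Measurable fun ω => ∫ x, φ x ∂(M ω).1) : Measurable M := by
  have hb : PointMeasure.instMeasurableSpace X
      = (inferInstance : MeasurableSpace (testFunctions X → ℝ)).comap evalTest := by
    rw [BorelSpace.measurable_eq (α := testFunctions X → ℝ), ← borel_comap]
    exact congrArg (@borel _) isInducing_evalTest.eq_induced
  rw [hb, measurable_comap_iff]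
  exact measurable_pi_lambda _ fun φ => h φ.1 (testFunctions_nonneg φ.2)

end VagueTopology

section Laplace

variable {X : Type*} [TopologicalSpace X] [MeasurableSpace X]

/-- The integrand `exp (-∫ φ dm)` of the Laplace functional. -/
def expNeg (φ : C_c(X, ℝ)) (m : PointMeasure X) : ℝ := Real.exp (-∫ x, φ x ∂m.1)

theorem expNeg_zero (m : PointMeasure X) : expNeg 0 m = 1 := by simp [expNeg]

theorem expNeg_nonneg (φ : C_c(X, ℝ)) (m : PointMeasure X) : 0 ≤ expNeg φ m := (Real.exp_pos _).le

theorem expNeg_le_one {φ : C_c(X, ℝ)} (hφ : 0 ≤ φ) (m : PointMeasure X) : expNeg φ m ≤ 1 :=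
  Real.exp_le_one_iff.2 (neg_nonpos.2 (integral_nonneg hφ))

theorem continuous_expNeg (φ : C_c(X, ℝ)) : Continuous (expNeg φ) :=
  Real.continuous_exp.comp (continuous_integral φ).neg

variable [BorelSpace X]

theorem expNeg_add (φ ψ : C_c(X, ℝ)) (m : PointMeasure X) :
    expNeg (φ + ψ) m = expNeg φ m * expNeg ψ m := by
  simp only [expNeg, CompactlySupportedContinuousMap.add_apply]
  rw [integral_add (m.integrable φ) (m.integrable ψ), neg_add, Real.exp_add]

variable [LocallyCompactSpace X] [SecondCountableTopology X] [T2Space X]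

/-- The map `m ↦ (exp (-∫ φ dm))_φ` from the space of point measures to a compact metrizable cube;
the vague topology is induced by it. -/
def toCube (m : PointMeasure X) (φ : testFunctions X) : unitInterval :=
  ⟨expNeg φ.1 m, expNeg_nonneg _ m, expNeg_le_one (testFunctions_nonneg φ.2) m⟩

theorem isInducing_toCube : IsInducing (toCube (X := X)) := by
  have hc : Continuous (toCube (X := X)) :=
    continuous_pi fun φ => (continuous_expNeg φ.1).subtype_mk _
  rw [isInducing_iff_nhds]
  intro m₀
  refine le_antisymm (tendsto_iff_comap.1 (hc.tendsto m₀)) ?_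
  rw [isInducing_evalTest.nhds_eq_comap, ← tendsto_iff_comap]
  refine tendsto_pi_nhds.2 fun φ => ?_
  have h1 : Tendsto (fun m => (toCube (X := X) m φ : ℝ)) (comap toCube (𝓝 (toCube m₀)))
      (𝓝 (toCube m₀ φ)) := by
    have : Continuous fun q : testFunctions X → unitInterval => (q φ : ℝ) := by fun_prop
    exact (this.tendsto (toCube m₀)).comp tendsto_comap
  have h2 := (((Real.continuousAt_log (Real.exp_pos _).ne').tendsto).comp h1).neg
  simpa [Function.comp_def, toCube, expNeg, evalTest] using h2

open ContinuousMap in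
/-- Convergence of Laplace functionals implies weak convergence in the space of point measures.
The cube `[0, 1]^ℕ` being compact, convergence of the images there can be tested on polynomials
by the Stone–Weierstrass theorem; the integrals of monomials are Laplace functionals. The
convergence is pulled back through the open-set criterion of the portmanteau theorem, for which
the image of the space of point measures does not need to be closed. -/
theorem tendsto_integral_of_tendsto_laplace {Ω : Type*} [MeasurableSpace Ω] {P : Measure Ω}
    [IsProbabilityMeasure P] {M : ℕ → Ω → PointMeasure X} {M₀ : Ω → PointMeasure X}
    (hM : ∀ n, AEMeasurable (M n) P) (hM₀ : AEMeasurable M₀ P)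
    (h : ∀ φ : C_c(X, ℝ), 0 ≤ φ → Tendsto (fun n => ∫ ω, expNeg φ (M n ω) ∂P) atTop
      (𝓝 (∫ ω, expNeg φ (M₀ ω) ∂P)))
    (f : PointMeasure X →ᵇ ℝ) :
    Tendsto (fun n => ∫ ω, f (M n ω) ∂P) atTop (𝓝 (∫ ω, f (M₀ ω) ∂P)) := by
  let Q := testFunctions X → unitInterval
  have hι : Measurable (toCube (X := X)) := isInducing_toCube.continuous.measurable
  have hint : ∀ (g : C(Q, ℝ)) (V : Ω → PointMeasure X), AEMeasurable V P →
      Integrable (fun ω => g (toCube (V ω))) P := by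
    intro g V hV
    refine Integrable.of_bound (C := ‖g‖) ?_ (ae_of_all _ fun ω => g.norm_coe_le_norm _)
    exact (g.continuous.measurable.comp_aemeasurable
      (hι.comp_aemeasurable hV)).aestronglyMeasurable
  -- the continuous functions on the cube whose integrals converge
  let B : Submodule ℝ C(Q, ℝ) :=
    { carrier := {g | Tendsto (fun n => ∫ ω, g (toCube (M n ω)) ∂P) atTop
        (𝓝 (∫ ω, g (toCube (M₀ ω)) ∂P))}
      add_mem' := by
        intro g g' hg hg'
        simp only [Set.mem_ofPred_eq, ContinuousMap.add_apply] at hg hg' ⊢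
        simp only [integral_add (hint g _ (hM _)) (hint g' _ (hM _)),
          integral_add (hint g _ hM₀) (hint g' _ hM₀)]
        exact hg.add hg'
      zero_mem' := by simp
      smul_mem' := by
        intro a g hg
        simp only [Set.mem_ofPred_eq, ContinuousMap.smul_apply, smul_eq_mul,
          integral_const_mul] at hg ⊢
        exact hg.const_mul a }
  let S : Submonoid C(Q, ℝ) :=
    { carrier := {g | ∃ φ : C_c(X, ℝ), 0 ≤ φ ∧ ∀ m, g (toCube m) = expNeg φ m}
      one_mem' := ⟨0, le_rfl, fun m => by simp [expNeg_zero]⟩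
      mul_mem' := by
        rintro g g' ⟨φ, hφ, h1⟩ ⟨φ', hφ', h2⟩
        exact ⟨φ + φ', add_nonneg hφ hφ', fun m => by
          rw [ContinuousMap.mul_apply, h1, h2, expNeg_add]⟩ }
  have hAB : ∀ g ∈ Algebra.adjoin ℝ (S : Set C(Q, ℝ)), g ∈ B := by
    intro g hg
    have hg' : g ∈ Subalgebra.toSubmodule (Algebra.adjoin ℝ (S : Set C(Q, ℝ))) := hg
    rw [Algebra.adjoin_eq_span, Submonoid.closure_eq] at hg'
    refine Submodule.span_le.2 ?_ hg'
    rintro g ⟨φ, hφ, h1⟩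
    change Tendsto _ _ _
    simpa only [h1] using h φ hφ
  have hsep : (Algebra.adjoin ℝ (S : Set C(Q, ℝ))).SeparatesPoints := by
    intro x y hxy
    obtain ⟨φ, hφ⟩ := Function.ne_iff.1 hxy
    refine ⟨_, ⟨⟨fun q : Q => (q φ : ℝ), by fun_prop⟩, Algebra.subset_adjoin
      ⟨φ.1, testFunctions_nonneg φ.2, fun m => rfl⟩, rfl⟩, ?_⟩
    simpa [Subtype.ext_iff] using hφ
  have hall : ∀ g : C(Q, ℝ), Tendsto (fun n => ∫ ω, g (toCube (M n ω)) ∂P) atTop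
        (𝓝 (∫ ω, g (toCube (M₀ ω)) ∂P)) := by
    intro g
    rw [Metric.tendsto_nhds]
    intro δ hδ
    obtain ⟨g', hg'⟩ := exists_mem_subalgebra_near_continuousMap_of_separatesPoints _ hsep g
      (δ / 3) (by positivity)
    have hdist : ∀ V : Ω → PointMeasure X, AEMeasurable V P →
        |∫ ω, g'.1 (toCube (V ω)) ∂P - ∫ ω, g (toCube (V ω)) ∂P| ≤ δ / 3 := by
      intro V hV
      rw [← integral_sub (hint _ V hV) (hint g V hV), ← Real.norm_eq_abs]
      refine (norm_integral_le_of_norm_le_const (C := δ / 3) (ae_of_all _ fun ω => ?_)).trans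
        (by simp)
      exact ((g'.1 - g).norm_coe_le_norm _).trans hg'.le
    filter_upwards [Metric.tendsto_nhds.1 (hAB g'.1 g'.2) (δ / 3) (by positivity)] with n hn
    have h1 := hdist (M n) (hM n)
    have h2 := hdist M₀ hM₀
    rw [Real.dist_eq] at hn ⊢
    rw [abs_le] at h1 h2
    rw [abs_lt] at hn ⊢
    constructor <;> linarith [h1.1, h1.2, h2.1, h2.2, hn.1, hn.2]
  -- transfer to laws
  have hprob : ∀ V : Ω → PointMeasure X, AEMeasurable V P → IsProbabilityMeasure (P.map V) :=
    fun V hV => Measure.isProbabilityMeasure_map hV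
  let ν : ℕ → ProbabilityMeasure (PointMeasure X) := fun n => ⟨P.map (M n), hprob _ (hM n)⟩
  let ν₀ : ProbabilityMeasure (PointMeasure X) := ⟨P.map M₀, hprob _ hM₀⟩
  have hcube : Tendsto (fun n => (ν n).map hι.aemeasurable) atTop
      (𝓝 (ν₀.map hι.aemeasurable)) := by
    rw [ProbabilityMeasure.tendsto_iff_forall_integral_tendsto]
    intro g
    have e : ∀ V : Ω → PointMeasure X, AEMeasurable V P →
        ∫ q, g q ∂((P.map V).map toCube) = ∫ ω, g (toCube (V ω)) ∂P := by
      intro V hV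
      rw [AEMeasurable.map_map_of_aemeasurable hι.aemeasurable hV,
        integral_map (hι.comp_aemeasurable hV) g.continuous.measurable.aestronglyMeasurable]
      rfl
    have := hall g.toContinuousMap
    change Tendsto (fun n => ∫ q, g q ∂((P.map (M n)).map toCube)) atTop
      (𝓝 (∫ q, g q ∂((P.map M₀).map toCube)))
    simp only [e _ (hM _), e _ hM₀]
    exact this
  have hν : Tendsto ν atTop (𝓝 ν₀) := by
    refine tendsto_of_forall_isOpen_le_liminf' fun G hG => ?_
    obtain ⟨W, hW, rfl⟩ := isInducing_toCube.isOpen_iff.1 hG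
    have := ProbabilityMeasure.le_liminf_measure_open_of_tendsto hcube hW
    simpa only [ProbabilityMeasure.toMeasure_map, Measure.map_apply hι hW.measurableSet] using this
  have := ProbabilityMeasure.tendsto_iff_forall_integral_tendsto.1 hν f
  have e : ∀ V : Ω → PointMeasure X, AEMeasurable V P →
      ∫ m, f m ∂(P.map V) = ∫ ω, f (V ω) ∂P := fun V hV =>
    integral_map hV f.continuous.measurable.aestronglyMeasurable
  simpa only [ν, ν₀, ProbabilityMeasure.coe_mk, e _ (hM _), e _ hM₀] using this

end Laplace

end PointMeasure

/-! ### Point measures given by their points -/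

section OfMeasure

variable {X : Type*} [TopologicalSpace X] [MeasurableSpace X] {m : Measure X}

theorem PointMeasure.ofMeasure_val (h : IsRadonPointMeasure m) :
    (PointMeasure.ofMeasure m).1 = m :=
  congrArg Subtype.val (dif_pos h : PointMeasure.ofMeasure m = ⟨m, h⟩)

theorem PointMeasure.ofMeasure_val_of_not (h : ¬ IsRadonPointMeasure m) :
    (PointMeasure.ofMeasure m).1 = 0 :=
  congrArg Subtype.val (dif_neg h : PointMeasure.ofMeasure m = ⟨0, isRadonPointMeasure_zero X⟩)

/-- A point measure charging a set has an atom of mass at least one in it. -/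
theorem IsRadonPointMeasure.exists_mem_one_le (h : IsRadonPointMeasure m) {s : Set X}
    (hs : MeasurableSet s) (hm : m s ≠ 0) :
    ∃ p ∈ s, ∀ t, p ∈ t → 1 ≤ m t := by
  obtain ⟨-, S, x, rfl⟩ := h
  rw [Measure.sum_apply _ hs, Ne, ENNReal.tsum_eq_zero, not_forall] at hm
  obtain ⟨i, hi⟩ := hm
  have hxs : x i ∈ s := by
    by_contra hn
    exact hi (by rw [Measure.dirac_apply' _ hs, Set.indicator_of_notMem hn])
  refine ⟨x i, hxs, fun t ht => ?_⟩
  refine le_trans ?_ (Measure.le_sum_apply _ t)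
  refine le_trans ?_ (ENNReal.le_tsum i)
  rw [Measure.dirac_apply_of_mem ht]

end OfMeasure

section PosExt

variable {E : Type*} [TopologicalSpace E]

/-- Since `(0, ∞] × E` is open in `[0, ∞] × E`, its topology and its Borel sets are inherited from
there. -/
theorem isOpenEmbedding_posExt_prod :
    IsOpenEmbedding fun p : PosExt × E => ((p.1 : ℝ≥0∞), p.2) :=
  (isOpen_Ioi.isOpenEmbedding_subtypeVal (X := ℝ≥0∞)).prodMap .id

instance : LocallyCompactSpace PosExt :=
  (isOpen_Ioi : IsOpen {x : ℝ≥0∞ | 0 < x}).locallyCompactSpace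

instance : SecondCountableTopology PosExt :=
  TopologicalSpace.Subtype.secondCountableTopology {x : ℝ≥0∞ | 0 < x}

/-- Compact subsets of `(0, ∞] × E` stay away from level zero. -/
theorem exists_lt_of_isCompact {K : Set (PosExt × E)} (hK : IsCompact K) :
    ∃ a : ℝ≥0∞, 0 < a ∧ a < ∞ ∧ ∀ p ∈ K, a ≤ p.1 := by
  have h1 : IsCompact ((fun p : PosExt × E => (p.1 : ℝ≥0∞)) '' K) := hK.image (by fun_prop)
  have h2 : ((fun p : PosExt × E => (p.1 : ℝ≥0∞)) '' K)ᶜ ∈ 𝓝 (0 : ℝ≥0∞) := by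
    refine h1.isClosed.isOpen_compl.mem_nhds ?_
    rintro ⟨p, -, hp⟩
    exact p.1.2.ne' hp
  obtain ⟨a, ha, hsub⟩ := ENNReal.nhds_zero_basis.mem_iff.1 h2
  refine ⟨min a 1, lt_min ha one_pos, (min_le_right _ _).trans_lt ENNReal.one_lt_top,
    fun p hp => ?_⟩
  by_contra! h
  exact hsub (h.trans_le (min_le_left _ _)) ⟨p, hp, rfl⟩

theorem isCompact_Ici_prod {a : ℝ≥0∞} (ha : 0 < a) {K : Set E} (hK : IsCompact K) :
    IsCompact {p : PosExt × E | a ≤ p.1 ∧ p.2 ∈ K} := by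
  have h1 : IsCompact {x : PosExt | a ≤ x} := by
    rw [Subtype.isCompact_iff]
    have : (Subtype.val '' {x : PosExt | a ≤ x}) = Set.Ici a := by
      ext x
      simp only [Set.mem_image, Set.mem_ofPred_eq, Subtype.exists, exists_and_left,
        exists_prop, exists_eq_right_right, Set.mem_Ici]
      exact ⟨fun h => h.1, fun h => ⟨h, ha.trans_le h⟩⟩
    rw [this]
    exact isClosed_Ici.isCompact
  exact h1.prod hK

end PosExt

section ZeroExtend

variable {E : Type*} [TopologicalSpace E]

open Classical in
/-- The extension by zero of a test function on `(0, ∞] × E` to `[0, ∞] × E`. -/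
def zeroExtend (φ : C_c(PosExt × E, ℝ)) (p : ℝ≥0∞ × E) : ℝ :=
  if h : 0 < p.1 then φ (⟨p.1, h⟩, p.2) else 0

theorem zeroExtend_of_pos (φ : C_c(PosExt × E, ℝ)) {x : ℝ≥0∞} (hx : 0 < x) (u : E) :
    zeroExtend φ (x, u) = φ (⟨x, hx⟩, u) := dif_pos hx

theorem zeroExtend_nonneg {φ : C_c(PosExt × E, ℝ)} (hφ : 0 ≤ φ) (p : ℝ≥0∞ × E) :
    0 ≤ zeroExtend φ p := by
  unfold zeroExtend
  split_ifs with h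
  · exact hφ _
  · exact le_rfl

theorem exists_zeroExtend_eq_zero (φ : C_c(PosExt × E, ℝ)) :
    ∃ a : ℝ≥0∞, 0 < a ∧ a < ∞ ∧ ∀ p : ℝ≥0∞ × E, p.1 < a → zeroExtend φ p = 0 := by
  obtain ⟨a, h0, h1, ha⟩ := exists_lt_of_isCompact φ.hasCompactSupport
  refine ⟨a, h0, h1, fun p hp => ?_⟩
  unfold zeroExtend
  split_ifs with h
  · refine image_eq_zero_of_notMem_tsupport fun hm => ?_
    exact (ha _ hm).not_gt hp
  · rfl

theorem continuous_zeroExtend (φ : C_c(PosExt × E, ℝ)) : Continuous (zeroExtend φ) := by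
  rw [continuous_iff_continuousAt]
  rintro ⟨x, u⟩
  rcases eq_or_ne x 0 with rfl | hx
  · obtain ⟨a, h0, -, ha⟩ := exists_zeroExtend_eq_zero φ
    have : zeroExtend φ =ᶠ[𝓝 ((0 : ℝ≥0∞), u)] fun _ => 0 := by
      filter_upwards [(isOpen_Iio.preimage continuous_fst).mem_nhds
        (show ((0 : ℝ≥0∞), u) ∈ Prod.fst ⁻¹' Set.Iio a from h0)] with p hp
      exact ha p hp
    exact continuousAt_const.congr this.symm
  · have hx' : 0 < x := pos_iff_ne_zero.2 hx
    rw [← (isOpenEmbedding_posExt_prod (E := E)).continuousAt_iff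
      (x := ((⟨x, hx'⟩ : PosExt), u)) (g := zeroExtend φ)]
    have : (zeroExtend φ ∘ fun p : PosExt × E => ((p.1 : ℝ≥0∞), p.2)) = φ := by
      ext p
      exact zeroExtend_of_pos φ p.1.2 p.2
    rw [this]
    exact φ.continuous.continuousAt

end ZeroExtend

section PointSum

variable {E : Type*} [MeasurableSpace E]

theorem pointSum_apply {s : Set (PosExt × E)} (hs : MeasurableSet s) (I : Set ℕ) (x : ℕ → ℝ≥0∞)
    (u : ℕ → E) :
    pointSum I x u s = ∑' i, {i | i ∈ I ∧
      (x i, u i) ∈ (fun p : PosExt × E => ((p.1 : ℝ≥0∞), p.2)) '' s}.indicator 1 i := by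
  rw [pointSum, Measure.sum_apply _ hs]
  have e1 : ∀ i : {i : ℕ | i ∈ I ∧ 0 < x i},
      Measure.dirac ((⟨x i, i.2.2⟩ : PosExt), u i) s = {i | i ∈ I ∧
      (x i, u i) ∈ (fun p : PosExt × E => ((p.1 : ℝ≥0∞), p.2)) '' s}.indicator 1 (i : ℕ) := by
    rintro ⟨i, hiI, hi⟩
    rw [Measure.dirac_apply' _ hs]
    by_cases h : ((⟨x i, hi⟩ : PosExt), u i) ∈ s
    · rw [Set.indicator_of_mem h, Set.indicator_of_mem (show i ∈ {i | i ∈ I ∧ _} from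
        ⟨hiI, _, h, rfl⟩)]
      rfl
    · rw [Set.indicator_of_notMem h, Set.indicator_of_notMem]
      rintro ⟨-, p, hp, he⟩
      simp only [Prod.mk.injEq] at he
      have : p = ((⟨x i, hi⟩ : PosExt), u i) := Prod.ext (Subtype.ext he.1) he.2
      exact h (this ▸ hp)
  rw [tsum_congr e1, tsum_subtype {i : ℕ | i ∈ I ∧ 0 < x i} ({i | i ∈ I ∧
      (x i, u i) ∈ (fun p : PosExt × E => ((p.1 : ℝ≥0∞), p.2)) '' s}.indicator 1)]
  refine tsum_congr fun i => Set.indicator_apply_eq_self.2 fun hi => Set.indicator_of_notMem ?_ _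
  rintro ⟨h1, p, -, hp⟩
  refine hi ⟨h1, ?_⟩
  have h2 : (p.1 : ℝ≥0∞) = x i := congrArg Prod.fst hp
  exact h2 ▸ p.1.2

theorem pointSum_ne_zero_iff {s : Set (PosExt × E)} (hs : MeasurableSet s) (I : Set ℕ)
    (x : ℕ → ℝ≥0∞) (u : ℕ → E) :
    pointSum I x u s ≠ 0 ↔ ∃ i ∈ I, ∃ h : 0 < x i, ((⟨x i, h⟩ : PosExt), u i) ∈ s := by
  rw [pointSum_apply hs, Ne, ENNReal.tsum_eq_zero, not_forall]
  refine exists_congr fun i => ?_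
  simp only [Set.indicator_apply_eq_zero, Pi.one_apply, one_ne_zero, imp_false, not_not]
  constructor
  · rintro ⟨hi, p, hp, he⟩
    obtain ⟨h1, h2⟩ := Prod.mk.inj he
    refine ⟨hi, h1 ▸ p.1.2, ?_⟩
    convert hp
    · exact h1.symm
    · exact h2.symm
  · rintro ⟨hi, h, hp⟩
    exact ⟨hi, _, hp, rfl⟩

variable [TopologicalSpace E]

/-- A sum of unit masses with finitely many points above every positive level is Radon. -/
theorem isRadonPointMeasure_pointSum_of_finite {I : Set ℕ} {x : ℕ → ℝ≥0∞} (u : ℕ → E)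
    (h : ∀ a : ℝ≥0∞, 0 < a → {i | i ∈ I ∧ a ≤ x i}.Finite) :
    IsRadonPointMeasure (pointSum I x u) := by
  refine ⟨⟨fun K hK => ?_⟩, _, _, rfl⟩
  obtain ⟨a, ha, -, hKa⟩ := exists_lt_of_isCompact hK
  have hm : MeasurableSet {p : PosExt × E | a ≤ p.1} :=
    measurableSet_le measurable_const (measurable_subtype_coe.comp measurable_fst)
  have hsub : K ⊆ {p : PosExt × E | a ≤ p.1} := fun p hp => hKa p hp
  refine (measure_mono hsub).trans_lt ?_
  rw [pointSum_apply hm]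
  have hfin := h a ha
  calc ∑' i, {i | i ∈ I ∧ (x i, u i) ∈ (fun p : PosExt × E => ((p.1 : ℝ≥0∞), p.2)) ''
        {p : PosExt × E | a ≤ p.1}}.indicator (1 : ℕ → ℝ≥0∞) i
      ≤ ∑' i, {i | i ∈ I ∧ a ≤ x i}.indicator (1 : ℕ → ℝ≥0∞) i := by
        refine ENNReal.tsum_le_tsum fun i => Set.indicator_le_indicator_of_subset ?_
          (fun _ => zero_le) i
        rintro i ⟨hi, p, hp, he⟩
        have h2 : (p.1 : ℝ≥0∞) = x i := congrArg Prod.fst he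
        exact ⟨hi, h2 ▸ hp⟩
    _ < ∞ := by
        rw [← tsum_subtype]
        have := hfin.fintype
        rw [tsum_fintype]
        simp

variable [SecondCountableTopology E] [BorelSpace E]

theorem hasSum_integral_pointSum [T2Space E] {I : Set ℕ} {x : ℕ → ℝ≥0∞} {u : ℕ → E}
    (h : IsRadonPointMeasure (pointSum I x u)) (φ : C_c(PosExt × E, ℝ)) :
    HasSum (fun i => I.indicator (fun i => zeroExtend φ (x i, u i)) i)
      (∫ p, φ p ∂(pointSum I x u)) := by
  have hint : Integrable φ (pointSum I x u) :=
    PointMeasure.integrable (⟨_, h⟩ : PointMeasure (PosExt × E)) φ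
  have h1 := hasSum_integral_measure hint
  have e : (fun i : {i : ℕ | i ∈ I ∧ 0 < x i} =>
      ∫ p, φ p ∂(Measure.dirac ((⟨x i, i.2.2⟩ : PosExt), u i)))
      = (fun i => zeroExtend φ (x i, u i)) ∘ (↑) := by
    ext i
    rw [integral_dirac]
    exact (zeroExtend_of_pos φ i.2.2 _).symm
  rw [e, hasSum_subtype_iff_indicator] at h1
  convert! h1 using 1
  ext i
  by_cases hi : i ∈ I
  · by_cases hx : 0 < x i
    · rw [Set.indicator_of_mem hi, Set.indicator_of_mem (show i ∈ {i | i ∈ I ∧ 0 < x i} from ⟨hi, hx⟩)]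
    · rw [Set.indicator_of_mem hi, Set.indicator_of_notMem (fun h' => hx h'.2)]
      exact dif_neg hx
  · rw [Set.indicator_of_notMem hi, Set.indicator_of_notMem (fun h' => hi h'.1)]

variable {Ω : Type*} [MeasurableSpace Ω]

theorem measurable_pointSum {I : Ω → Set ℕ} {x : ℕ → Ω → ℝ≥0∞} {u : ℕ → Ω → E}
    (hI : ∀ i, MeasurableSet {ω | i ∈ I ω}) (hx : ∀ i, Measurable (x i))
    (hu : ∀ i, Measurable (u i)) :
    Measurable fun ω => pointSum (I ω) (fun i => x i ω) (fun i => u i ω) := by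
  refine Measure.measurable_of_measurable_coe _ fun s hs => ?_
  simp only [pointSum_apply hs]
  refine Measurable.tsum fun i => ?_
  have hemb : MeasurableEmbedding fun p : PosExt × E => ((p.1 : ℝ≥0∞), p.2) :=
    (isOpenEmbedding_posExt_prod (E := E)).measurableEmbedding
  have hS : MeasurableSet ({ω | i ∈ I ω} ∩ (fun ω => (x i ω, u i ω)) ⁻¹'
      ((fun p : PosExt × E => ((p.1 : ℝ≥0∞), p.2)) '' s)) :=
    (hI i).inter (((hx i).prodMk (hu i)) (hemb.measurableSet_image' hs))
  exact (measurable_one.indicator hS : Measurable (Set.indicator _ (1 : Ω → ℝ≥0∞)))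

variable [T2Space E] [LocallyCompactSpace E]

theorem measurableSet_isRadonPointMeasure_pointSum {I : Ω → Set ℕ} {x : ℕ → Ω → ℝ≥0∞}
    {u : ℕ → Ω → E} (hI : ∀ i, MeasurableSet {ω | i ∈ I ω}) (hx : ∀ i, Measurable (x i))
    (hu : ∀ i, Measurable (u i)) :
    MeasurableSet {ω | IsRadonPointMeasure
      (pointSum (I ω) (fun i => x i ω) (fun i => u i ω))} := by
  have hM := measurable_pointSum hI hx hu
  let K : CompactExhaustion (PosExt × E) := default
  have : {ω | IsRadonPointMeasure (pointSum (I ω) (fun i => x i ω) (fun i => u i ω))}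
      = ⋂ m, {ω | pointSum (I ω) (fun i => x i ω) (fun i => u i ω) (K m) < ∞} := by
    ext ω
    simp only [Set.mem_ofPred_eq, Set.mem_iInter]
    refine ⟨fun h m => h.1.1 (K.isCompact m), fun h => ⟨⟨fun C hC => ?_⟩, _, _, rfl⟩⟩
    obtain ⟨m, hm⟩ := K.exists_superset_of_isCompact hC
    exact (measure_mono hm).trans_lt (h m)
  rw [this]
  exact MeasurableSet.iInter fun m => measurableSet_lt
    ((Measure.measurable_coe (K.isCompact m).measurableSet).comp hM) measurable_const

/-- A random sum of unit masses with measurable positions is a random element of the space of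
point measures. -/
theorem measurable_ofMeasure_pointSum {I : Ω → Set ℕ} {x : ℕ → Ω → ℝ≥0∞} {u : ℕ → Ω → E}
    (hI : ∀ i, MeasurableSet {ω | i ∈ I ω}) (hx : ∀ i, Measurable (x i))
    (hu : ∀ i, Measurable (u i)) :
    Measurable fun ω =>
      PointMeasure.ofMeasure (pointSum (I ω) (fun i => x i ω) (fun i => u i ω)) := by
  classical
  have hM := measurable_pointSum hI hx hu
  have hR := measurableSet_isRadonPointMeasure_pointSum hI hx hu
  refine PointMeasure.measurable_of_integral fun φ hφ => ?_
  have e : (fun ω => ∫ p, φ p ∂(PointMeasure.ofMeasure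
      (pointSum (I ω) (fun i => x i ω) (fun i => u i ω))).1)
      = fun ω => if IsRadonPointMeasure (pointSum (I ω) (fun i => x i ω) (fun i => u i ω)) then
        (∫⁻ p, ENNReal.ofReal (φ p) ∂(pointSum (I ω) (fun i => x i ω) (fun i => u i ω))).toReal
        else 0 := by
    ext ω
    split_ifs with h
    · rw [PointMeasure.ofMeasure_val h, integral_eq_lintegral_of_nonneg_ae
        (ae_of_all _ hφ) φ.continuous.aestronglyMeasurable]
    · rw [PointMeasure.ofMeasure_val_of_not h, integral_zero_measure]
  rw [e]
  refine Measurable.ite hR (ENNReal.measurable_toReal.comp ?_) measurable_const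
  exact (Measure.measurable_lintegral φ.continuous.measurable.ennreal_ofReal).comp hM

end PointSum

/-! ### Sup-measures as continuous images of point measures -/

namespace SupMeasure

variable {E : Type*} [TopologicalSpace E]

theorem ext_onOpen {m m' : SupMeasure E} (h : ∀ G, m.onOpen G = m'.onOpen G) : m = m' := by
  cases m
  cases m'
  congr 1
  exact funext h

theorem onSet_lt_iff (m : SupMeasure E) {A : Set E} {x : ℝ≥0∞} :
    m.onSet A < x ↔ ∃ G : TopologicalSpace.Opens E, A ⊆ G ∧ m.onOpen G < x := by
  simp [onSet, iInf_lt_iff]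

theorem smul_onOpen (a : ℝ≥0∞) (m : SupMeasure E) (G : TopologicalSpace.Opens E) :
    (a • m).onOpen G = a * m.onOpen G := rfl

instance : BorelSpace (SupMeasure E) := ⟨rfl⟩

end SupMeasure

section SupMap

variable {E : Type*}

/-- The open set `(y, ∞] × G` of `(0, ∞] × E`. -/
def aboveSet (y : ℝ≥0∞) (G : Set E) : Set (PosExt × E) := {p | y < p.1 ∧ p.2 ∈ G}

variable [MeasurableSpace E]

/-- The supremum of the first coordinates of the points of `m` whose second coordinate is
in `G`. -/
def supValue (m : Measure (PosExt × E)) (G : Set E) : ℝ≥0∞ := sSup {y | m (aboveSet y G) ≠ 0}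

theorem lt_supValue_iff {m : Measure (PosExt × E)} {G : Set E} {y : ℝ≥0∞} :
    y < supValue m G ↔ m (aboveSet y G) ≠ 0 := by
  constructor
  · intro h
    obtain ⟨z, hz, hyz⟩ := lt_sSup_iff.1 h
    intro h0
    have hsub : aboveSet z G ⊆ aboveSet y G := fun p hp => ⟨hyz.trans hp.1, hp.2⟩
    exact hz (measure_mono_null hsub h0)
  · intro h
    have hy : y < ∞ := by
      obtain ⟨p, hp⟩ := nonempty_of_measure_ne_zero h
      exact hp.1.trans_le le_top
    obtain ⟨v, -, hv, hlim⟩ := exists_seq_strictAnti_tendsto' hy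
    have hU : aboveSet y G = ⋃ n, aboveSet (v n) G := by
      ext p
      simp only [aboveSet, Set.mem_ofPred_eq, Set.mem_iUnion]
      constructor
      · rintro ⟨h1, h2⟩
        obtain ⟨n, hn⟩ := (hlim.eventually (gt_mem_nhds h1)).exists
        exact ⟨n, hn, h2⟩
      · rintro ⟨n, h2, h3⟩
        exact ⟨(hv n).1.trans h2, h3⟩
    rw [hU, Ne, measure_iUnion_null_iff, not_forall] at h
    obtain ⟨n, hn⟩ := h
    exact (hv n).1.trans_le (le_sSup hn)

variable [TopologicalSpace E]

omit [MeasurableSpace E] in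
theorem isOpen_aboveSet (y : ℝ≥0∞) {G : Set E} (hG : IsOpen G) : IsOpen (aboveSet y G) :=
  (isOpen_lt continuous_const (continuous_subtype_val.comp continuous_fst)).inter
    (hG.preimage continuous_snd)

variable [SecondCountableTopology E]

/-- The map which sends a point measure on `(0, ∞] × E` to the sup-measure
`G ↦ sup {x : (x, u) is a point, u ∈ G}`. -/
def PointMeasure.toSup (m : PointMeasure (PosExt × E)) : SupMeasure E where
  onOpen G := supValue m.1 G
  onOpen_sSup S := by
    refine eq_of_forall_lt_iff fun y => ?_
    simp only [lt_iSup_iff, lt_supValue_iff, exists_prop]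
    rw [← not_iff_not]
    push Not
    have : aboveSet y (sSup S : TopologicalSpace.Opens E)
        = ⋃₀ ((fun G : TopologicalSpace.Opens E => aboveSet y (G : Set E)) '' S) := by
      ext p
      simp only [aboveSet, SetLike.mem_coe, TopologicalSpace.Opens.mem_sSup, Set.mem_ofPred_eq,
        Set.sUnion_image, Set.mem_iUnion, exists_prop]
      tauto
    rw [this]
    constructor
    · intro h G hG
      exact measure_mono_null (Set.subset_sUnion_of_mem (Set.mem_image_of_mem
        (fun G : TopologicalSpace.Opens E => aboveSet y (G : Set E)) hG)) h
    · intro h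
      obtain ⟨T, hTc, hTS, hT⟩ := TopologicalSpace.isOpen_sUnion_countable
        ((fun G : TopologicalSpace.Opens E => aboveSet y (G : Set E)) '' S)
        (by rintro _ ⟨G, -, rfl⟩; exact isOpen_aboveSet y G.2)
      rw [← hT, measure_sUnion_null_iff hTc]
      intro s hs
      obtain ⟨G, hG, rfl⟩ := hTS hs
      exact h G hG

theorem PointMeasure.toSup_onOpen (m : PointMeasure (PosExt × E))
    (G : TopologicalSpace.Opens E) : m.toSup.onOpen G = supValue m.1 G := rfl

variable [BorelSpace E]

theorem toSup_ofMeasure_pointSum {I : Set ℕ} {x : ℕ → ℝ≥0∞} {u : ℕ → E}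
    (h : IsRadonPointMeasure (pointSum I x u)) :
    (PointMeasure.ofMeasure (pointSum I x u)).toSup = supOfPoints I x u := by
  refine SupMeasure.ext_onOpen fun G => eq_of_forall_lt_iff fun y => ?_
  rw [PointMeasure.toSup_onOpen, lt_supValue_iff, PointMeasure.ofMeasure_val h,
    pointSum_ne_zero_iff (isOpen_aboveSet y G.isOpen).measurableSet]
  simp only [supOfPoints, lt_iSup_iff, aboveSet, Set.mem_ofPred_eq, exists_prop]
  constructor
  · rintro ⟨i, hi, h0, h1, h2⟩
    exact ⟨i, ⟨hi, h2⟩, h1⟩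
  · rintro ⟨i, ⟨hi, h2⟩, h1⟩
    exact ⟨i, hi, pos_of_gt h1, h1, h2⟩

variable [T2Space E] [LocallyCompactSpace E]

/-- The map to sup-measures is continuous, since `[y, ∞] × K` is compact in `(0, ∞] × E`. -/
theorem continuous_toSup : Continuous (PointMeasure.toSup (E := E)) := by
  refine continuous_generateFrom_iff.2 ?_
  rintro _ (⟨K, x, hK, rfl⟩ | ⟨G, x, rfl⟩)
  · refine isOpen_iff_mem_nhds.2 fun m₀ hm₀ => ?_
    obtain ⟨G, hKG, hG⟩ := (SupMeasure.onSet_lt_iff _).1 hm₀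
    obtain ⟨y, hy1, hy2⟩ := exists_between hG
    obtain ⟨z, hz1, hz2⟩ := exists_between hy1
    have h0 : m₀.1 (aboveSet z G) = 0 := by
      by_contra h
      exact (lt_supValue_iff.2 h).not_gt hz1
    obtain ⟨K', hK', hKK', hK'G⟩ := exists_compact_between hK G.2 hKG
    obtain ⟨φ, hφ1, hφc, hφs, hφ01⟩ := exists_continuousMap_one_of_isCompact_subset_isOpen
      (isCompact_Ici_prod (pos_of_gt hz2) hK') (isOpen_aboveSet z G.2)
      (fun p hp => ⟨hz2.trans_le hp.1, hK'G hp.2⟩)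
    let ψ : C_c(PosExt × E, ℝ) := ⟨φ, hφc⟩
    have hψ0 : ∫ p, ψ p ∂m₀.1 = 0 := by
      refine integral_eq_zero_of_ae ?_
      have : ∀ᵐ p ∂m₀.1, p ∉ aboveSet z (G : Set E) := measure_eq_zero_iff_ae_notMem.1 h0
      filter_upwards [this] with p hp
      exact image_eq_zero_of_notMem_tsupport fun h => hp (hφs h)
    filter_upwards [(PointMeasure.continuous_integral ψ).continuousAt.preimage_mem_nhds
      (Iio_mem_nhds (show ∫ p, ψ p ∂m₀.1 < 1 by rw [hψ0]; exact one_pos))] with m hm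
    refine (SupMeasure.onSet_lt_iff _).2 ⟨⟨interior K', isOpen_interior⟩, hKK', ?_⟩
    refine lt_of_le_of_lt ?_ hy2
    rw [PointMeasure.toSup_onOpen]
    by_contra! hlt
    have hne := lt_supValue_iff.1 hlt
    obtain ⟨p, hp, hp1⟩ := m.2.exists_mem_one_le
      (isOpen_aboveSet y isOpen_interior).measurableSet hne
    -- the atom `p` contributes at least one to the integral of the test function
    have hC : MeasurableSet {p : PosExt × E | y ≤ p.1 ∧ p.2 ∈ K'} :=
      (isCompact_Ici_prod (pos_of_gt hz2) hK').measurableSet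
    have h1 : (1 : ℝ) ≤ m.1.real {p : PosExt × E | y ≤ p.1 ∧ p.2 ∈ K'} := by
      have := hp1 {p : PosExt × E | y ≤ p.1 ∧ p.2 ∈ K'} ⟨hp.1.le, interior_subset hp.2⟩
      have hfin := (isCompact_Ici_prod (pos_of_gt hz2) hK').measure_lt_top (μ := m.1)
      rw [Measure.real, ← ENNReal.toReal_one]
      exact ENNReal.toReal_mono hfin.ne this
    have h2 : m.1.real {p : PosExt × E | y ≤ p.1 ∧ p.2 ∈ K'} ≤ ∫ p, ψ p ∂m.1 := by
      rw [← integral_indicator_one hC]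
      refine integral_mono_of_nonneg (ae_of_all _ fun p => Set.indicator_nonneg (by simp) p)
        (m.integrable ψ) (ae_of_all _ fun p => ?_)
      by_cases hp : p ∈ {p : PosExt × E | y ≤ p.1 ∧ p.2 ∈ K'}
      · rw [Set.indicator_of_mem hp]
        exact (hφ1 hp).ge
      · rw [Set.indicator_of_notMem hp]
        exact (hφ01 p).1
    exact absurd hm (not_lt.2 (h1.trans h2))
  · refine isOpen_iff_mem_nhds.2 fun m₀ hm₀ => ?_
    have hm₀' : x < supValue m₀.1 G := hm₀
    have hne := lt_supValue_iff.1 hm₀'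
    obtain ⟨p, hp, hp1⟩ := m₀.2.exists_mem_one_le (isOpen_aboveSet x G.2).measurableSet hne
    obtain ⟨φ, hφ1, hφc, hφs, hφ01⟩ := exists_continuousMap_one_of_isCompact_subset_isOpen
      (isCompact_singleton (x := p)) (isOpen_aboveSet x G.2) (Set.singleton_subset_iff.2 hp)
    let ψ : C_c(PosExt × E, ℝ) := ⟨φ, hφc⟩
    have hpos : ∀ m : PointMeasure (PosExt × E),
        0 < ∫ p, ψ p ∂m.1 ↔ 0 < m.1 (Function.support ψ) := fun m =>
      integral_pos_iff_support_of_nonneg (fun p => (hφ01 p).1) (m.integrable ψ)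
    have hm : 0 < ∫ p, ψ p ∂m₀.1 := by
      refine (hpos m₀).2 (one_pos.trans_le (hp1 _ ?_))
      rw [Function.mem_support]
      exact (hφ1 rfl).trans_ne one_ne_zero
    filter_upwards [(PointMeasure.continuous_integral ψ).continuousAt.preimage_mem_nhds
      (Ioi_mem_nhds hm)] with m hm
    refine lt_supValue_iff.2 fun h0 => ((hpos m).1 hm).ne' ?_
    exact measure_mono_null ((subset_tsupport _).trans hφs) h0

end SupMap

/-! ### Independence, freezing and Poisson sample sizes -/

section Independence

variable {Ω S S' : Type*} [MeasurableSpace Ω] [MeasurableSpace S] [MeasurableSpace S']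
  {P : Measure Ω} [IsProbabilityMeasure P] {X : Ω → S} {Y : Ω → S'}

theorem integral_of_indepFun (hX : Measurable X) (hY : Measurable Y) (h : IndepFun X Y P)
    {H : S × S' → ℝ} (hH : Measurable H) {C : ℝ} (hC : ∀ p, |H p| ≤ C) :
    ∫ ω, H (X ω, Y ω) ∂P = ∫ ω, ∫ ω', H (X ω, Y ω') ∂P ∂P := by
  have := Measure.isProbabilityMeasure_map (μ := P) hX.aemeasurable
  have := Measure.isProbabilityMeasure_map (μ := P) hY.aemeasurable
  have hint : Integrable H ((P.map X).prod (P.map Y)) :=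
    Integrable.of_bound hH.aestronglyMeasurable C (ae_of_all _ hC)
  have e1 : ∫ ω, H (X ω, Y ω) ∂P = ∫ p, H p ∂(P.map fun ω => (X ω, Y ω)) :=
    (integral_map (hX.prodMk hY).aemeasurable hH.aestronglyMeasurable).symm
  rw [e1, (indepFun_iff_map_prod_eq_prod_map_map hX.aemeasurable hY.aemeasurable).1 h,
    integral_prod _ hint, integral_map hX.aemeasurable]
  · congr 1 with ω
    exact integral_map hY.aemeasurable
      (hH.comp measurable_prodMk_left).aestronglyMeasurable
  · exact hint.integral_prod_left.aestronglyMeasurable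

theorem measurable_integral_prodMk (hY : Measurable Y) {H : S × S' → ℝ} (hH : Measurable H) :
    Measurable fun x => ∫ ω, H (x, Y ω) ∂P := by
  have : StronglyMeasurable fun p : S × Ω => H (p.1, Y p.2) :=
    (hH.comp (measurable_fst.prodMk (hY.comp measurable_snd))).stronglyMeasurable
  exact this.integral_prod_right.measurable

/-- Conditional expectation given `X` of a function of `X` and of an independent `Y`: freeze `X`
and integrate over `Y`. -/
theorem condExp_of_indepFun (hX : Measurable X) (hY : Measurable Y) (h : IndepFun X Y P)
    {H : S × S' → ℝ} (hH : Measurable H) {C : ℝ} (hC : ∀ p, |H p| ≤ C) :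
    P[fun ω => H (X ω, Y ω) | MeasurableSpace.comap X inferInstance]
      =ᵐ[P] fun ω => ∫ ω', H (X ω, Y ω') ∂P := by
  symm
  have hG : Measurable fun x => ∫ ω', H (x, Y ω') ∂P := measurable_integral_prodMk hY hH
  have hGC : ∀ x, ‖∫ ω', H (x, Y ω') ∂P‖ ≤ C := fun x => by
    refine (norm_integral_le_of_norm_le_const (ae_of_all _ fun ω' => hC _)).trans ?_
    simp
  refine ae_eq_condExp_of_forall_setIntegral_eq hX.comap_le ?_ ?_ ?_ ?_
  · exact Integrable.of_bound (hH.comp (hX.prodMk hY)).aestronglyMeasurable C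
      (ae_of_all _ fun ω => hC _)
  · intro s _ _
    exact (Integrable.of_bound (hG.comp hX).aestronglyMeasurable C
      (ae_of_all _ fun ω => hGC _)).integrableOn
  · rintro _ ⟨t, ht, rfl⟩ -
    rw [← integral_indicator (hX ht), ← integral_indicator (hX ht)]
    have hH' : Measurable ((t ×ˢ Set.univ).indicator H) := hH.indicator (ht.prod .univ)
    have hC' : ∀ p, |(t ×ˢ Set.univ).indicator H p| ≤ C := fun p =>
      (norm_indicator_le_norm_self H p).trans (hC p)
    have e := integral_of_indepFun hX hY h hH' hC'
    have e1 : ∀ ω, ((X ⁻¹' t).indicator (fun ω => H (X ω, Y ω)) ω)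
        = (t ×ˢ Set.univ).indicator H (X ω, Y ω) := by
      intro ω
      by_cases hω : X ω ∈ t <;> simp [hω]
    have e2 : ∀ ω, ((X ⁻¹' t).indicator (fun ω => ∫ ω', H (X ω, Y ω') ∂P) ω)
        = ∫ ω', (t ×ˢ Set.univ).indicator H (X ω, Y ω') ∂P := by
      intro ω
      by_cases hω : X ω ∈ t <;> simp [hω]
    simp only [e1, e2]
    exact e.symm
  · exact (hG.comp (comap_measurable X)).stronglyMeasurable.aestronglyMeasurable

theorem condLExp_of_indepFun (hX : Measurable X) (hY : Measurable Y) (h : IndepFun X Y P)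
    {H : S × S' → ℝ≥0∞} (hH : Measurable H) :
    condLExp (MeasurableSpace.comap X inferInstance) P (fun ω => H (X ω, Y ω))
      =ᵐ[P] fun ω => ∫⁻ ω', H (X ω, Y ω') ∂P := by
  symm
  have hG : Measurable fun x => ∫⁻ ω', H (x, Y ω') ∂P :=
    (hH.comp (measurable_fst.prodMk (hY.comp measurable_snd))).lintegral_prod_right'
  refine ae_eq_condLExp (hm := hX.comap_le) P _ (hG.comp (comap_measurable X)) ?_
  rintro _ ⟨t, ht, rfl⟩
  rw [← lintegral_indicator (hX ht), ← lintegral_indicator (hX ht)]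
  have hH' : Measurable ((t ×ˢ Set.univ).indicator H) := hH.indicator (ht.prod .univ)
  have e1 : ∀ ω, ((X ⁻¹' t).indicator (fun ω => H (X ω, Y ω)) ω)
      = (t ×ˢ Set.univ).indicator H (X ω, Y ω) := by
    intro ω
    by_cases hω : X ω ∈ t <;> simp [hω]
  have e2 : ∀ ω, ((X ⁻¹' t).indicator (fun ω => ∫⁻ ω', H (X ω, Y ω') ∂P) ω)
      = ∫⁻ ω', (t ×ˢ Set.univ).indicator H (X ω, Y ω') ∂P := by
    intro ω
    by_cases hω : X ω ∈ t <;> simp [hω]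
  have := Measure.isProbabilityMeasure_map (μ := P) hX.aemeasurable
  have := Measure.isProbabilityMeasure_map (μ := P) hY.aemeasurable
  simp only [e1, e2]
  have e3 : ∫⁻ ω, (t ×ˢ Set.univ).indicator H (X ω, Y ω) ∂P
      = ∫⁻ p, (t ×ˢ Set.univ).indicator H p ∂(P.map fun ω => (X ω, Y ω)) :=
    (lintegral_map hH' (hX.prodMk hY)).symm
  rw [e3, (indepFun_iff_map_prod_eq_prod_map_map hX.aemeasurable hY.aemeasurable).1 h,
    lintegral_prod _ hH'.aemeasurable, lintegral_map hH'.lintegral_prod_right' hX]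
  refine lintegral_congr fun ω => ?_
  exact (lintegral_map (hH'.comp measurable_prodMk_left) hY).symm

omit [IsProbabilityMeasure P] in
theorem indep_of_iIndep {ι : Type*} {m : ι → MeasurableSpace Ω} (hm : ∀ i, m i ≤ ‹_›)
    (h : iIndep m P) {A B : Set ι} (hAB : Disjoint A B) {m₁ m₂ : MeasurableSpace Ω}
    (h₁ : m₁ ≤ ⨆ i ∈ A, m i) (h₂ : m₂ ≤ ⨆ i ∈ B, m i) : Indep m₁ m₂ P :=
  indep_of_indep_of_le_right (indep_of_indep_of_le_left (indep_iSup_of_disjoint hm h hAB) h₁) h₂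

/-- Two independent families, each i.i.d., give an i.i.d. family of pairs. -/
theorem IsIID.prodMk {X : ℕ → Ω → S} {Y : ℕ → Ω → S'} (hX : IsIID X P) (hY : IsIID Y P)
    (h : Indep (sigmaOf X) (sigmaOf Y) P) : IsIID (fun i ω => (X i ω, Y i ω)) P := by
  have hXY : ∀ i j, IndepFun (X i) (Y j) P := fun i j =>
    IndepFun.comp (f := fun ω i => X i ω) (g := fun ω i => Y i ω)
      (φ := fun x => x i) (ψ := fun y => y j) h (measurable_pi_apply i) (measurable_pi_apply j)
  have hmap : ∀ i, P.map (fun ω => (X i ω, Y i ω)) = (P.map (X i)).prod (P.map (Y i)) := fun i =>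
    (indepFun_iff_map_prod_eq_prod_map_map (hX.measurable i).aemeasurable
      (hY.measurable i).aemeasurable).1 (hXY i i)
  refine ⟨fun i => (hX.measurable i).prodMk (hY.measurable i), ?_, fun i => ⟨?_, ?_, ?_⟩⟩
  · let R : Set (Set (S × S')) :=
      Set.image2 (fun s t => s ×ˢ t) {s | MeasurableSet s} {t | MeasurableSet t}
    rw [iIndepFun_iff_iIndep]
    refine iIndepSets.iIndep (fun i => ((hX.measurable i).prodMk (hY.measurable i)).comap_le)
      (fun i => Set.preimage (fun ω => (X i ω, Y i ω)) '' R) (fun i => ?_) (fun i => ?_) ?_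
    · rintro _ ⟨s, hs, rfl⟩ _ ⟨t, ht, rfl⟩ hst
      refine ⟨s ∩ t, isPiSystem_prod s hs t ht ?_, rfl⟩
      obtain ⟨ω, hω⟩ := hst
      exact ⟨_, hω⟩
    · rw [← MeasurableSpace.comap_generateFrom, generateFrom_prod]
    · rw [iIndepSets_iff]
      intro s f hf
      have hf' : ∀ i : ℕ, ∃ A : Set S, ∃ B : Set S', MeasurableSet A ∧ MeasurableSet B ∧
          (i ∈ s → f i = X i ⁻¹' A ∩ Y i ⁻¹' B) := by
        intro i
        by_cases hi : i ∈ s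
        · obtain ⟨_, ⟨A, hA, B, hB, rfl⟩, he⟩ := hf i hi
          exact ⟨A, B, hA, hB, fun _ => he.symm⟩
        · exact ⟨∅, ∅, .empty, .empty, fun h => absurd h hi⟩
      choose A B hA hB he using hf'
      have h1 : (⋂ i ∈ s, f i) = (⋂ i ∈ s, X i ⁻¹' A i) ∩ ⋂ i ∈ s, Y i ⁻¹' B i := by
        simp only [← Set.iInter_inter_distrib]
        exact Set.iInter₂_congr fun i hi => he i hi
      have hmX : MeasurableSet[sigmaOf X] (⋂ i ∈ s, X i ⁻¹' A i) := by
        refine s.measurableSet_biInter fun i _ => ?_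
        exact ⟨(fun x => x i) ⁻¹' A i, measurable_pi_apply i (hA i), rfl⟩
      have hmY : MeasurableSet[sigmaOf Y] (⋂ i ∈ s, Y i ⁻¹' B i) := by
        refine s.measurableSet_biInter fun i _ => ?_
        exact ⟨(fun x => x i) ⁻¹' B i, measurable_pi_apply i (hB i), rfl⟩
      rw [h1, (Indep_iff _ _ _).1 h _ _ hmX hmY,
        hX.indep.meas_biInter (fun i _ => ⟨A i, hA i, rfl⟩),
        hY.indep.meas_biInter (fun i _ => ⟨B i, hB i, rfl⟩), ← Finset.prod_mul_distrib]
      refine Finset.prod_congr rfl fun i hi => ?_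
      rw [he i hi, (hXY i i).measure_inter_preimage_eq_mul _ _ (hA i) (hB i)]
  · exact ((hX.measurable i).prodMk (hY.measurable i)).aemeasurable
  · exact ((hX.measurable 0).prodMk (hY.measurable 0)).aemeasurable
  · rw [hmap, hmap, (hX.identDistrib i).map_eq, (hY.identDistrib i).map_eq]

omit [IsProbabilityMeasure P] in
theorem IsIID.comp {X : ℕ → Ω → S} (hX : IsIID X P) {f : S → S'} (hf : Measurable f) :
    IsIID (fun i ω => f (X i ω)) P :=
  ⟨fun i => hf.comp (hX.measurable i), hX.indep.comp (fun _ => f) (fun _ => hf),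
    fun i => (hX.identDistrib i).comp hf⟩

omit [IsProbabilityMeasure P] in
theorem IsIID.measurable_seq {X : ℕ → Ω → S} (hX : IsIID X P) : Measurable fun ω i => X i ω :=
  measurable_pi_lambda _ hX.measurable

omit [MeasurableSpace Ω] in
theorem sigmaOf_prodMk_le (X : ℕ → Ω → S) (Y : ℕ → Ω → S') :
    sigmaOf (fun i ω => (X i ω, Y i ω)) ≤ sigmaOf X ⊔ sigmaOf Y := by
  rw [sigmaOf, sigmaOf, sigmaOf, ← MeasurableSpace.comap_prodMk, ← measurable_iff_comap_le]
  refine Measurable.comp (g := fun (p : (ℕ → S) × (ℕ → S')) i => (p.1 i, p.2 i)) ?_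
    (comap_measurable _)
  fun_prop

omit [MeasurableSpace Ω] in
theorem sigmaOf_comp_le (X : ℕ → Ω → S) {f : S → S'} (hf : Measurable f) :
    sigmaOf (fun i ω => f (X i ω)) ≤ sigmaOf X := by
  rw [sigmaOf, ← measurable_iff_comap_le]
  refine Measurable.comp (g := fun (x : ℕ → S) i => f (x i)) ?_ (comap_measurable _)
  fun_prop

omit [IsProbabilityMeasure P] in
theorem IsIID.integral_comp {X : ℕ → Ω → S} (hX : IsIID X P) {f : S → ℝ} (hf : Measurable f)
    (i : ℕ) : ∫ ω, f (X i ω) ∂P = ∫ ω, f (X 0 ω) ∂P :=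
  ((hX.identDistrib i).comp hf).integral_eq

omit [IsProbabilityMeasure P] in
theorem IsIID.integral_prod_range {X : ℕ → Ω → S} (hX : IsIID X P) {f : S → ℝ}
    (hf : Measurable f) (n : ℕ) :
    ∫ ω, ∏ i ∈ Finset.range n, f (X i ω) ∂P = (∫ ω, f (X 0 ω) ∂P) ^ n := by
  have h1 : iIndepFun (fun (i : Fin n) ω => X i ω) P := hX.indep.precomp Fin.val_injective
  have h2 := h1.integral_fun_prod_comp (f := fun _ => f)
    (fun i => (hX.measurable i).aemeasurable) (fun i => hf.aestronglyMeasurable)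
  simp only [hX.integral_comp hf, Finset.prod_const, Finset.card_univ, Fintype.card_fin] at h2
  rw [← h2]
  congr 1 with ω
  exact Finset.prod_range fun i => f (X i ω)

end Independence

section PoissonSample

variable {Ω S : Type*} [MeasurableSpace Ω] [MeasurableSpace S]
  {P : Measure Ω} [IsProbabilityMeasure P]

/-- The Laplace functional of a sample of Poisson size. -/
theorem integral_prod_range_poisson {V : ℕ → Ω → S} (hV : IsIID V P) {N : Ω → ℕ}
    (hN : Measurable N) {r : ℝ≥0} (hNr : P.map N = poissonMeasure r)
    (h : IndepFun N (fun ω i => V i ω) P) {g : S → ℝ} (hg : Measurable g)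
    (hg0 : ∀ s, 0 ≤ g s) (hg1 : ∀ s, g s ≤ 1) :
    ∫ ω, ∏ i ∈ Finset.range (N ω), g (V i ω) ∂P
      = Real.exp (-(r * (1 - ∫ ω, g (V 0 ω) ∂P))) := by
  have hH : Measurable fun p : ℕ × (ℕ → S) => ∏ i ∈ Finset.range p.1, g (p.2 i) := by
    refine measurable_from_prod_countable_right fun n => ?_
    exact Finset.measurable_fun_prod (f := fun i (y : ℕ → S) => g (y i)) (Finset.range n)
      fun i _ => hg.comp (measurable_pi_apply i)
  rw [integral_of_indepFun (H := fun p : ℕ × (ℕ → S) => ∏ i ∈ Finset.range p.1, g (p.2 i))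
    hN hV.measurable_seq h hH (C := 1)]
  · simp only [hV.integral_prod_range hg]
    set m := ∫ ω, g (V 0 ω) ∂P
    rw [← integral_map (f := fun n : ℕ => m ^ n) hN.aemeasurable
      (measurable_of_countable _).aestronglyMeasurable, hNr, integral_poissonMeasure]
    have h1 : HasSum (fun n : ℕ => (r * m) ^ n / (n.factorial : ℝ)) (Real.exp (r * m)) := by
      rw [Real.exp_eq_exp_ℝ]
      exact NormedSpace.expSeries_div_hasSum_exp (r * m)
    have h2 := (h1.mul_left (Real.exp (-r))).tsum_eq
    rw [show -((r : ℝ) * (1 - m)) = -r + r * m by ring, Real.exp_add, ← h2]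
    refine tsum_congr fun n => ?_
    rw [smul_eq_mul, mul_pow]
    ring
  · intro p
    rw [abs_of_nonneg (Finset.prod_nonneg fun i _ => hg0 _)]
    exact Finset.prod_le_one (fun i _ => hg0 _) fun i _ => hg1 _

end PoissonSample

/-! ### Laplace functionals of marked Poisson arrival times -/

section ArrivalTimes

open Set

/-- For the cumulative tail `K s = ∫_s^∞ k` of a function `0 ≤ k ≤ 1` on `(0, ∞)`, the function
`F = exp (-K)` is a fixed point of the operator which waits for an exponential time:
`F s = E[(1 - k (s + τ)) F (s + τ)]`. -/
theorem integral_exp_fixedPoint {k : ℝ → ℝ} (hkc : ContinuousOn k (Ioi 0))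
    (hki : IntegrableOn k (Ioi 0)) (hk0 : ∀ t, 0 ≤ k t) (hk1 : ∀ t, k t ≤ 1) {s : ℝ}
    (hs : 0 ≤ s) :
    ∫ t in Ioi 0, Real.exp (-t) * ((1 - k (s + t)) * Real.exp (-∫ v in Ioi (s + t), k v))
      = Real.exp (-∫ v in Ioi s, k v) := by
  have hII : ∀ a b : ℝ, 0 ≤ a → a ≤ b → IntervalIntegrable k volume a b := fun a b ha hab => by
    rw [intervalIntegrable_iff_integrableOn_Ioc_of_le hab]
    exact hki.mono_set fun x hx => ha.trans_lt hx.1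
  have hK : ∀ v, 0 ≤ v → ∫ x in Ioi v, k x = (∫ x in Ioi 0, k x) - ∫ x in (0 : ℝ)..v, k x := by
    intro v hv
    rw [eq_sub_iff_add_eq, add_comm, intervalIntegral.integral_of_le hv,
      ← setIntegral_union Ioc_disjoint_Ioi_same measurableSet_Ioi
        (hki.mono_set Ioc_subset_Ioi_self) (hki.mono_set (Ioi_subset_Ioi hv)),
      Ioc_union_Ioi_eq_Ioi hv]
  have hKn : ∀ v, 0 ≤ ∫ x in Ioi v, k x := fun v => integral_nonneg fun x => hk0 x
  have hcont : ContinuousOn (fun v => ∫ x in Ioi v, k x) (Ici 0) := by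
    have h1 : ContinuousOn (fun v => (∫ x in Ioi 0, k x) - ∫ x in (0 : ℝ)..v, k x) (Ici 0) := by
      refine continuousOn_const.sub fun v hv => ?_
      have h2 := intervalIntegral.continuousOn_primitive_interval (μ := volume) (f := k) (a := 0)
        (b := v + 1) (by
          rw [uIcc_of_le (by linarith [mem_Ici.1 hv]), integrableOn_Icc_iff_integrableOn_Ioc]
          exact hki.mono_set Ioc_subset_Ioi_self)
      rw [uIcc_of_le (by linarith [mem_Ici.1 hv])] at h2
      refine (h2 v ⟨hv, by linarith⟩).mono_of_mem_nhdsWithin ?_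
      rw [← Ici_inter_Iic]
      exact inter_mem self_mem_nhdsWithin (mem_nhdsWithin_of_mem_nhds (Iic_mem_nhds (by linarith)))
    exact h1.congr fun v hv => hK v hv
  let G : ℝ → ℝ := fun v => -(Real.exp (-v) * Real.exp (-∫ x in Ioi v, k x))
  let G' : ℝ → ℝ := fun v => Real.exp (-v) * ((1 - k v) * Real.exp (-∫ x in Ioi v, k x))
  have hder : ∀ v ∈ Ioi s, HasDerivAt G (G' v) v := by
    intro v hv
    have hv0 : 0 < v := hs.trans_lt hv
    have h1 : HasDerivAt (fun v => ∫ x in (0 : ℝ)..v, k x) (k v) v :=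
      intervalIntegral.integral_hasDerivAt_right (hII 0 v le_rfl hv0.le)
        (hkc.stronglyMeasurableAtFilter isOpen_Ioi v hv0)
        (hkc.continuousAt (Ioi_mem_nhds hv0))
    have h2 : HasDerivAt (fun v => ∫ x in Ioi v, k x) (-k v) v := by
      refine (h1.const_sub (∫ x in Ioi 0, k x)).congr_of_eventuallyEq ?_
      filter_upwards [Ioi_mem_nhds hv0] with w hw
      exact hK w (le_of_lt hw)
    have h3 := (((hasDerivAt_id v).neg.exp).mul (h2.neg.exp)).neg
    refine h3.congr_deriv ?_
    simp only [Pi.neg_apply, id, G']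
    ring
  have hGcont : ContinuousWithinAt G (Ici s) s := by
    have h1 : ContinuousWithinAt (fun v => ∫ x in Ioi v, k x) (Ici s) s :=
      (hcont s hs).mono (Ici_subset_Ici.2 hs)
    exact ((Real.continuous_exp.comp continuous_neg).continuousWithinAt.mul
      (Real.continuous_exp.continuousAt.comp_continuousWithinAt h1.neg)).neg
  have hG'n : ∀ v, 0 ≤ G' v := fun v => mul_nonneg (Real.exp_pos _).le
    (mul_nonneg (by linarith [hk1 v]) (Real.exp_pos _).le)
  have hlim : Tendsto G atTop (𝓝 0) := by
    have h1 : Tendsto (fun v : ℝ => Real.exp (-v)) atTop (𝓝 0) :=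
      Real.tendsto_exp_neg_atTop_nhds_zero
    have h2 : Tendsto (fun v => Real.exp (-v) * Real.exp (-∫ x in Ioi v, k x)) atTop (𝓝 0) := by
      refine squeeze_zero (fun v => by positivity) (fun v => ?_) h1
      exact mul_le_of_le_one_right (Real.exp_pos _).le (Real.exp_le_one_iff.2 (by linarith [hKn v]))
    simpa [G] using h2.neg
  have hmain := integral_Ioi_of_hasDerivAt_of_nonneg hGcont hder (fun v _ => hG'n v) hlim
  have hshift : ∫ t in Ioi 0, G' (s + t) = ∫ v in Ioi s, G' v := by
    have := (measurePreserving_add_left (volume : Measure ℝ) s).setIntegral_preimage_emb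
      (measurableEmbedding_addLeft s) G' (Ioi s)
    rw [← this]
    simp
  have e : ∀ t, Real.exp (-t) * ((1 - k (s + t)) * Real.exp (-∫ v in Ioi (s + t), k v))
      = Real.exp s * G' (s + t) := by
    intro t
    simp only [G']
    rw [← mul_assoc (Real.exp s), ← Real.exp_add]
    congr 2
    ring
  simp only [e]
  rw [integral_const_mul, hshift, hmain]
  simp only [G]
  rw [sub_neg_eq_add, zero_add, ← mul_assoc, ← Real.exp_add]
  simp

theorem integral_expMeasure_one (f : ℝ → ℝ) :
    ∫ t, f t ∂(expMeasure 1) = ∫ t in Ioi 0, Real.exp (-t) * f t := by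
  rw [expMeasure, gammaMeasure, integral_withDensity_eq_integral_toReal_smul
    (show Measurable (gammaPDF 1 1) from
      (measurable_gammaPDFReal 1 1).ennreal_ofReal) (ae_of_all _ fun x => by simp [gammaPDF]),
    ← integral_indicator measurableSet_Ioi]
  refine integral_congr_ae ?_
  filter_upwards [compl_mem_ae_iff.2 (measure_singleton (μ := (volume : Measure ℝ)) 0)] with t ht
  have ht : t ≠ 0 := ht
  rcases lt_or_gt_of_ne ht with h | h
  · rw [indicator_of_notMem (by simpa using h.le)]
    simp [gammaPDF, gammaPDFReal, h.not_ge]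
  · rw [indicator_of_mem (by simpa using h)]
    simp [gammaPDF, gammaPDFReal, h.le, Real.exp_nonneg]

variable {Ω S : Type*} [MeasurableSpace Ω] [MeasurableSpace S]
  {P : Measure Ω} [IsProbabilityMeasure P]

omit [IsProbabilityMeasure P] in
/-- Interarrival times are almost surely positive. -/
theorem ae_pos_of_map_eq_expMeasure {τ : Ω → ℝ} (hτ : Measurable τ)
    (hlaw : P.map τ = expMeasure 1) : ∀ᵐ ω ∂P, 0 < τ ω := by
  have h : ∀ᵐ t ∂(expMeasure 1), 0 < t := by
    rw [expMeasure, gammaMeasure, ae_withDensity_iff (show Measurable (gammaPDF 1 1) from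
      (measurable_gammaPDFReal 1 1).ennreal_ofReal)]
    filter_upwards [compl_mem_ae_iff.2 (measure_singleton (μ := (volume : Measure ℝ)) 0)] with t ht h
    have ht : t ≠ 0 := ht
    by_contra hn
    exact h (by simp [gammaPDF, gammaPDFReal, not_le.2 (lt_of_le_of_ne (not_lt.1 hn) ht)])
  rw [← hlaw] at h
  exact ae_of_ae_map hτ.aemeasurable h

omit [IsProbabilityMeasure P] in
/-- By the strong law of large numbers the arrival times grow linearly. -/
theorem ae_eventually_le_arrivalTime {T : ℕ → Ω → ℝ} (hT : IsIID T P)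
    (hTlaw : ∀ i, P.map (T i) = expMeasure 1) :
    ∀ᵐ ω ∂P, ∀ᶠ n : ℕ in atTop, (n : ℝ) / 2 ≤ ∑ j ∈ Finset.range n, T j ω := by
  have hmean : ∫ t, t ∂(expMeasure 1) = 1 := by
    rw [integral_expMeasure_one (fun t => t)]
    have := Real.integral_rpow_mul_exp_neg_mul_Ioi (a := 2) (r := 1) two_pos one_pos
    rw [Real.Gamma_two] at this
    norm_num at this
    rw [← this]
    exact integral_congr_ae (ae_of_all _ fun t => mul_comm _ _)
  have h1 : ∫ ω, T 0 ω ∂P = 1 := by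
    rw [← hmean, ← hTlaw 0]
    exact (integral_map (f := fun t : ℝ => t) (hT.measurable 0).aemeasurable
      measurable_id.aestronglyMeasurable).symm
  have hint : Integrable (T 0) P := by
    by_contra h
    rw [integral_undef h] at h1
    exact zero_ne_one h1
  filter_upwards [strong_law_ae_real T hint (fun i j hij => hT.indep.indepFun hij)
    hT.identDistrib] with ω hω
  rw [h1] at hω
  filter_upwards [hω.eventually (lt_mem_nhds (show (1 / 2 : ℝ) < 1 by norm_num)),
    eventually_gt_atTop 0] with n hn hn0
  have hn0' : (0 : ℝ) < n := Nat.cast_pos.2 hn0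
  rw [lt_div_iff₀ hn0'] at hn
  linarith

/-- The Laplace functional of the arrival times of a standard Poisson process, marked by an
independent i.i.d. sequence. Here `h t = E[g (t, W)]`; the products over the first `n` points,
completed by the expected contribution `exp (-∫_{Γ_n}^∞ (1 - h))` of the others, have constant
expectation. -/
theorem integral_eq_exp_of_tendsto_prod_arrivalTime {T : ℕ → Ω → ℝ} (hT : IsIID T P)
    (hTlaw : ∀ i, P.map (T i) = expMeasure 1) {W : ℕ → Ω → S} (hW : IsIID W P)
    (hTW : Indep (sigmaOf T) (sigmaOf W) P) {g : ℝ × S → ℝ} (hg : Measurable g)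
    (hg0 : ∀ p, 0 ≤ g p) (hg1 : ∀ p, g p ≤ 1)
    (hc : ContinuousOn (fun t => ∫ ω, g (t, W 0 ω) ∂P) (Ioi 0))
    (hi : IntegrableOn (fun t => 1 - ∫ ω, g (t, W 0 ω) ∂P) (Ioi 0)) {R : Ω → ℝ}
    (hR : ∀ᵐ ω ∂P, Tendsto (fun n => ∏ l ∈ Finset.range n, g (arrivalTime T l ω, W l ω)) atTop
      (𝓝 (R ω))) :
    ∫ ω, R ω ∂P = Real.exp (-∫ t in Ioi 0, (1 - ∫ ω, g (t, W 0 ω) ∂P)) := by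
  set h : ℝ → ℝ := fun t => ∫ ω, g (t, W 0 ω) ∂P with hh
  have hh0 : ∀ t, 0 ≤ h t := fun t => integral_nonneg fun ω => hg0 _
  have hh1 : ∀ t, h t ≤ 1 := fun t => by
    refine (integral_mono_of_nonneg (ae_of_all _ fun ω => hg0 _) (integrable_const (1 : ℝ))
      (ae_of_all _ fun ω => hg1 _)).trans ?_
    simp
  set k : ℝ → ℝ := (Ioi 0).indicator fun t => 1 - h t with hk
  have hk0 : ∀ t, 0 ≤ k t := fun t => indicator_nonneg (fun t _ => by linarith [hh1 t]) t
  have hk1 : ∀ t, k t ≤ 1 := fun t => by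
    by_cases ht : t ∈ Ioi (0 : ℝ)
    · rw [hk, indicator_of_mem ht]; linarith [hh0 t]
    · rw [hk, indicator_of_notMem ht]; exact zero_le_one
  have hkc : ContinuousOn k (Ioi 0) :=
    (continuousOn_const.sub hc).congr fun t ht => indicator_of_mem ht _
  have hki : Integrable k := (integrable_indicator_iff measurableSet_Ioi).2 hi
  let F : ℝ → ℝ := fun s => Real.exp (-∫ v in Ioi s, k v)
  have hF0 : ∀ s, 0 ≤ F s := fun s => (Real.exp_pos _).le
  have hF1 : ∀ s, F s ≤ 1 := fun s =>
    Real.exp_le_one_iff.2 (neg_nonpos.2 (integral_nonneg fun x => hk0 x))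
  have hFm : Measurable F := by
    refine Monotone.measurable fun a b hab => Real.exp_le_exp.2 (neg_le_neg ?_)
    exact setIntegral_mono_set hki.integrableOn (ae_of_all _ hk0)
      (Ioi_subset_Ioi hab).eventuallyLE
  have hfix : ∀ s, 0 ≤ s → ∀ n, ∫ ω, h (s + T n ω) * F (s + T n ω) ∂P = F s := by
    intro s hs n
    have hm : Measurable fun t => h (s + t) * F (s + t) := by
      have hhm : Measurable h := measurable_integral_prodMk (hW.measurable 0) hg
      fun_prop
    rw [← integral_map (f := fun t => h (s + t) * F (s + t)) (hT.measurable n).aemeasurable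
      hm.aestronglyMeasurable, hTlaw, integral_expMeasure_one]
    refine Eq.trans ?_ (integral_exp_fixedPoint hkc hki.integrableOn hk0 hk1 hs)
    refine setIntegral_congr_fun measurableSet_Ioi fun t ht => ?_
    simp only [F]
    rw [hk, indicator_of_mem (show s + t ∈ Ioi (0 : ℝ) from add_pos_of_nonneg_of_pos hs ht)]
    simp
  -- the first `n` points, summarized by their product and the last arrival time
  let V : ℕ → Ω → ℝ × S := fun i ω => (T i ω, W i ω)
  have hV : IsIID V P := hT.prodMk hW hTW
  let Q : ℕ → Ω → ℝ × ℝ := fun n ω => (∏ l ∈ Finset.range n, g (arrivalTime T l ω, W l ω),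
    ∑ j ∈ Finset.range n, T j ω)
  let κ : (ℝ × ℝ) × (ℝ × S) → ℝ × ℝ := fun p =>
    (p.1.1 * g (p.1.2 + p.2.1, p.2.2), p.1.2 + p.2.1)
  have hκ : Measurable κ := by fun_prop
  have hQ : ∀ n ω, Q (n + 1) ω = κ (Q n ω, V n ω) := by
    intro n ω
    simp only [Q, κ, V, Finset.prod_range_succ, Finset.sum_range_succ, arrivalTime]
  have hQm : ∀ n, Measurable[⨆ i ∈ Iio n, (inferInstance : MeasurableSpace (ℝ × S)).comap (V i)]
      (Q n) := by
    intro n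
    induction n with
    | zero => simp [Q]
    | succ n ih =>
      have h1 : Measurable[⨆ i ∈ Iio (n + 1), (inferInstance : MeasurableSpace (ℝ × S)).comap (V i)]
          (Q n) := by
        refine ih.mono ?_ le_rfl
        exact biSup_mono fun i hi => lt_trans hi (Nat.lt_succ_self n)
      have h2 : Measurable[⨆ i ∈ Iio (n + 1), (inferInstance : MeasurableSpace (ℝ × S)).comap (V i)]
          (V n) :=
        (comap_measurable (V n)).mono (le_biSup (fun i =>
          (inferInstance : MeasurableSpace (ℝ × S)).comap (V i)) (Nat.lt_succ_self n)) le_rfl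
      have h3 : Q (n + 1) = fun ω => κ (Q n ω, V n ω) := funext (hQ n)
      rw [h3]
      exact hκ.comp (h1.prodMk h2)
  have hQind : ∀ n, IndepFun (Q n) (V n) P := by
    intro n
    rw [IndepFun_iff_Indep]
    refine indep_of_iIndep (fun i => (hV.measurable i).comap_le)
      ((iIndepFun_iff_iIndep _ _ _).1 hV.indep) (A := Iio n) (B := {n}) (by simp)
      (hQm n).comap_le ?_
    simp
  have hQm' : ∀ n, Measurable (Q n) := fun n =>
    (hQm n).mono (iSup₂_le fun i _ => (hV.measurable i).comap_le) le_rfl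
  have hT0 : ∀ᵐ ω ∂P, ∀ i, 0 < T i ω := ae_all_iff.2 fun i =>
    ae_pos_of_map_eq_expMeasure (hT.measurable i) (hTlaw i)
  have hQ0 : ∀ n ω, 0 ≤ (Q n ω).1 := fun n ω => by
    simp only [Q]
    exact Finset.prod_nonneg fun l _ => hg0 _
  have hQ1 : ∀ n ω, (Q n ω).1 ≤ 1 := fun n ω => by
    simp only [Q]
    exact Finset.prod_le_one (fun l _ => hg0 _) fun l _ => hg1 _
  -- the completed products have constant expectation
  have hstep : ∀ n, ∫ ω, (Q n ω).1 * F (Q n ω).2 ∂P = F 0 := by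
    intro n
    induction n with
    | zero => simp [Q]
    | succ n ih =>
      rw [← ih]
      -- truncate the first factor in order to have a bounded integrand everywhere
      let c : ℝ → ℝ := fun x => max 0 (min 1 x)
      have hcm : Measurable c := by fun_prop
      have hc0 : ∀ x, 0 ≤ c x := fun x => le_max_left _ _
      have hc1 : ∀ x, c x ≤ 1 := fun x => max_le zero_le_one (min_le_left _ _)
      have hcQ : ∀ n ω, c (Q n ω).1 = (Q n ω).1 := fun n ω => by
        simp only [c]
        rw [min_eq_right (hQ1 n ω), max_eq_right (hQ0 n ω)]
      have e1 : ∀ ω, (Q (n + 1) ω).1 * F (Q (n + 1) ω).2 = (fun p : (ℝ × ℝ) × (ℝ × S) =>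
          c p.1.1 * (g (p.1.2 + p.2.1, p.2.2) * F (p.1.2 + p.2.1))) (Q n ω, V n ω) := by
        intro ω
        rw [hQ]
        simp only [κ, hcQ]
        ring
      simp only [e1]
      rw [integral_of_indepFun (H := fun p : (ℝ × ℝ) × (ℝ × S) =>
          c p.1.1 * (g (p.1.2 + p.2.1, p.2.2) * F (p.1.2 + p.2.1)))
        (hQm' n) (hV.measurable n) (hQind n) (by fun_prop) (C := 1)]
      · refine integral_congr_ae ?_
        filter_upwards [hT0] with ω hω
        have hs : 0 ≤ (Q n ω).2 := by
          simp only [Q]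
          exact Finset.sum_nonneg fun j _ => (hω j).le
        simp only [hcQ]
        rw [integral_const_mul, ← hfix _ hs n]
        congr 1
        have hWT : IndepFun (T n) (W n) P :=
          IndepFun.comp (f := fun ω i => T i ω) (g := fun ω i => W i ω)
            (φ := fun x => x n) (ψ := fun y => y n) hTW (measurable_pi_apply n)
            (measurable_pi_apply n)
        rw [integral_of_indepFun (H := fun p : ℝ × S =>
          g ((Q n ω).2 + p.1, p.2) * F ((Q n ω).2 + p.1)) (hT.measurable n) (hW.measurable n) hWT
          (by fun_prop) (C := 1)]
        · congr 1 with ω'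
          dsimp only
          rw [integral_mul_const]
          congr 1
          exact hW.integral_comp (f := fun w => g ((Q n ω).2 + T n ω', w)) (by fun_prop) n
        · intro p
          rw [abs_of_nonneg (mul_nonneg (hg0 _) (hF0 _))]
          exact mul_le_one₀ (hg1 _) (hF0 _) (hF1 _)
      · intro p
        rw [abs_of_nonneg (mul_nonneg (hc0 _) (mul_nonneg (hg0 _) (hF0 _)))]
        exact mul_le_one₀ (hc1 _) (mul_nonneg (hg0 _) (hF0 _))
          (mul_le_one₀ (hg1 _) (hF0 _) (hF1 _))
  have hFlim : Tendsto F atTop (𝓝 1) := by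
    have h1 : Tendsto (fun s : ℝ => ∫ v in Ioi s, k v) atTop (𝓝 0) :=
      tendsto_integral_Ioi_zero tendsto_id
    have h2 : Tendsto F atTop (𝓝 (Real.exp (-0))) := (Real.continuous_exp.tendsto _).comp h1.neg
    rwa [neg_zero, Real.exp_zero] at h2
  have hlim : Tendsto (fun n => ∫ ω, (Q n ω).1 * F (Q n ω).2 ∂P) atTop (𝓝 (∫ ω, R ω ∂P)) := by
    refine tendsto_integral_of_dominated_convergence (fun _ => 1) (fun n => ?_)
      (integrable_const _) (fun n => ae_of_all _ fun ω => ?_) ?_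
    · exact (((measurable_fst.comp (hQm' n)).mul
        (hFm.comp (measurable_snd.comp (hQm' n))))).aestronglyMeasurable
    · rw [Real.norm_eq_abs, abs_of_nonneg (mul_nonneg (hQ0 n ω) (hF0 _))]
      exact mul_le_one₀ (hQ1 n ω) (hF0 _) (hF1 _)
    · filter_upwards [hR, ae_eventually_le_arrivalTime hT hTlaw] with ω h1 h2
      have h3 : Tendsto (fun n : ℕ => ∑ j ∈ Finset.range n, T j ω) atTop atTop :=
        tendsto_atTop_mono' atTop h2 (tendsto_natCast_atTop_atTop.atTop_div_const two_pos)
      simpa using h1.mul (hFlim.comp h3)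
  simp only [hstep] at hlim
  rw [tendsto_nhds_unique hlim tendsto_const_nhds]
  simp only [F]
  congr 2
  refine setIntegral_congr_fun measurableSet_Ioi fun t ht => ?_
  rw [hk, indicator_of_mem ht]

end ArrivalTimes

/-! ### Finiteness above positive levels -/

section FiniteAboveLevels

variable {Ω : Type*} [MeasurableSpace Ω] {P : Measure Ω} [IsProbabilityMeasure P]

/-- The points `ξ_l Γ_l^{-1/α}` do not accumulate away from zero when `E ξ^α < ∞`: as
`Γ_l ≥ (l + 1) / 2` eventually, a point above the level `b` forces `2 ξ_l^α / b^α > l`, which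
happens finitely often by the Borel–Cantelli lemma. -/
theorem ae_finite_le_mul_arrivalTime {T : ℕ → Ω → ℝ} (hT : IsIID T P)
    (hTlaw : ∀ i, P.map (T i) = expMeasure 1) {ξ : ℕ → Ω → ℝ} (hξ : IsIID ξ P)
    (hξ0 : ∀ i ω, 0 ≤ ξ i ω) {α : ℝ} (hα : 0 < α) (hint : Integrable (fun ω => ξ 0 ω ^ α) P) :
    ∀ᵐ ω ∂P, ∀ a : ℝ≥0∞, 0 < a →
      {l | a ≤ ENNReal.ofReal (ξ l ω * arrivalTime T l ω ^ (-(1 / α)))}.Finite := by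
  have key : ∀ m : ℕ, ∀ᵐ ω ∂P, ∀ᶠ l in atTop,
      ¬ (((m : ℝ) + 1)⁻¹ ≤ ξ l ω * arrivalTime T l ω ^ (-(1 / α))) := by
    intro m
    set b : ℝ := ((m : ℝ) + 1)⁻¹
    have hb : 0 < b := by positivity
    have hbα : 0 < b ^ α := Real.rpow_pos_of_pos hb α
    let X : Ω → ℝ := fun ω => 2 / b ^ α * ξ 0 ω ^ α
    have hX0 : 0 ≤ X := fun ω => mul_nonneg (by positivity) (Real.rpow_nonneg (hξ0 0 ω) α)
    have hXi : Integrable X P := hint.const_mul _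
    have hsum : ∑' j : ℕ, P {ω | (j : ℝ) < X ω} ≠ ∞ := by
      let _ : MeasureSpace Ω := ⟨P⟩
      have : IsProbabilityMeasure (volume : Measure Ω) := ‹IsProbabilityMeasure P›
      exact (tsum_prob_mem_Ioi_lt_top (X := X) hXi hX0).ne
    have hsum' : ∑' j : ℕ, P {ω | (j : ℝ) < 2 / b ^ α * ξ j ω ^ α} ≠ ∞ := by
      convert hsum using 3 with j
      have hm : MeasurableSet {x : ℝ | (j : ℝ) < 2 / b ^ α * x ^ α} :=
        measurableSet_lt measurable_const (by fun_prop)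
      exact (hξ.identDistrib j).measure_mem_eq hm
    have hΓ := ae_eventually_le_arrivalTime hT hTlaw
    filter_upwards [ae_eventually_notMem hsum', hΓ] with ω h1 h2
    filter_upwards [h1, (tendsto_add_atTop_nat 1).eventually h2] with l h3 h4 h5
    have hΓpos : 0 < arrivalTime T l ω := by
      refine lt_of_lt_of_le ?_ h4
      push_cast
      positivity
    have h6 : b ^ α ≤ ξ l ω ^ α * (arrivalTime T l ω)⁻¹ := by
      have := Real.rpow_le_rpow hb.le h5 hα.le
      rwa [Real.mul_rpow (hξ0 l ω) (Real.rpow_nonneg hΓpos.le _), ← Real.rpow_mul hΓpos.le,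
        show -(1 / α) * α = -1 by field_simp, Real.rpow_neg_one] at this
    rw [← div_eq_mul_inv, le_div_iff₀ hΓpos] at h6
    have h7 : 2 / b ^ α * ξ l ω ^ α ≤ l := not_lt.1 h3
    rw [div_mul_eq_mul_div, div_le_iff₀ hbα] at h7
    have h8 : ((l : ℝ) + 1) / 2 ≤ arrivalTime T l ω := by exact_mod_cast h4
    nlinarith [mul_le_mul_of_nonneg_left h8 hbα.le]
  filter_upwards [ae_all_iff.2 key] with ω hω a ha
  obtain ⟨n, hn⟩ := ENNReal.exists_inv_nat_lt ha.ne'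
  have hfin := hω n
  rw [← Nat.cofinite_eq_atTop, Filter.eventually_cofinite] at hfin
  refine hfin.subset fun l hl => ?_
  simp only [not_not, Set.mem_ofPred_eq] at hl ⊢
  by_contra! hlt
  refine (hn.trans_le hl).not_ge ?_
  refine (ENNReal.ofReal_le_ofReal hlt.le).trans ?_
  rw [ENNReal.ofReal_inv_of_pos (by positivity), ENNReal.inv_le_inv,
    ← ENNReal.ofReal_natCast]
  exact ENNReal.ofReal_le_ofReal (by linarith)

end FiniteAboveLevels

/-! ### Regular variation and convergence of tails -/

section RegularVariation

open Set

variable {G : ℝ → ℝ} {α : ℝ}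

/-- Potter's bound for a monotone regularly varying function, with the exponent enlarged by `δ`;
it follows from iterating the doubling inequality `G t ≤ 2 ^ (α + δ) * G (2 * t)`. -/
theorem IsRegularlyVarying.potter (hG : IsRegularlyVarying G (-α)) (hanti : Antitone G)
    (hα : 0 < α) {δ : ℝ} (hδ : 0 < δ) :
    ∃ C x₀ : ℝ, 0 < C ∧ 0 < x₀ ∧ 0 < G x₀ ∧
      ∀ t s, x₀ ≤ t → t ≤ s → G t ≤ C * (s / t) ^ (α + δ) * G s := by
  obtain ⟨-, hpos, hlim⟩ := hG
  set β := α + δ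
  have hβ : 0 < β := by positivity
  have h1 : (2 : ℝ) ^ (-β) < 2 ^ (-α) :=
    Real.rpow_lt_rpow_of_exponent_lt one_lt_two (by simp only [β]; linarith)
  obtain ⟨x₁, hx₁⟩ := eventually_atTop.1
    (((hlim 2 two_pos).eventually (lt_mem_nhds h1)).and (hpos.and (eventually_gt_atTop 0)))
  have hdouble : ∀ t, x₁ ≤ t → G t ≤ 2 ^ β * G (2 * t) := by
    intro t ht
    obtain ⟨h2, h3, -⟩ := hx₁ t ht
    rw [lt_div_iff₀ h3, Real.rpow_neg two_pos.le, inv_mul_lt_iff₀ (by positivity)] at h2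
    rw [mul_comm 2 t]
    exact h2.le
  have hx₁0 : 0 < x₁ := (hx₁ x₁ le_rfl).2.2
  have hiter : ∀ (j : ℕ) t, x₁ ≤ t → G t ≤ (2 ^ β) ^ j * G (2 ^ j * t) := by
    intro j
    induction j with
    | zero => intro t _; simp
    | succ j ih =>
      intro t ht
      have ht0 : 0 < t := hx₁0.trans_le ht
      refine (ih t ht).trans ?_
      rw [pow_succ, mul_assoc]
      refine mul_le_mul_of_nonneg_left ?_ (by positivity)
      have h3 : x₁ ≤ 2 ^ j * t :=
        ht.trans (le_mul_of_one_le_left ht0.le (one_le_pow₀ one_le_two))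
      refine (hdouble _ h3).trans (le_of_eq ?_)
      congr 2
      ring
  refine ⟨2 ^ β, x₁, by positivity, hx₁0, (hx₁ x₁ le_rfl).2.1, fun t s ht hts => ?_⟩
  have ht0 : 0 < t := hx₁0.trans_le ht
  obtain ⟨j, hj1, hj2⟩ := exists_nat_pow_near ((one_le_div ht0).2 hts) one_lt_two
  refine (hiter (j + 1) t ht).trans ?_
  have hs0 : 0 < s := ht0.trans_le hts
  have hs : s ≤ 2 ^ (j + 1) * t := by
    rw [div_lt_iff₀ ht0] at hj2
    exact hj2.le
  have hGs : 0 ≤ G s := ((hx₁ s (ht.trans hts)).2.1).le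
  refine mul_le_mul ?_ (hanti hs) ((hx₁ _ ((ht.trans hts).trans hs)).2.1).le (by positivity)
  rw [← Real.mul_rpow two_pos.le (by positivity), ← Real.rpow_natCast, ← Real.rpow_mul two_pos.le,
    mul_comm β, Real.rpow_mul two_pos.le, Real.rpow_natCast]
  refine Real.rpow_le_rpow (by positivity) ?_ hβ.le
  rw [pow_succ, mul_comm]
  exact mul_le_mul_of_nonneg_left hj1 two_pos.le

theorem IsRegularlyVarying.pos (hG : IsRegularlyVarying G (-α)) (hanti : Antitone G) (x : ℝ) :
    0 < G x := by
  obtain ⟨y, hy⟩ := eventually_atTop.1 hG.2.1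
  exact (hy _ (le_max_left y x)).trans_le (hanti (le_max_right y x))

theorem IsRegularlyVarying.tendsto_atTop_of_mul (hG : IsRegularlyVarying G (-α))
    (hanti : Antitone G) {c : ℕ → ℝ}
    (hc : Tendsto (fun n : ℕ => (n : ℝ) * G (c n)) atTop (𝓝 1)) : Tendsto c atTop atTop := by
  refine tendsto_atTop.2 fun x => ?_
  have h0 : Tendsto (fun n => G (c n)) atTop (𝓝 0) := by
    have h1 : Tendsto (fun n : ℕ => ((n : ℝ))⁻¹ * ((n : ℝ) * G (c n))) atTop (𝓝 (0 * 1)) :=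
      (tendsto_inv_atTop_zero.comp tendsto_natCast_atTop_atTop).mul hc
    rw [zero_mul] at h1
    refine h1.congr' ?_
    filter_upwards [eventually_ne_atTop 0] with n hn
    rw [inv_mul_cancel_left₀ (Nat.cast_ne_zero.2 hn)]
  filter_upwards [h0.eventually (gt_mem_nhds (hG.pos hanti x))] with n hn
  by_contra! h
  exact (hanti h.le).not_gt hn

theorem IsRegularlyVarying.tendsto_mul (hG : IsRegularlyVarying G (-α))
    (hanti : Antitone G) {c : ℕ → ℝ}
    (hc : Tendsto (fun n : ℕ => (n : ℝ) * G (c n)) atTop (𝓝 1)) {x : ℝ} (hx : 0 < x) :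
    Tendsto (fun n : ℕ => (n : ℝ) * G (c n * x)) atTop (𝓝 (x ^ (-α))) := by
  have h1 := ((hG.2.2 x hx).comp (hG.tendsto_atTop_of_mul hanti hc)).mul hc
  rw [mul_one] at h1
  refine h1.congr fun n => ?_
  have := (hG.pos hanti (c n)).ne'
  simp only [Function.comp_apply]
  field_simp

/-- A uniform bound on the rescaled tails near the origin; for `c n * y` below the range of
Potter's bound, the number `n` itself is bounded by a power of `c n`. -/
theorem IsRegularlyVarying.exists_mul_le (hG : IsRegularlyVarying G (-α)) (hanti : Antitone G)
    (hG1 : ∀ x, G x ≤ 1) (hα : 0 < α) {δ : ℝ} (hδ : 0 < δ) {c : ℕ → ℝ}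
    (hc : Tendsto (fun n : ℕ => (n : ℝ) * G (c n)) atTop (𝓝 1)) :
    ∃ C : ℝ, 0 ≤ C ∧ ∀ᶠ n : ℕ in atTop, ∀ y, 0 < y →
      (n : ℝ) * G (c n * y) ≤ C * (1 + y ^ (-(α + δ))) := by
  obtain ⟨C, x₀, hC, hx₀, hGx₀, hpot⟩ := hG.potter hanti hα hδ
  set β := α + δ
  have hβ : 0 < β := by positivity
  refine ⟨2 + 2 * C + 2 * C / G x₀, by positivity, ?_⟩
  filter_upwards [hc.eventually (gt_mem_nhds one_lt_two),
    (hG.tendsto_atTop_of_mul hanti hc).eventually (eventually_ge_atTop x₀)] with n hn hcn y hy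
  have hcn0 : 0 < c n := hx₀.trans_le hcn
  have hn0 : (0 : ℝ) ≤ n := Nat.cast_nonneg n
  have hyβ : 0 < y ^ (-β) := Real.rpow_pos_of_pos hy _
  have hD1 : 0 ≤ 2 * C := by positivity
  have hD2 : 0 ≤ 2 * C / G x₀ := by positivity
  have hyinv : ∀ z : ℝ, 0 < z → z ≤ y⁻¹ → z ^ β ≤ y ^ (-β) := fun z hz hzy => by
    rw [Real.rpow_neg hy.le, ← Real.inv_rpow hy.le]
    exact Real.rpow_le_rpow hz.le hzy hβ.le
  rcases le_or_gt 1 y with h1 | h1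
  · have h2 : (n : ℝ) * G (c n * y) ≤ n * G (c n) :=
      mul_le_mul_of_nonneg_left (hanti (le_mul_of_one_le_right hcn0.le h1)) hn0
    nlinarith [mul_nonneg hD1 hyβ.le, mul_nonneg hD2 hyβ.le]
  rcases le_or_gt x₀ (c n * y) with h2 | h2
  · have h3 := hpot (c n * y) (c n) h2 (mul_le_of_le_one_right hcn0.le h1.le)
    have h4 : (c n / (c n * y)) ^ β ≤ y ^ (-β) := by
      refine hyinv _ (by positivity) (le_of_eq ?_)
      field_simp
    have h5 : (n : ℝ) * G (c n * y) ≤ C * y ^ (-β) * (n * G (c n)) := by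
      calc (n : ℝ) * G (c n * y) ≤ n * (C * (c n / (c n * y)) ^ β * G (c n)) :=
            mul_le_mul_of_nonneg_left h3 hn0
        _ = C * (c n / (c n * y)) ^ β * (n * G (c n)) := by ring
        _ ≤ _ := by
            refine mul_le_mul_of_nonneg_right (mul_le_mul_of_nonneg_left h4 hC.le) ?_
            exact mul_nonneg hn0 (hG.pos hanti _).le
    have h6 : C * y ^ (-β) * (n * G (c n)) ≤ C * y ^ (-β) * 2 :=
      mul_le_mul_of_nonneg_left hn.le (by positivity)
    nlinarith [mul_nonneg hD1 hyβ.le, mul_nonneg hD2 hyβ.le]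
  · have h3 := hpot x₀ (c n) le_rfl hcn
    have h4 : (c n / x₀) ^ β ≤ y ^ (-β) := by
      refine hyinv _ (by positivity) ?_
      rw [div_le_iff₀ hx₀, inv_mul_eq_div, le_div_iff₀ hy]
      exact h2.le
    have h5 : (n : ℝ) * G x₀ ≤ C * y ^ (-β) * (n * G (c n)) := by
      calc (n : ℝ) * G x₀ ≤ n * (C * (c n / x₀) ^ β * G (c n)) :=
            mul_le_mul_of_nonneg_left h3 hn0
        _ = C * (c n / x₀) ^ β * (n * G (c n)) := by ring
        _ ≤ _ := by
            refine mul_le_mul_of_nonneg_right (mul_le_mul_of_nonneg_left h4 hC.le) ?_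
            exact mul_nonneg hn0 (hG.pos hanti _).le
    have h6 : C * y ^ (-β) * (n * G (c n)) ≤ C * y ^ (-β) * 2 :=
      mul_le_mul_of_nonneg_left hn.le (by positivity)
    have h7 : (n : ℝ) ≤ 2 * C / G x₀ * y ^ (-β) := by
      rw [div_mul_eq_mul_div, le_div_iff₀ hGx₀]
      linarith
    have h8 : (n : ℝ) * G (c n * y) ≤ n := mul_le_of_le_one_right hn0 (hG1 _)
    nlinarith [mul_nonneg hD1 hyβ.le, mul_nonneg hD2 hyβ.le]

end RegularVariation

section TailConvergence

open Set

/-- Convergence of all tails implies weak convergence of probability measures on `[0, ∞]`. -/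
theorem tendsto_probabilityMeasure_of_tendsto_Ioi {ν : ℕ → ProbabilityMeasure ℝ≥0∞}
    {ν₀ : ProbabilityMeasure ℝ≥0∞}
    (h : ∀ x, Tendsto (fun n => (ν n : Measure ℝ≥0∞) (Ioi x)) atTop
      (𝓝 ((ν₀ : Measure ℝ≥0∞) (Ioi x)))) : Tendsto ν atTop (𝓝 ν₀) := by
  let S : Set (Set ℝ≥0∞) := {s | ∃ y, s = Iic y ∨ ∃ x, s = Ioc x y}
  have hS : IsPiSystem S := by
    rintro _ ⟨y, rfl | ⟨x, rfl⟩⟩ _ ⟨y', rfl | ⟨x', rfl⟩⟩ -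
    · exact ⟨y ⊓ y', Or.inl Iic_inter_Iic⟩
    · refine ⟨y ⊓ y', Or.inr ⟨x', ?_⟩⟩
      ext z; simp only [mem_inter_iff, mem_Iic, mem_Ioc, le_inf_iff]; tauto
    · refine ⟨y ⊓ y', Or.inr ⟨x, ?_⟩⟩
      ext z; simp only [mem_inter_iff, mem_Iic, mem_Ioc, le_inf_iff]; tauto
    · exact ⟨y ⊓ y', Or.inr ⟨x ⊔ x', Ioc_inter_Ioc⟩⟩
  refine hS.tendsto_probabilityMeasure_of_tendsto_of_mem ?_ ?_ ?_
  · rintro _ ⟨y, rfl | ⟨x, rfl⟩⟩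
    · exact measurableSet_Iic
    · exact measurableSet_Ioc
  · intro u hu x hx
    rcases eq_or_ne x 0 with rfl | hx0
    · obtain ⟨a, ha, hsub⟩ := ENNReal.nhds_zero_basis.mem_iff.1 (hu.mem_nhds hx)
      obtain ⟨b, hb0, hb⟩ := exists_between ha
      exact ⟨Iic b, ⟨b, Or.inl rfl⟩, Iic_mem_nhds hb0, fun z hz => hsub (lt_of_le_of_lt hz hb)⟩
    · rcases eq_or_ne x ∞ with rfl | hx1
      · obtain ⟨a, ha, hsub⟩ := exists_Ioc_subset_of_mem_nhds (hu.mem_nhds hx) ⟨0, by simp⟩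
        refine ⟨Ioc a ∞, ⟨∞, Or.inr ⟨a, rfl⟩⟩, ?_, hsub⟩
        filter_upwards [Ioi_mem_nhds ha] with z hz
        exact ⟨hz, le_top⟩
      · obtain ⟨a, b, hab, hsub⟩ := mem_nhds_iff_exists_Ioo_subset'
          ⟨0, pos_iff_ne_zero.2 hx0⟩ ⟨∞, lt_top_iff_ne_top.2 hx1⟩ |>.1 (hu.mem_nhds hx)
        obtain ⟨b', hb1, hb2⟩ := exists_between hab.2
        exact ⟨Ioc a b', ⟨b', Or.inr ⟨a, rfl⟩⟩, Ioc_mem_nhds hab.1 hb1,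
          fun z hz => hsub ⟨hz.1, hz.2.trans_lt hb2⟩⟩
  · have hIoc : ∀ x y, x ≤ y → ∀ μ : ProbabilityMeasure ℝ≥0∞, (μ : Measure ℝ≥0∞) (Ioc x y)
        = (μ : Measure ℝ≥0∞) (Ioi x) - (μ : Measure ℝ≥0∞) (Ioi y) := by
      intro x y hxy μ
      rw [← measure_sdiff (Ioi_subset_Ioi hxy) measurableSet_Ioi.nullMeasurableSet
        (measure_ne_top _ _)]
      congr 1
      ext z; simp
    have hIic : ∀ y, ∀ μ : ProbabilityMeasure ℝ≥0∞, (μ : Measure ℝ≥0∞) (Iic y)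
        = 1 - (μ : Measure ℝ≥0∞) (Ioi y) := by
      intro y μ
      rw [← prob_compl_eq_one_sub measurableSet_Ioi, compl_Ioi]
    intro s hs
    suffices Tendsto (fun n => (ν n : Measure ℝ≥0∞) s) atTop (𝓝 ((ν₀ : Measure ℝ≥0∞) s)) from
      (ENNReal.tendsto_toNNReal (measure_ne_top _ _)).comp this
    obtain ⟨y, rfl | ⟨x, rfl⟩⟩ := hs
    · simp only [hIic]
      exact ENNReal.Tendsto.sub tendsto_const_nhds (h y) (Or.inl ENNReal.one_ne_top)
    · rcases le_total x y with hxy | hxy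
      · simp only [hIoc x y hxy]
        exact ENNReal.Tendsto.sub (h x) (h y) (Or.inl (measure_ne_top _ _))
      · simp [Ioc_eq_empty_of_le hxy]

/-- If the tails beyond `b` of measures on `[0, ∞]` converge, then so do the integrals of
continuous functions vanishing up to `b`. -/
theorem tendsto_integral_of_tendsto_Ioi {ρ : ℕ → Measure ℝ≥0∞} {ρ₀ : Measure ℝ≥0∞} {b : ℝ≥0∞}
    (h : ∀ x, b ≤ x → Tendsto (fun n => ρ n (Ioi x)) atTop (𝓝 (ρ₀ (Ioi x))))
    (h0 : ρ₀ (Ioi b) ≠ 0) (h1 : ρ₀ (Ioi b) ≠ ∞) {ψ : ℝ≥0∞ → ℝ} (hψ : Continuous ψ)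
    (hψb : ∀ x, x ≤ b → ψ x = 0) :
    Tendsto (fun n => ∫ x, ψ x ∂(ρ n)) atTop (𝓝 (∫ x, ψ x ∂ρ₀)) := by
  classical
  have hgood : ∀ᶠ n in atTop, ρ n (Ioi b) ≠ 0 ∧ ρ n (Ioi b) ≠ ∞ :=
    ((h b le_rfl).eventually_ne h0).and ((h b le_rfl).eventually_ne h1)
  have hcond : ∀ ρ : Measure ℝ≥0∞, ρ (Ioi b) ≠ 0 → ρ (Ioi b) ≠ ∞ →
      IsProbabilityMeasure (ρ[|Ioi b]) := fun ρ h0 h1 =>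
    cond_isProbabilityMeasure_of_finite h0 h1
  let ν₀ : ProbabilityMeasure ℝ≥0∞ := ⟨ρ₀[|Ioi b], hcond ρ₀ h0 h1⟩
  let ν : ℕ → ProbabilityMeasure ℝ≥0∞ := fun n =>
    if hn : ρ n (Ioi b) ≠ 0 ∧ ρ n (Ioi b) ≠ ∞ then ⟨(ρ n)[|Ioi b], hcond _ hn.1 hn.2⟩ else ν₀
  have hν : ∀ᶠ n in atTop, (ν n : Measure ℝ≥0∞) = (ρ n)[|Ioi b] := by
    filter_upwards [hgood] with n hn
    have : ν n = ⟨(ρ n)[|Ioi b], hcond _ hn.1 hn.2⟩ := dif_pos hn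
    rw [this]
    rfl
  have hlim : Tendsto ν atTop (𝓝 ν₀) := by
    refine tendsto_probabilityMeasure_of_tendsto_Ioi fun x => ?_
    have e : ∀ ρ : Measure ℝ≥0∞, ρ[|Ioi b] (Ioi x) = (ρ (Ioi b))⁻¹ * ρ (Ioi (b ⊔ x)) := fun ρ => by
      rw [cond_apply measurableSet_Ioi, Ioi_inter_Ioi]
    have h2 : Tendsto (fun n => (ρ n (Ioi b))⁻¹ * ρ n (Ioi (b ⊔ x))) atTop
        (𝓝 ((ρ₀ (Ioi b))⁻¹ * ρ₀ (Ioi (b ⊔ x)))) := by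
      refine ENNReal.Tendsto.mul (tendsto_inv_iff.2 (h b le_rfl)) (Or.inr ?_)
        (h _ le_sup_left) (Or.inr (ENNReal.inv_ne_top.2 h0))
      exact ne_top_of_le_ne_top h1 (measure_mono (Ioi_subset_Ioi le_sup_left))
    change Tendsto _ _ (𝓝 (ρ₀[|Ioi b] (Ioi x)))
    rw [e]
    refine h2.congr' ?_
    filter_upwards [hν] with n hn
    rw [hn, e]
  have hint : ∀ ρ : Measure ℝ≥0∞, ρ (Ioi b) ≠ 0 → ρ (Ioi b) ≠ ∞ →
      ∫ x, ψ x ∂ρ = (ρ (Ioi b)).toReal * ∫ x, ψ x ∂(ρ[|Ioi b]) := by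
    intro ρ h0 h1
    rw [ProbabilityTheory.cond, integral_smul_measure, ENNReal.toReal_inv, smul_eq_mul,
      mul_inv_cancel_left₀ (ENNReal.toReal_ne_zero.2 ⟨h0, h1⟩)]
    refine (setIntegral_eq_integral_of_forall_compl_eq_zero fun x hx => hψb x ?_).symm
    exact not_lt.1 hx
  have h3 := ProbabilityMeasure.tendsto_iff_forall_integral_tendsto.1 hlim
    (BoundedContinuousFunction.mkOfCompact ⟨ψ, hψ⟩)
  rw [hint ρ₀ h0 h1]
  refine (((ENNReal.tendsto_toReal h1).comp (h b le_rfl)).mul h3).congr' ?_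
  filter_upwards [hgood, hν] with n hn hn'
  rw [hint _ hn.1 hn.2, ← hn']
  rfl

end TailConvergence

/-! ### Breiman's lemma -/

section FrechetIntegral

open Set

/-- The integral of `ψ` with respect to the measure `α x^{-α-1} dx` on `(0, ∞)`, the image of
Lebesgue measure under `t ↦ t^{-1/α}`. -/
def frechetIntegral (α : ℝ) (ψ : ℝ≥0∞ → ℝ) : ℝ :=
  ∫ t in Ioi (0 : ℝ), ψ (ENNReal.ofReal (t ^ (-(1 / α))))

variable {α : ℝ} {ψ : ℝ≥0∞ → ℝ}

theorem setIntegral_scaled (hα : 0 < α) (hψ0 : ψ 0 = 0) {x : ℝ} (hx : 0 ≤ x) :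
    ∫ t in Ioi (0 : ℝ), ψ (ENNReal.ofReal (x * t ^ (-(1 / α)))) = x ^ α * frechetIntegral α ψ := by
  rcases hx.eq_or_lt with rfl | hx
  · simp [hψ0, Real.zero_rpow hα.ne']
  have hxα : 0 < x ^ α := Real.rpow_pos_of_pos hx α
  have h := integral_comp_mul_left_Ioi
    (fun t => ψ (ENNReal.ofReal (x * t ^ (-(1 / α))))) 0 hxα
  rw [mul_zero, smul_eq_mul, eq_inv_mul_iff_mul_eq₀ hxα.ne'] at h
  rw [← h, frechetIntegral]
  congr 1
  refine setIntegral_congr_fun measurableSet_Ioi fun t ht => ?_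
  rw [Real.mul_rpow hxα.le (le_of_lt ht), ← Real.rpow_mul hx.le,
    show α * -(1 / α) = -1 by field_simp, Real.rpow_neg_one, mul_inv_cancel_left₀ hx.ne']

theorem continuousOn_scaled (hψ : Continuous ψ) (x : ℝ) :
    ContinuousOn (fun t : ℝ => ψ (ENNReal.ofReal (x * t ^ (-(1 / α))))) (Ioi 0) := by
  refine hψ.comp_continuousOn (ENNReal.continuous_ofReal.comp_continuousOn ?_)
  exact continuousOn_const.mul (continuousOn_id.rpow_const fun t ht => Or.inl (ne_of_gt ht))

theorem integrableOn_scaled (hα : 0 < α) (hψ : Continuous ψ) {a : ℝ≥0∞} (ha : 0 < a)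
    (hψa : ∀ x, x < a → ψ x = 0) (x : ℝ) :
    IntegrableOn (fun t : ℝ => ψ (ENNReal.ofReal (x * t ^ (-(1 / α))))) (Ioi 0) := by
  obtain ⟨C, hC⟩ : ∃ C, ∀ y, ‖ψ y‖ ≤ C :=
    ⟨_, fun y => (BoundedContinuousFunction.mkOfCompact ⟨ψ, hψ⟩).norm_coe_le_norm y⟩
  have hlim : Tendsto (fun t : ℝ => ENNReal.ofReal (x * t ^ (-(1 / α)))) atTop (𝓝 0) := by
    have h1 := (tendsto_rpow_neg_atTop (y := 1 / α) (by positivity)).const_mul x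
    rw [mul_zero] at h1
    have h2 := (ENNReal.continuous_ofReal.tendsto 0).comp h1
    rwa [ENNReal.ofReal_zero] at h2
  obtain ⟨M, hM⟩ := eventually_atTop.1 (hlim.eventually (gt_mem_nhds ha))
  have h1 : IntegrableOn (fun t : ℝ => ψ (ENNReal.ofReal (x * t ^ (-(1 / α))))) (Ioc 0 M) := by
    refine IntegrableOn.of_bound (by simp) ?_ C (ae_of_all _ fun t => hC _)
    exact ((continuousOn_scaled hψ x).mono Ioc_subset_Ioi_self).aestronglyMeasurable
      measurableSet_Ioc
  have h2 : IntegrableOn (fun t : ℝ => ψ (ENNReal.ofReal (x * t ^ (-(1 / α))))) (Ici M) := by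
    refine (integrableOn_zero).congr_fun (fun t ht => ?_) measurableSet_Ici
    exact (hψa _ (hM t ht)).symm
  refine (h1.union h2).mono_set fun t ht => ?_
  rcases le_total t M with h | h
  · exact Or.inl ⟨ht, h⟩
  · exact Or.inr h

end FrechetIntegral

section RescaledTail

open Set

variable {Ω : Type*} [MeasurableSpace Ω] {P : Measure Ω} [IsProbabilityMeasure P] {α : ℝ}
  {ψ : ℝ≥0∞ → ℝ} {Z : Ω → ℝ} {c : ℕ → ℝ}

theorem antitone_tail (Z : Ω → ℝ) : Antitone (tail P Z) := fun _ _ hxy =>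
  measureReal_mono fun _ hω => lt_of_le_of_lt hxy hω

theorem tail_le_one (Z : Ω → ℝ) (x : ℝ) : tail P Z x ≤ 1 := measureReal_le_one

/-- Vague convergence of the rescaled law of the noise: the limit of `n E ψ (x Z / c_n)`. -/
theorem tendsto_mul_integral_scaled (hα : 0 < α) (hψ : Continuous ψ) {a : ℝ≥0∞} (ha : 0 < a)
    (ha' : a < ∞) (hψa : ∀ x, x < a → ψ x = 0) (hZ : Measurable Z)
    (hRV : IsRegularlyVarying (tail P Z) (-α))
    (hc : Tendsto (fun n : ℕ => (n : ℝ) * tail P Z (c n)) atTop (𝓝 1)) {x : ℝ} (hx : 0 ≤ x) :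
    Tendsto (fun n : ℕ => (n : ℝ) * ∫ ω, ψ (ENNReal.ofReal (x * Z ω / c n)) ∂P) atTop
      (𝓝 (x ^ α * frechetIntegral α ψ)) := by
  have hψ0 : ψ 0 = 0 := hψa 0 ha
  rcases hx.eq_or_lt with rfl | hx
  · simp [hψ0, Real.zero_rpow hα.ne']
  obtain ⟨b, hb0, hba⟩ := exists_between ha
  have hf : ∀ n, Measurable fun ω => ENNReal.ofReal (x * Z ω / c n) := fun n => by fun_prop
  have hk : Measurable fun t : ℝ => ENNReal.ofReal (t ^ (-(1 / α))) := by fun_prop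
  let ρ : ℕ → Measure ℝ≥0∞ := fun n =>
    (n : ℝ≥0∞) • P.map (fun ω => ENNReal.ofReal (x * Z ω / c n))
  let ρ₀ : Measure ℝ≥0∞ := ENNReal.ofReal (x ^ α) •
    (volume.restrict (Ioi (0 : ℝ))).map (fun t : ℝ => ENNReal.ofReal (t ^ (-(1 / α))))
  have hρ₀ : ∀ y : ℝ, 0 < y →
      ρ₀ (Ioi (ENNReal.ofReal y)) = ENNReal.ofReal (x ^ α * y ^ (-α)) := by
    intro y hy
    have hset : (fun t : ℝ => ENNReal.ofReal (t ^ (-(1 / α)))) ⁻¹' (Ioi (ENNReal.ofReal y)) ∩ Ioi 0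
        = Ioo 0 (y ^ (-α)) := by
      ext t
      simp only [mem_inter_iff, mem_preimage, mem_Ioi, mem_Ioo,
        ENNReal.ofReal_lt_ofReal_iff_of_nonneg hy.le]
      rw [and_comm]
      refine and_congr_right fun ht => ?_
      have hy' : y = (y ^ (-α)) ^ (-(1 / α)) := by
        rw [← Real.rpow_mul hy.le, show -α * -(1 / α) = 1 by field_simp, Real.rpow_one]
      conv_lhs => rw [hy']
      exact Real.rpow_lt_rpow_iff_of_neg (Real.rpow_pos_of_pos hy _) ht (by simp [hα])
    simp only [ρ₀, Measure.smul_apply, smul_eq_mul]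
    rw [Measure.map_apply hk measurableSet_Ioi, Measure.restrict_apply (hk measurableSet_Ioi), hset,
      Real.volume_Ioo, sub_zero, ENNReal.ofReal_mul (by positivity)]
  have hρ : ∀ y : ℝ, 0 < y → ∀ n, 0 < c n →
      ρ n (Ioi (ENNReal.ofReal y)) = ENNReal.ofReal (n * tail P Z (c n * (y / x))) := by
    intro y hy n hcn
    have hset : (fun ω => ENNReal.ofReal (x * Z ω / c n)) ⁻¹' (Ioi (ENNReal.ofReal y))
        = {ω | c n * (y / x) < Z ω} := by
      ext ω
      simp only [mem_preimage, mem_Ioi, ENNReal.ofReal_lt_ofReal_iff_of_nonneg hy.le,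
        mem_ofPred_eq]
      rw [lt_div_iff₀ hcn, ← mul_div_assoc, div_lt_iff₀ hx, mul_comm y, mul_comm x]
    simp only [ρ, Measure.smul_apply, smul_eq_mul]
    rw [Measure.map_apply (hf n) measurableSet_Ioi, hset, ENNReal.ofReal_mul (Nat.cast_nonneg n),
      ENNReal.ofReal_natCast, tail, ofReal_measureReal]
  have hcpos : ∀ᶠ n in atTop, 0 < c n :=
    (hRV.tendsto_atTop_of_mul (antitone_tail Z) hc).eventually (eventually_gt_atTop 0)
  have hlim : ∀ y, b ≤ y → Tendsto (fun n => ρ n (Ioi y)) atTop (𝓝 (ρ₀ (Ioi y))) := by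
    intro y hy
    rcases eq_or_ne y ∞ with rfl | hy1
    · simp
    obtain ⟨z, hz, rfl⟩ : ∃ z : ℝ, 0 < z ∧ ENNReal.ofReal z = y :=
      ⟨y.toReal, ENNReal.toReal_pos (hb0.trans_le hy).ne' hy1, ENNReal.ofReal_toReal hy1⟩
    rw [hρ₀ z hz]
    have h1 := hRV.tendsto_mul (antitone_tail Z) hc (x := z / x) (by positivity)
    have e : (z / x) ^ (-α) = x ^ α * z ^ (-α) := by
      rw [Real.div_rpow hz.le hx.le, Real.rpow_neg hx.le, div_inv_eq_mul, mul_comm]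
    rw [e] at h1
    refine ((ENNReal.continuous_ofReal.tendsto _).comp h1).congr' ?_
    filter_upwards [hcpos] with n hn
    exact (hρ z hz n hn).symm
  have hb1 : b ≠ ∞ := (hba.trans ha').ne
  have hρb : ρ₀ (Ioi b) = ENNReal.ofReal (x ^ α * b.toReal ^ (-α)) := by
    rw [← hρ₀ _ (ENNReal.toReal_pos hb0.ne' hb1), ENNReal.ofReal_toReal hb1]
  have hbpos : 0 < b.toReal := ENNReal.toReal_pos hb0.ne' hb1
  have hmain := tendsto_integral_of_tendsto_Ioi hlim
    (by rw [hρb]; exact (ENNReal.ofReal_pos.2 (by positivity)).ne')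
    (by rw [hρb]; exact ENNReal.ofReal_ne_top) hψ fun y hy => hψa y (hy.trans_lt hba)
  have e1 : ∀ n, ∫ y, ψ y ∂(ρ n) = (n : ℝ) * ∫ ω, ψ (ENNReal.ofReal (x * Z ω / c n)) ∂P := by
    intro n
    simp only [ρ]
    rw [integral_smul_measure, integral_map (hf n).aemeasurable hψ.aestronglyMeasurable,
      ENNReal.toReal_natCast, smul_eq_mul]
  have e2 : ∫ y, ψ y ∂ρ₀ = x ^ α * frechetIntegral α ψ := by
    simp only [ρ₀]
    rw [integral_smul_measure, integral_map hk.aemeasurable hψ.aestronglyMeasurable,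
      ENNReal.toReal_ofReal (by positivity), smul_eq_mul, frechetIntegral]
  simpa only [e1, e2] using hmain

/-- Breiman's lemma in the form of vague convergence: an independent factor `ξ` with a moment of
order `α + δ` multiplies the limit by `E ξ^α`. -/
theorem tendsto_mul_integral_mul (hα : 0 < α) (hψ : Continuous ψ) {a : ℝ≥0∞} (ha : 0 < a)
    (ha' : a < ∞) (hψa : ∀ x, x < a → ψ x = 0) (hZ : Measurable Z)
    (hRV : IsRegularlyVarying (tail P Z) (-α))
    (hc : Tendsto (fun n : ℕ => (n : ℝ) * tail P Z (c n)) atTop (𝓝 1)) {ξ : Ω → ℝ}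
    (hξ : Measurable ξ) (hξ0 : ∀ ω, 0 ≤ ξ ω) (hξZ : IndepFun ξ Z P) {δ : ℝ} (hδ : 0 < δ)
    (hint : Integrable (fun ω => ξ ω ^ (α + δ)) P) :
    Tendsto (fun n : ℕ => (n : ℝ) * ∫ ω, ψ (ENNReal.ofReal (ξ ω * Z ω / c n)) ∂P) atTop
      (𝓝 ((∫ ω, ξ ω ^ α ∂P) * frechetIntegral α ψ)) := by
  obtain ⟨B, hB⟩ : ∃ B, ∀ y, |ψ y| ≤ B :=
    ⟨_, fun y => (BoundedContinuousFunction.mkOfCompact ⟨ψ, hψ⟩).norm_coe_le_norm y⟩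
  have hB0 : 0 ≤ B := (abs_nonneg _).trans (hB 0)
  have hψ0 : ψ 0 = 0 := hψa 0 ha
  have e : ∀ n : ℕ, (n : ℝ) * ∫ ω, ψ (ENNReal.ofReal (ξ ω * Z ω / c n)) ∂P
      = ∫ ω, (n : ℝ) * ∫ ω', ψ (ENNReal.ofReal (ξ ω * Z ω' / c n)) ∂P ∂P := by
    intro n
    rw [integral_const_mul, integral_of_indepFun (H := fun p : ℝ × ℝ =>
      ψ (ENNReal.ofReal (p.1 * p.2 / c n))) hξ hZ hξZ
      (hψ.measurable.comp (by fun_prop)) (C := B) fun p => hB _]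
  simp only [e]
  rw [← integral_mul_const]
  obtain ⟨C, hC0, hC⟩ := hRV.exists_mul_le (antitone_tail Z) (tail_le_one Z) hα hδ hc
  set d : ℝ := a.toReal / 2
  have hd : 0 < d := half_pos (ENNReal.toReal_pos ha.ne' ha'.ne)
  have hcpos : ∀ᶠ n in atTop, 0 < c n :=
    (hRV.tendsto_atTop_of_mul (antitone_tail Z) hc).eventually (eventually_gt_atTop 0)
  refine tendsto_integral_filter_of_dominated_convergence
    (fun ω => B * (C * (1 + (d ^ (-(α + δ)) * ξ ω ^ (α + δ))))) ?_ ?_ ?_ ?_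
  · refine Eventually.of_forall fun n => ?_
    exact ((measurable_integral_prodMk (H := fun p : ℝ × ℝ =>
      ψ (ENNReal.ofReal (p.1 * p.2 / c n))) hZ (hψ.measurable.comp (by fun_prop))).comp
      hξ).aestronglyMeasurable.const_mul _
  · filter_upwards [hC, hcpos] with n hn hcn
    refine ae_of_all _ fun ω => ?_
    have hrhs : 0 ≤ d ^ (-(α + δ)) * ξ ω ^ (α + δ) :=
      mul_nonneg (by positivity) (Real.rpow_nonneg (hξ0 ω) _)
    rcases (hξ0 ω).eq_or_lt with h0 | h0
    · rw [← h0] at hrhs ⊢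
      simp only [zero_mul, zero_div, ENNReal.ofReal_zero, hψ0, integral_zero, mul_zero, norm_zero]
      positivity
    have h1 : ‖∫ ω', ψ (ENNReal.ofReal (ξ ω * Z ω' / c n)) ∂P‖
        ≤ B * tail P Z (c n * (d / ξ ω)) := by
      have hm : MeasurableSet {ω' | c n * (d / ξ ω) < Z ω'} := measurableSet_lt measurable_const hZ
      rw [tail, mul_comm, ← smul_eq_mul, ← integral_indicator_const _ hm]
      refine norm_integral_le_of_norm_le ((integrable_const B).indicator hm)
        (ae_of_all _ fun ω' => ?_)
      by_cases hω' : ω' ∈ {ω' | c n * (d / ξ ω) < Z ω'}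
      · rw [indicator_of_mem hω']
        exact hB _
      · rw [indicator_of_notMem hω', hψa, norm_zero]
        have h2 : Z ω' ≤ c n * (d / ξ ω) := not_lt.1 hω'
        have h3 : ξ ω * Z ω' / c n ≤ d := by
          rw [div_le_iff₀ hcn]
          calc ξ ω * Z ω' ≤ ξ ω * (c n * (d / ξ ω)) := mul_le_mul_of_nonneg_left h2 h0.le
            _ = d * c n := by field_simp
        refine (ENNReal.ofReal_le_ofReal h3).trans_lt ?_
        rw [ENNReal.ofReal_lt_iff_lt_toReal hd.le ha'.ne]
        exact half_lt_self (ENNReal.toReal_pos ha.ne' ha'.ne)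
    rw [norm_mul, Real.norm_natCast]
    calc (n : ℝ) * ‖∫ ω', ψ (ENNReal.ofReal (ξ ω * Z ω' / c n)) ∂P‖
        ≤ n * (B * tail P Z (c n * (d / ξ ω))) :=
          mul_le_mul_of_nonneg_left h1 (Nat.cast_nonneg n)
      _ = B * (n * tail P Z (c n * (d / ξ ω))) := by ring
      _ ≤ B * (C * (1 + (d / ξ ω) ^ (-(α + δ)))) :=
          mul_le_mul_of_nonneg_left (hn _ (by positivity)) hB0
      _ = _ := by
          rw [Real.div_rpow hd.le h0.le, Real.rpow_neg h0.le, div_inv_eq_mul]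
  · exact (((integrable_const 1).add (hint.const_mul _)).const_mul _).const_mul _
  · refine ae_of_all _ fun ω => ?_
    exact tendsto_mul_integral_scaled hα hψ ha ha' hψa hZ hRV hc (hξ0 ω)

end RescaledTail

/-! ### Laplace functionals of the two point processes -/

section LaplaceFunctionals

open Set

variable {E : Type*} [MetricSpace E] [MeasurableSpace E] [BorelSpace E]

/-- The function `x ↦ ∫ (1 - exp (-φ (x, u))) μ(du)`, the integrand of the exponent of the Laplace
functional of a Poisson process whose points have independent marks of law `μ`. -/
def laplaceExponent (μ : Measure E) (φ : C_c(PosExt × E, ℝ)) (x : ℝ≥0∞) : ℝ :=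
  ∫ u, (1 - Real.exp (-zeroExtend φ (x, u))) ∂μ

omit [MeasurableSpace E] [BorelSpace E] in
theorem exp_neg_zeroExtend_mem {φ : C_c(PosExt × E, ℝ)} (hφ : 0 ≤ φ) (p : ℝ≥0∞ × E) :
    0 ≤ Real.exp (-zeroExtend φ p) ∧ Real.exp (-zeroExtend φ p) ≤ 1 :=
  ⟨(Real.exp_pos _).le, Real.exp_le_one_iff.2 (neg_nonpos.2 (zeroExtend_nonneg hφ p))⟩

omit [MeasurableSpace E] [BorelSpace E] in
theorem norm_one_sub_exp_le {φ : C_c(PosExt × E, ℝ)} (hφ : 0 ≤ φ) (p : ℝ≥0∞ × E) :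
    ‖1 - Real.exp (-zeroExtend φ p)‖ ≤ 1 := by
  obtain ⟨h0, h1⟩ := exp_neg_zeroExtend_mem hφ p
  rw [Real.norm_eq_abs, abs_le]
  constructor <;> linarith

variable [SecondCountableTopology E]

theorem measurable_exp_neg_zeroExtend (φ : C_c(PosExt × E, ℝ)) :
    Measurable fun p => Real.exp (-zeroExtend φ p) :=
  (Real.continuous_exp.comp (continuous_zeroExtend φ).neg).measurable

theorem continuous_laplaceExponent (μ : Measure E) [IsProbabilityMeasure μ]
    {φ : C_c(PosExt × E, ℝ)} (hφ : 0 ≤ φ) : Continuous (laplaceExponent μ φ) := by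
  refine continuous_of_dominated (bound := fun _ => 1) (fun x => ?_)
    (fun x => ae_of_all _ fun _ => norm_one_sub_exp_le hφ _) (integrable_const _)
    (ae_of_all _ fun _ => ?_)
  · exact (measurable_const.sub ((measurable_exp_neg_zeroExtend φ).comp
      measurable_prodMk_left)).aestronglyMeasurable
  · exact continuous_const.sub (Real.continuous_exp.comp
      ((continuous_zeroExtend φ).comp (by fun_prop)).neg)

omit [SecondCountableTopology E] [BorelSpace E] in
theorem exists_laplaceExponent_eq_zero (μ : Measure E) (φ : C_c(PosExt × E, ℝ)) :
    ∃ a : ℝ≥0∞, 0 < a ∧ a < ∞ ∧ ∀ x, x < a → laplaceExponent μ φ x = 0 := by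
  obtain ⟨a, h0, h1, ha⟩ := exists_zeroExtend_eq_zero φ
  refine ⟨a, h0, h1, fun x hx => ?_⟩
  have : ∀ u : E, zeroExtend φ (x, u) = 0 := fun u => ha (x, u) hx
  simp [laplaceExponent, this]

omit [SecondCountableTopology E] [BorelSpace E] in
theorem laplaceExponent_nonneg (μ : Measure E) {φ : C_c(PosExt × E, ℝ)} (hφ : 0 ≤ φ) (x : ℝ≥0∞) :
    0 ≤ laplaceExponent μ φ x :=
  integral_nonneg fun _ => sub_nonneg.2 (exp_neg_zeroExtend_mem hφ _).2

variable {Ω : Type*} [MeasurableSpace Ω] {P : Measure Ω} [IsProbabilityMeasure P]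

/-- Integrating out an independent mark. -/
theorem one_sub_integral_exp_neg {X : Ω → ℝ≥0∞} {V : Ω → E} (hX : Measurable X)
    (hV : Measurable V) (h : IndepFun X V P) {φ : C_c(PosExt × E, ℝ)} (hφ : 0 ≤ φ) :
    1 - ∫ ω, Real.exp (-zeroExtend φ (X ω, V ω)) ∂P
      = ∫ ω, laplaceExponent (P.map V) φ (X ω) ∂P := by
  have hm := measurable_exp_neg_zeroExtend φ
  have hint : Integrable (fun ω => Real.exp (-zeroExtend φ (X ω, V ω))) P := by
    refine Integrable.of_bound (hm.comp (hX.prodMk hV)).aestronglyMeasurable 1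
      (ae_of_all _ fun ω => ?_)
    obtain ⟨h0, h1⟩ := exp_neg_zeroExtend_mem hφ (X ω, V ω)
    rwa [Real.norm_eq_abs, abs_of_nonneg h0]
  have e1 : 1 - ∫ ω, Real.exp (-zeroExtend φ (X ω, V ω)) ∂P
      = ∫ ω, (1 - Real.exp (-zeroExtend φ (X ω, V ω))) ∂P := by
    rw [integral_sub (integrable_const _) hint]
    simp
  rw [e1, integral_of_indepFun (H := fun p : ℝ≥0∞ × E => 1 - Real.exp (-zeroExtend φ p)) hX hV h
    (measurable_const.sub hm) (C := 1) fun p => norm_one_sub_exp_le hφ p]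
  congr 1 with ω
  exact (integral_map (f := fun u => 1 - Real.exp (-zeroExtend φ (X ω, u))) hV.aemeasurable
    (measurable_const.sub (hm.comp measurable_prodMk_left)).aestronglyMeasurable).symm

omit [IsProbabilityMeasure P] [SecondCountableTopology E] [BorelSpace E] in
theorem expNeg_ofMeasure {m : Measure (PosExt × E)} (h : IsRadonPointMeasure m)
    (φ : C_c(PosExt × E, ℝ)) :
    (PointMeasure.ofMeasure m).expNeg φ = Real.exp (-∫ p, φ p ∂m) := by
  rw [PointMeasure.expNeg, PointMeasure.ofMeasure_val h]

/-- The Laplace functional of the noisy point process. -/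
theorem integral_expNeg_noisy {X : ℕ → Ω → ℝ≥0∞} {U : ℕ → Ω → E}
    (hV : IsIID (fun i ω => (X i ω, U i ω)) P) (hXU : IndepFun (X 0) (U 0) P) {N : Ω → ℕ}
    (hN : Measurable N) {r : ℝ≥0} (hNr : P.map N = poissonMeasure r)
    (hNV : IndepFun N (fun ω i => (X i ω, U i ω)) P) {φ : C_c(PosExt × E, ℝ)} (hφ : 0 ≤ φ) :
    ∫ ω, (PointMeasure.ofMeasure
        (pointSum (Iio (N ω)) (fun i => X i ω) (fun i => U i ω))).expNeg φ ∂P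
      = Real.exp (-(r * ∫ ω, laplaceExponent (P.map (U 0)) φ (X 0 ω) ∂P)) := by
  have hXm : Measurable (X 0) := measurable_fst.comp (hV.measurable 0)
  have hUm : Measurable (U 0) := measurable_snd.comp (hV.measurable 0)
  rw [← one_sub_integral_exp_neg hXm hUm hXU hφ]
  rw [← integral_prod_range_poisson hV hN hNr hNV (measurable_exp_neg_zeroExtend φ)
    (fun p => (exp_neg_zeroExtend_mem hφ p).1) (fun p => (exp_neg_zeroExtend_mem hφ p).2)]
  congr 1 with ω
  have hR := isRadonPointMeasure_pointSum (finite_Iio (N ω)) (fun i => X i ω) (fun i => U i ω)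
  have hs := hasSum_integral_pointSum hR φ
  have hs' : HasSum (fun i => (Iio (N ω)).indicator (fun i => zeroExtend φ (X i ω, U i ω)) i)
      (∑ i ∈ Finset.range (N ω), zeroExtend φ (X i ω, U i ω)) := by
    have h : ∀ i ∉ Finset.range (N ω),
        (Iio (N ω)).indicator (fun i => zeroExtend φ (X i ω, U i ω)) i = 0 := fun i hi =>
      indicator_of_notMem (fun h : i ∈ Iio (N ω) => hi (Finset.mem_range.2 h)) _
    rw [← Finset.sum_congr rfl fun i hi => indicator_of_mem
      (show i ∈ Iio (N ω) from Finset.mem_range.1 hi) fun i => zeroExtend φ (X i ω, U i ω)]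
    exact hasSum_sum_of_ne_finset_zero h
  rw [expNeg_ofMeasure hR, hs.unique hs', ← Finset.sum_neg_distrib, Real.exp_sum]

theorem continuousOn_integral_scaled {α : ℝ} {ψ : ℝ≥0∞ → ℝ} (hψ : Continuous ψ) {ξ : Ω → ℝ}
    (hξ : Measurable ξ) :
    ContinuousOn (fun t : ℝ => ∫ ω, ψ (ENNReal.ofReal (ξ ω * t ^ (-(1 / α)))) ∂P) (Set.Ioi 0) := by
  obtain ⟨B, hB⟩ : ∃ B, ∀ y, ‖ψ y‖ ≤ B :=
    ⟨_, fun y => (BoundedContinuousFunction.mkOfCompact ⟨ψ, hψ⟩).norm_coe_le_norm y⟩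
  refine continuousOn_of_dominated (bound := fun _ => B) (fun t _ => ?_)
    (fun t _ => ae_of_all _ fun ω => hB _) (integrable_const _)
    (ae_of_all _ fun ω => continuousOn_scaled hψ _)
  have hm : Measurable fun ω => ENNReal.ofReal (ξ ω * t ^ (-(1 / α))) :=
    (hξ.mul_const _).ennreal_ofReal
  exact (hψ.measurable.comp hm).aestronglyMeasurable

theorem integrable_scaled_prod {α : ℝ} (hα : 0 < α) {ψ : ℝ≥0∞ → ℝ} (hψ : Continuous ψ)
    (hψn : ∀ x, 0 ≤ ψ x) {a : ℝ≥0∞} (ha : 0 < a) (hψa : ∀ x, x < a → ψ x = 0) {ξ : Ω → ℝ}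
    (hξ : Measurable ξ) (hξ0 : ∀ ω, 0 ≤ ξ ω) (hint : Integrable (fun ω => ξ ω ^ α) P) :
    Integrable (fun p : ℝ × Ω => ψ (ENNReal.ofReal (ξ p.2 * p.1 ^ (-(1 / α)))))
      ((volume.restrict (Set.Ioi 0)).prod P) := by
  have hm : Measurable fun p : ℝ × Ω => ENNReal.ofReal (ξ p.2 * p.1 ^ (-(1 / α))) :=
    ((hξ.comp measurable_snd).mul (measurable_fst.pow_const _)).ennreal_ofReal
  refine (integrable_prod_iff' (hψ.measurable.comp hm).aestronglyMeasurable).2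
    ⟨ae_of_all _ fun ω => integrableOn_scaled hα hψ ha hψa (ξ ω), ?_⟩
  change Integrable (fun ω => ∫ t in Ioi (0 : ℝ), ‖ψ (ENNReal.ofReal (ξ ω * t ^ (-(1 / α))))‖) P
  simp only [Real.norm_of_nonneg (hψn _), setIntegral_scaled hα (hψa 0 ha) (hξ0 _)]
  exact hint.mul_const _

/-- The Laplace functional of the limiting point process. -/
theorem integral_expNeg_limit {α : ℝ} (hα : 0 < α) {T : ℕ → Ω → ℝ} (hT : IsIID T P)
    (hTlaw : ∀ i, P.map (T i) = expMeasure 1) {ξ : ℕ → Ω → ℝ} {U : ℕ → Ω → E}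
    (hξ0 : ∀ i ω, 0 ≤ ξ i ω) (hW : IsIID (fun i ω => (ξ i ω, U i ω)) P)
    (hξU : IndepFun (ξ 0) (U 0) P)
    (hTW : Indep (sigmaOf T) (sigmaOf fun i ω => (ξ i ω, U i ω)) P)
    (hint : Integrable (fun ω => ξ 0 ω ^ α) P) {φ : C_c(PosExt × E, ℝ)} (hφ : 0 ≤ φ)
    (hR : ∀ᵐ ω ∂P, IsRadonPointMeasure (pointSum univ
      (fun l => ENNReal.ofReal (ξ l ω * arrivalTime T l ω ^ (-(1 / α)))) (fun l => U l ω))) :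
    ∫ ω, (PointMeasure.ofMeasure (pointSum univ
      (fun l => ENNReal.ofReal (ξ l ω * arrivalTime T l ω ^ (-(1 / α))))
        (fun l => U l ω))).expNeg φ ∂P
      = Real.exp (-((∫ ω, ξ 0 ω ^ α ∂P) *
        frechetIntegral α (laplaceExponent (P.map (U 0)) φ))) := by
  have hξm : Measurable (ξ 0) := measurable_fst.comp (hW.measurable 0)
  have hUm : Measurable (U 0) := measurable_snd.comp (hW.measurable 0)
  have := Measure.isProbabilityMeasure_map (μ := P) hUm.aemeasurable
  have hψ := continuous_laplaceExponent (P.map (U 0)) hφ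
  have hψn := laplaceExponent_nonneg (P.map (U 0)) hφ
  obtain ⟨a, ha, -, hψa⟩ := exists_laplaceExponent_eq_zero (P.map (U 0)) φ
  have hh' := fun (t : ℝ) =>
    one_sub_integral_exp_neg (P := P) (X := fun ω => ENNReal.ofReal (ξ 0 ω * t ^ (-(1 / α))))
      (hξm.mul_const _).ennreal_ofReal hUm
      (hξU.comp (φ := fun x => ENNReal.ofReal (x * t ^ (-(1 / α)))) (by fun_prop) measurable_id) hφ
  generalize laplaceExponent (P.map (U 0)) φ = ψ at *
  let g : ℝ × (ℝ × E) → ℝ := fun p =>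
    Real.exp (-zeroExtend φ (ENNReal.ofReal (p.2.1 * p.1 ^ (-(1 / α))), p.2.2))
  have hg : Measurable g := (measurable_exp_neg_zeroExtend φ).comp (by fun_prop)
  -- the expected contribution of a point of given arrival time
  have hh : ∀ t, 1 - ∫ ω, g (t, (ξ 0 ω, U 0 ω)) ∂P
      = ∫ ω, ψ (ENNReal.ofReal (ξ 0 ω * t ^ (-(1 / α)))) ∂P := hh'
  have hcont : ContinuousOn (fun t : ℝ => ∫ ω, ψ (ENNReal.ofReal (ξ 0 ω * t ^ (-(1 / α)))) ∂P)
      (Ioi 0) := continuousOn_integral_scaled hψ hξm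
  have hc : ContinuousOn (fun t => ∫ ω, g (t, (ξ 0 ω, U 0 ω)) ∂P) (Ioi 0) := by
    refine (continuousOn_const (c := (1 : ℝ)).sub hcont).congr fun t _ => ?_
    simp only [Pi.sub_apply, ← hh]
    ring
  have hprod := integrable_scaled_prod hα hψ hψn ha hψa hξm (hξ0 0) hint
  have hi : IntegrableOn (fun t => 1 - ∫ ω, g (t, (ξ 0 ω, U 0 ω)) ∂P) (Ioi 0) := by
    simp only [hh]
    exact hprod.integral_prod_left
  have hexp : ∫ t in Ioi 0, (1 - ∫ ω, g (t, (ξ 0 ω, U 0 ω)) ∂P)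
      = (∫ ω, ξ 0 ω ^ α ∂P) * frechetIntegral α ψ := by
    simp only [hh]
    rw [integral_integral_swap hprod, ← integral_mul_const]
    congr 1 with ω
    exact setIntegral_scaled hα (hψa 0 ha) (hξ0 0 ω)
  rw [← hexp]
  refine integral_eq_exp_of_tendsto_prod_arrivalTime hT hTlaw hW hTW hg
    (fun p => (exp_neg_zeroExtend_mem hφ _).1) (fun p => (exp_neg_zeroExtend_mem hφ _).2) hc hi ?_
  filter_upwards [hR] with ω hω
  have hs := (hasSum_integral_pointSum hω φ).tendsto_sum_nat
  simp only [indicator_univ] at hs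
  rw [expNeg_ofMeasure hω]
  refine ((Real.continuous_exp.tendsto _).comp hs.neg).congr fun n => ?_
  simp only [Function.comp_apply, g]
  rw [← Finset.sum_neg_distrib, Real.exp_sum]

omit [BorelSpace E] [SecondCountableTopology E] in
/-- Almost surely, the limiting point process is Radon. -/
theorem ae_isRadonPointMeasure_limit {α : ℝ} (hα : 0 < α) {T : ℕ → Ω → ℝ} (hT : IsIID T P)
    (hTlaw : ∀ i, P.map (T i) = expMeasure 1) {ξ : ℕ → Ω → ℝ} (hξ : IsIID ξ P)
    (hξ0 : ∀ i ω, 0 ≤ ξ i ω) (hint : Integrable (fun ω => ξ 0 ω ^ α) P) (U : ℕ → Ω → E) :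
    ∀ᵐ ω ∂P, IsRadonPointMeasure (pointSum univ
      (fun l => ENNReal.ofReal (ξ l ω * arrivalTime T l ω ^ (-(1 / α)))) (fun l => U l ω)) := by
  filter_upwards [ae_finite_le_mul_arrivalTime hT hTlaw hξ hξ0 hα hint] with ω hω
  refine isRadonPointMeasure_pointSum_of_finite _ fun a ha => ?_
  simpa using hω a ha

end LaplaceFunctionals

/-! ### The point processes for a frozen signal -/

section FixedSignal

variable {E : Type*} [MetricSpace E] [MeasurableSpace E] [BorelSpace E]
  [SecondCountableTopology E]
  {Ω : Type*} [MeasurableSpace Ω] {P : Measure Ω} [IsProbabilityMeasure P]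

theorem measurable_comp_label {S : Type*} [MeasurableSpace S] {ε : ℕ → S → ℝ}
    (hε : ∀ k, Measurable (ε k)) {Y : S → ℕ} (hY : Measurable Y) :
    Measurable fun s => ε (Y s) s :=
  (measurable_from_prod_countable_right (f := fun p : ℕ × S => ε p.1 p.2) hε).comp
    (hY.prodMk measurable_id)

theorem measurable_arrivalTime {S : Type*} [MeasurableSpace S] {T : ℕ → S → ℝ}
    (hT : ∀ i, Measurable (T i)) (l : ℕ) : Measurable (arrivalTime T l) :=
  Finset.measurable_fun_sum _ fun j _ => hT j

theorem measurable_ofMeasure_noisyPointProcess [LocallyCompactSpace E] {S : Type*}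
    [MeasurableSpace S] {ε Z : ℕ → S → ℝ} {Y : ℕ → S → ℕ} {U : ℕ → S → E} {N : S → ℕ}
    (hε : ∀ k, Measurable (ε k)) (hZ : ∀ i, Measurable (Z i)) (hY : ∀ i, Measurable (Y i))
    (hU : ∀ i, Measurable (U i)) (hN : Measurable N) (c : ℝ) :
    Measurable fun s => PointMeasure.ofMeasure (noisyPointProcess ε Z Y U N c s) :=
  measurable_ofMeasure_pointSum
    (x := fun i s => ENNReal.ofReal (ε (Y i s) s * Z i s / c))
    (fun _ => measurableSet_lt measurable_const hN)
    (fun i => (((measurable_comp_label hε (hY i)).mul (hZ i)).div_const c).ennreal_ofReal) hU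

theorem measurable_limit_height {S : Type*} [MeasurableSpace S] {ε T : ℕ → S → ℝ} {Y : ℕ → S → ℕ}
    (hε : ∀ k, Measurable (ε k)) (hT : ∀ i, Measurable (T i)) (hY : ∀ i, Measurable (Y i))
    (a : ℝ) (l : ℕ) :
    Measurable fun s => ENNReal.ofReal (ε (Y l s) s * arrivalTime T l s ^ (-(1 / a))) :=
  ((measurable_comp_label hε (hY l)).mul
    ((measurable_arrivalTime hT l).pow_const _)).ennreal_ofReal

theorem measurable_ofMeasure_limitPointProcess [LocallyCompactSpace E] {S : Type*}
    [MeasurableSpace S] {ε T : ℕ → S → ℝ} {Y : ℕ → S → ℕ} {U : ℕ → S → E}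
    (hε : ∀ k, Measurable (ε k)) (hT : ∀ i, Measurable (T i)) (hY : ∀ i, Measurable (Y i))
    (hU : ∀ i, Measurable (U i)) (a : ℝ) :
    Measurable fun s => PointMeasure.ofMeasure (limitPointProcess a ε T Y U s) :=
  measurable_ofMeasure_pointSum (I := fun _ => Set.univ) (fun i => by simp)
    (measurable_limit_height hε hT hY a) hU

theorem measurableSet_isRadonPointMeasure_limitPointProcess [LocallyCompactSpace E] {S : Type*}
    [MeasurableSpace S] {ε T : ℕ → S → ℝ} {Y : ℕ → S → ℕ} {U : ℕ → S → E}
    (hε : ∀ k, Measurable (ε k)) (hT : ∀ i, Measurable (T i)) (hY : ∀ i, Measurable (Y i))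
    (hU : ∀ i, Measurable (U i)) (a : ℝ) :
    MeasurableSet {s | IsRadonPointMeasure (limitPointProcess a ε T Y U s)} :=
  measurableSet_isRadonPointMeasure_pointSum (I := fun _ => Set.univ) (fun i => by simp)
    (measurable_limit_height hε hT hY a) hU

variable {U : ℕ → Ω → E} {Y : ℕ → Ω → ℕ} {Z : ℕ → Ω → ℝ} {N : ℕ → Ω → ℕ} {T : ℕ → Ω → ℝ}
  {α δ : ℝ} {c : ℕ → ℝ} {e : ℕ → ℝ}

theorem integrable_rpow_of_integrable_rpow_add (hα : 0 < α) (hδ : 0 < δ) {ξ : Ω → ℝ}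
    (hξ : Measurable ξ) (hξ0 : ∀ ω, 0 ≤ ξ ω) (h : Integrable (fun ω => ξ ω ^ (α + δ)) P) :
    Integrable (fun ω => ξ ω ^ α) P := by
  refine ((integrable_const (1 : ℝ)).add h).mono' (hξ.pow_const _).aestronglyMeasurable
    (ae_of_all _ fun ω => ?_)
  rw [Real.norm_of_nonneg (Real.rpow_nonneg (hξ0 ω) _)]
  simp only [Pi.add_apply]
  rcases le_total (ξ ω) 1 with h1 | h1
  · linarith [Real.rpow_le_one (hξ0 ω) h1 hα.le, Real.rpow_nonneg (hξ0 ω) (α + δ)]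
  · linarith [Real.rpow_le_rpow_of_exponent_le h1 (show α ≤ α + δ by linarith)]

/-- The Laplace functional of the limiting process for a frozen signal `e`; it involves the signal
only through `∫ e_Y ^ α`. -/
theorem integral_expNeg_limitPointProcess (hU : IsIID U P) (hY : IsIID Y P) (hT : IsIID T P)
    (hTlaw : ∀ i, P.map (T i) = expMeasure 1) (hYU : Indep (sigmaOf Y) (sigmaOf U) P)
    (hTYU : Indep (sigmaOf T) (sigmaOf Y ⊔ sigmaOf U) P) (hα : 0 < α) (he : ∀ k, 0 ≤ e k)
    (hint : Integrable (fun ω => e (Y 0 ω) ^ α) P) {φ : C_c(PosExt × E, ℝ)} (hφ : 0 ≤ φ) :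
    ∫ ω, (PointMeasure.ofMeasure (limitPointProcess α (fun k _ => e k) T Y U ω)).expNeg φ ∂P
      = Real.exp (-((∫ ω, e (Y 0 ω) ^ α ∂P) *
        frechetIntegral α (laplaceExponent (P.map (U 0)) φ))) := by
  have he' : Measurable e := measurable_of_countable e
  have hW := (hY.prodMk hU hYU).comp (f := fun p : ℕ × E => (e p.1, p.2)) (by fun_prop)
  refine integral_expNeg_limit (ξ := fun i ω => e (Y i ω)) (U := U) hα hT hTlaw
    (fun _ _ => he _) hW ?_ ?_ hint hφ ?_
  · exact IndepFun.comp (f := fun ω i => Y i ω) (g := fun ω i => U i ω)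
      (φ := fun y => e (y 0)) (ψ := fun u => u 0) hYU (he'.comp (measurable_pi_apply 0))
      (measurable_pi_apply 0)
  · refine indep_of_indep_of_le_right hTYU ?_
    exact (sigmaOf_comp_le (fun i ω => (Y i ω, U i ω)) (f := fun p : ℕ × E => (e p.1, p.2))
      (by fun_prop)).trans (sigmaOf_prodMk_le Y U)
  · exact ae_isRadonPointMeasure_limit hα hT hTlaw (hY.comp he') (fun i ω => he _) hint U

omit [BorelSpace E] [SecondCountableTopology E] in
theorem ae_isRadonPointMeasure_limitPointProcess (hY : IsIID Y P) (hT : IsIID T P)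
    (hTlaw : ∀ i, P.map (T i) = expMeasure 1) (hα : 0 < α) (he : ∀ k, 0 ≤ e k)
    (hint : Integrable (fun ω => e (Y 0 ω) ^ α) P) (U : ℕ → Ω → E) :
    ∀ᵐ ω ∂P, IsRadonPointMeasure (limitPointProcess α (fun k _ => e k) T Y U ω) :=
  ae_isRadonPointMeasure_limit hα hT hTlaw (hY.comp (measurable_of_countable e))
    (fun _ _ => he _) hint U

/-- For a frozen signal `e`, the noisy point processes converge in law: their Laplace functionals
converge by Breiman's lemma. -/
theorem tendsto_integral_noisyPointProcess [LocallyCompactSpace E] (hU : IsIID U P)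
    (hY : IsIID Y P) (hZ : IsIID Z P) (hT : IsIID T P)
    (hTlaw : ∀ i, P.map (T i) = expMeasure 1) (hN : ∀ n, Measurable (N n))
    (hNlaw : ∀ n : ℕ, P.map (N n) = poissonMeasure (n : ℝ≥0))
    (hYZ : Indep (sigmaOf Y) (sigmaOf Z) P)
    (hYZU : Indep (sigmaOf Y ⊔ sigmaOf Z) (sigmaOf U) P)
    (hNV : ∀ n, Indep (MeasurableSpace.comap (N n) inferInstance)
      (sigmaOf Y ⊔ sigmaOf Z ⊔ sigmaOf U) P)
    (hTYU : Indep (sigmaOf T) (sigmaOf Y ⊔ sigmaOf U) P)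
    (hα : 0 < α) (hδ : 0 < δ) (hRV : IsRegularlyVarying (tail P (Z 0)) (-α))
    (hc : Tendsto (fun n : ℕ => (n : ℝ) * tail P (Z 0) (c n)) atTop (𝓝 1))
    (he : ∀ k, 0 ≤ e k) (hint : Integrable (fun ω => e (Y 0 ω) ^ (α + δ)) P)
    (f : PointMeasure (PosExt × E) →ᵇ ℝ) :
    Tendsto (fun n => ∫ ω, f (PointMeasure.ofMeasure
        (noisyPointProcess (fun k _ => e k) Z Y U (N n) (c n) ω)) ∂P) atTop
      (𝓝 (∫ ω, f (PointMeasure.ofMeasure (limitPointProcess α (fun k _ => e k) T Y U ω)) ∂P)) := by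
  have he' : Measurable e := measurable_of_countable e
  have heY : Measurable fun ω => e (Y 0 ω) := he'.comp (hY.measurable 0)
  refine PointMeasure.tendsto_integral_of_tendsto_laplace
    (fun n => (measurable_ofMeasure_noisyPointProcess (fun k => measurable_const) hZ.measurable
      hY.measurable hU.measurable (hN n) (c n)).aemeasurable)
    (measurable_ofMeasure_limitPointProcess (fun k => measurable_const) hT.measurable
      hY.measurable hU.measurable α).aemeasurable (fun φ hφ => ?_) f
  rw [integral_expNeg_limitPointProcess hU hY hT hTlaw
    (indep_of_indep_of_le_left hYZU le_sup_left) hTYU hα he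
    (integrable_rpow_of_integrable_rpow_add hα hδ heY (fun ω => he _) hint) hφ]
  have hnoisy : ∀ n, ∫ ω, (PointMeasure.ofMeasure
      (noisyPointProcess (fun k _ => e k) Z Y U (N n) (c n) ω)).expNeg φ ∂P
      = Real.exp (-((n : ℝ) * ∫ ω, laplaceExponent (P.map (U 0)) φ
          (ENNReal.ofReal (e (Y 0 ω) * Z 0 ω / c n)) ∂P)) := by
    intro n
    have hf : Measurable fun p : (ℕ × ℝ) × E => (ENNReal.ofReal (e p.1.1 * p.1.2 / c n), p.2) := by
      fun_prop
    have hYZU' : Indep (sigmaOf fun i ω => (Y i ω, Z i ω)) (sigmaOf U) P :=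
      indep_of_indep_of_le_left hYZU (sigmaOf_prodMk_le Y Z)
    refine integral_expNeg_noisy (X := fun i ω => ENNReal.ofReal (e (Y i ω) * Z i ω / c n))
      (((hY.prodMk hZ hYZ).prodMk hU hYZU').comp hf) ?_ (hN n) (r := n) (hNlaw n) ?_ hφ
    · exact IndepFun.comp (f := fun ω i => (Y i ω, Z i ω)) (g := fun ω i => U i ω)
        (φ := fun y => ENNReal.ofReal (e (y 0).1 * (y 0).2 / c n)) (ψ := fun u => u 0) hYZU'
        (by fun_prop) (measurable_pi_apply 0)
    · refine indep_of_indep_of_le_right (hNV n) ?_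
      refine (sigmaOf_comp_le (fun i ω => ((Y i ω, Z i ω), U i ω)) hf).trans ?_
      exact (sigmaOf_prodMk_le _ U).trans (sup_le_sup_right (sigmaOf_prodMk_le Y Z) _)
  simp only [hnoisy]
  have := Measure.isProbabilityMeasure_map (μ := P) (hU.measurable 0).aemeasurable
  obtain ⟨a, ha, ha', hψa⟩ := exists_laplaceExponent_eq_zero (P.map (U 0)) φ
  have hYZ0 : IndepFun (fun ω => e (Y 0 ω)) (Z 0) P :=
    IndepFun.comp (f := fun ω i => Y i ω) (g := fun ω i => Z i ω)
      (φ := fun y => e (y 0)) (ψ := fun u => u 0) hYZ (he'.comp (measurable_pi_apply 0))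
      (measurable_pi_apply 0)
  exact (Real.continuous_exp.tendsto _).comp (tendsto_mul_integral_mul hα
    (continuous_laplaceExponent _ hφ) ha ha' hψa (hZ.measurable 0) hRV hc heY (fun ω => he _) hYZ0
    hδ hint).neg

/-- For a frozen signal `e`, the law of the limiting process does not change if the random factors
`e_Y` are replaced by the constant `(∫ e_Y ^ α) ^ (1 / α)`. -/
theorem integral_limitPointProcess_eq [LocallyCompactSpace E] (hU : IsIID U P)
    (hY : IsIID Y P) (hT : IsIID T P)
    (hTlaw : ∀ i, P.map (T i) = expMeasure 1) (hYU : Indep (sigmaOf Y) (sigmaOf U) P)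
    (hTYU : Indep (sigmaOf T) (sigmaOf Y ⊔ sigmaOf U) P) (hα : 0 < α) (he : ∀ k, 0 ≤ e k)
    (hint : Integrable (fun ω => e (Y 0 ω) ^ α) P) (f : PointMeasure (PosExt × E) →ᵇ ℝ) :
    ∫ ω, f (PointMeasure.ofMeasure (limitPointProcess α (fun k _ => e k) T Y U ω)) ∂P
      = ∫ ω, f (PointMeasure.ofMeasure (limitPointProcess α
        (fun _ _ => (∫ ω', e (Y 0 ω') ^ α ∂P) ^ (1 / α)) T Y U ω)) ∂P := by
  set σ := (∫ ω', e (Y 0 ω') ^ α ∂P) ^ (1 / α) with hσ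
  have hm : 0 ≤ ∫ ω', e (Y 0 ω') ^ α ∂P := integral_nonneg fun ω => Real.rpow_nonneg (he _) _
  have hσα : σ ^ α = ∫ ω', e (Y 0 ω') ^ α ∂P := by
    rw [hσ, ← Real.rpow_mul hm, one_div_mul_cancel hα.ne', Real.rpow_one]
  have hmeas : ∀ e : ℕ → ℝ, AEMeasurable (fun ω => PointMeasure.ofMeasure
      (limitPointProcess α (fun k _ => e k) T Y U ω)) P := fun e =>
    (measurable_ofMeasure_limitPointProcess (fun k => measurable_const) hT.measurable
      hY.measurable hU.measurable α).aemeasurable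
  refine tendsto_nhds_unique (tendsto_const_nhds (f := (atTop : Filter ℕ)))
    (PointMeasure.tendsto_integral_of_tendsto_laplace (fun _ => hmeas e) (hmeas fun _ => σ)
      (fun φ hφ => ?_) f)
  rw [integral_expNeg_limitPointProcess hU hY hT hTlaw hYU hTYU hα he hint hφ,
    integral_expNeg_limitPointProcess (e := fun _ => σ) hU hY hT hTlaw hYU hTYU hα
      (fun _ => Real.rpow_nonneg hm _) (integrable_const _) hφ, integral_const, hσα]
  simp

end FixedSignal

/-! ### Conditioning on the signal -/

section Freezing

variable {Ω S S' : Type*} [MeasurableSpace Ω] [MeasurableSpace S] [MeasurableSpace S']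
  {P : Measure Ω} [IsProbabilityMeasure P]

/-- A property of two independent random elements which holds almost surely for almost every
frozen value of the first one holds almost surely. -/
theorem ae_of_indepFun {X : Ω → S} {V : Ω → S'} (hX : Measurable X) (hV : Measurable V)
    (h : IndepFun X V P) {A : Set (S × S')} (hA : MeasurableSet A)
    (hAE : ∀ᵐ ω ∂P, ∀ᵐ ω' ∂P, (X ω, V ω') ∈ A) : ∀ᵐ ω ∂P, (X ω, V ω) ∈ A := by
  have := Measure.isProbabilityMeasure_map (μ := P) hX.aemeasurable
  have := Measure.isProbabilityMeasure_map (μ := P) hV.aemeasurable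
  have hprod := (indepFun_iff_map_prod_eq_prod_map_map hX.aemeasurable hV.aemeasurable).1 h
  have h0 : (P.map fun ω => (X ω, V ω)) Aᶜ = 0 := by
    rw [hprod, Measure.prod_apply hA.compl, lintegral_map (measurable_measure_prodMk_left hA.compl)
      hX]
    refine (lintegral_congr_ae ?_).trans lintegral_zero
    filter_upwards [hAE] with ω hω
    rw [Measure.map_apply hV (measurable_prodMk_left hA.compl)]
    exact hω
  rw [Measure.map_apply (hX.prodMk hV) hA.compl] at h0
  exact h0

variable {E : Type*} [MetricSpace E] [MeasurableSpace E] [BorelSpace E]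
  [SecondCountableTopology E] [LocallyCompactSpace E]
  {U : ℕ → Ω → E} {ε : ℕ → Ω → ℝ} {Y : ℕ → Ω → ℕ} {Z T : ℕ → Ω → ℝ} {N : Ω → ℕ}

/-- The signal may be frozen in conditional expectations of the noisy point process. -/
theorem condExp_noisyPointProcess (hU : ∀ i, Measurable (U i)) (hε : ∀ i, Measurable (ε i))
    (hY : ∀ i, Measurable (Y i)) (hZ : ∀ i, Measurable (Z i)) (hN : Measurable N)
    (h : IndepFun (fun ω i => ε i ω)
      (fun ω => ((fun i => U i ω), (fun i => Y i ω), (fun i => Z i ω), N ω)) P)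
    (c : ℝ) (f : PointMeasure (PosExt × E) →ᵇ ℝ) :
    P[fun ω => f (PointMeasure.ofMeasure (noisyPointProcess ε Z Y U N c ω)) | sigmaOf ε]
      =ᵐ[P] fun ω => ∫ ω', f (PointMeasure.ofMeasure
        (noisyPointProcess (fun k _ => ε k ω) Z Y U N c ω')) ∂P := by
  have hm : Measurable fun p : (ℕ → ℝ) × ((ℕ → E) × (ℕ → ℕ) × (ℕ → ℝ) × ℕ) =>
      f (PointMeasure.ofMeasure (noisyPointProcess (fun k p => p.1 k) (fun i p => p.2.2.2.1 i)
        (fun i p => p.2.2.1 i) (fun i p => p.2.1 i) (fun p => p.2.2.2.2) c p)) :=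
    f.continuous.measurable.comp (measurable_ofMeasure_noisyPointProcess (fun k => by fun_prop)
      (fun i => by fun_prop) (fun i => by fun_prop) (fun i => by fun_prop) (by fun_prop) c)
  exact condExp_of_indepFun (measurable_pi_lambda _ hε)
    ((measurable_pi_lambda _ hU).prodMk ((measurable_pi_lambda _ hY).prodMk
      ((measurable_pi_lambda _ hZ).prodMk hN))) h hm (C := ‖f‖) fun p => f.norm_coe_le_norm _

/-- The signal, or a function of it, may be frozen in conditional expectations of the limiting
point process. -/
theorem condExp_limitPointProcess (hU : ∀ i, Measurable (U i)) (hε : ∀ i, Measurable (ε i))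
    (hY : ∀ i, Measurable (Y i)) (hT : ∀ i, Measurable (T i))
    (h : IndepFun (fun ω i => ε i ω)
      (fun ω => ((fun i => U i ω), (fun i => Y i ω), (fun i => T i ω))) P)
    {G : ℕ → (ℕ → ℝ) → ℝ} (hG : ∀ k, Measurable (G k))
    (a : ℝ) (f : PointMeasure (PosExt × E) →ᵇ ℝ) :
    P[fun ω => f (PointMeasure.ofMeasure
        (limitPointProcess a (fun k ω => G k fun i => ε i ω) T Y U ω)) | sigmaOf ε]
      =ᵐ[P] fun ω => ∫ ω', f (PointMeasure.ofMeasure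
        (limitPointProcess a (fun k _ => G k fun i => ε i ω) T Y U ω')) ∂P := by
  have hm : Measurable fun p : (ℕ → ℝ) × ((ℕ → E) × (ℕ → ℕ) × (ℕ → ℝ)) =>
      f (PointMeasure.ofMeasure (limitPointProcess a (fun k p => G k p.1) (fun i p => p.2.2.2 i)
        (fun i p => p.2.2.1 i) (fun i p => p.2.1 i) p)) :=
    f.continuous.measurable.comp (measurable_ofMeasure_limitPointProcess
      (fun k => (hG k).comp measurable_fst)
      (fun i => by fun_prop) (fun i => by fun_prop) (fun i => by fun_prop) a)
  exact condExp_of_indepFun (measurable_pi_lambda _ hε)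
    ((measurable_pi_lambda _ hU).prodMk ((measurable_pi_lambda _ hY).prodMk
      (measurable_pi_lambda _ hT))) h hm (C := ‖f‖) fun p => f.norm_coe_le_norm _

theorem ae_isRadonPointMeasure_of_frozen (hU : ∀ i, Measurable (U i))
    (hε : ∀ i, Measurable (ε i)) (hY : ∀ i, Measurable (Y i)) (hT : ∀ i, Measurable (T i))
    (h : IndepFun (fun ω i => ε i ω)
      (fun ω => ((fun i => U i ω), (fun i => Y i ω), (fun i => T i ω))) P)
    {G : ℕ → (ℕ → ℝ) → ℝ} (hG : ∀ k, Measurable (G k)) {a : ℝ}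
    (hR : ∀ᵐ ω ∂P, ∀ᵐ ω' ∂P, IsRadonPointMeasure
      (limitPointProcess a (fun k _ => G k fun i => ε i ω) T Y U ω')) :
    ∀ᵐ ω ∂P, IsRadonPointMeasure
      (limitPointProcess a (fun k ω => G k fun i => ε i ω) T Y U ω) := by
  have hm : MeasurableSet {p : (ℕ → ℝ) × ((ℕ → E) × (ℕ → ℕ) × (ℕ → ℝ)) |
      IsRadonPointMeasure (limitPointProcess a (fun k p => G k p.1) (fun i p => p.2.2.2 i)
        (fun i p => p.2.2.1 i) (fun i p => p.2.1 i) p)} :=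
    measurableSet_isRadonPointMeasure_limitPointProcess
      (fun k => (hG k).comp measurable_fst)
      (fun i => by fun_prop) (fun i => by fun_prop) (fun i => by fun_prop) a
  exact ae_of_indepFun (measurable_pi_lambda _ hε)
    ((measurable_pi_lambda _ hU).prodMk ((measurable_pi_lambda _ hY).prodMk
      (measurable_pi_lambda _ hT))) h hm hR

omit [IsProbabilityMeasure P] in
theorem integrable_rpow_of_lintegral_lt_top {ξ : Ω → ℝ} (hξ : Measurable ξ) (hξ0 : ∀ ω, 0 ≤ ξ ω)
    {r : ℝ} (hr : 0 ≤ r) (h : ∫⁻ ω, ENNReal.ofReal (ξ ω) ^ r ∂P < ∞) :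
    Integrable (fun ω => ξ ω ^ r) P := by
  refine (lintegral_ofReal_ne_top_iff_integrable (hξ.pow_const r).aestronglyMeasurable
    (ae_of_all _ fun ω => Real.rpow_nonneg (hξ0 ω) r)).1 ?_
  simpa only [ENNReal.ofReal_rpow_of_nonneg (hξ0 _) hr] using h.ne

omit [IsProbabilityMeasure P] in
theorem lintegral_ofReal_rpow {ξ : Ω → ℝ} (hξ0 : ∀ ω, 0 ≤ ξ ω) {r : ℝ} (hr : 0 ≤ r)
    (h : Integrable (fun ω => ξ ω ^ r) P) :
    ∫⁻ ω, ENNReal.ofReal (ξ ω) ^ r ∂P = ENNReal.ofReal (∫ ω, ξ ω ^ r ∂P) := by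
  rw [ofReal_integral_eq_lintegral_ofReal h (ae_of_all _ fun ω => Real.rpow_nonneg (hξ0 ω) r)]
  simp only [ENNReal.ofReal_rpow_of_nonneg (hξ0 _) hr]

theorem condMoment_ae_eq (hε : ∀ i, Measurable (ε i)) {W : Ω → ℕ} (hW : Measurable W)
    (h : IndepFun (fun ω i => ε i ω) W P) (r : ℝ) :
    condMoment P ε W r =ᵐ[P] fun ω => ∫⁻ ω', ENNReal.ofReal (ε (W ω') ω) ^ r ∂P := by
  have hm : Measurable fun p : (ℕ → ℝ) × ℕ => ENNReal.ofReal (p.1 p.2) ^ r :=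
    measurable_from_prod_countable_left fun k =>
      (measurable_pi_apply k).ennreal_ofReal.pow_const r
  exact condLExp_of_indepFun (measurable_pi_lambda _ hε) hW h hm

/-- Properties of almost every frozen value of a signal whose conditional moment of order `α + δ`
is finite. -/
theorem ae_condMoment_eq_ofReal {α δ : ℝ} (hα : 0 < α) (hδ : 0 < δ)
    (hε : ∀ i, Measurable (ε i)) (hε0 : ∀ l, ∀ᵐ ω ∂P, 0 ≤ ε l ω) {W : Ω → ℕ} (hW : Measurable W)
    (h : IndepFun (fun ω i => ε i ω) W P) (hfin : ∀ᵐ ω ∂P, condMoment P ε W (α + δ) ω < ∞) :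
    ∀ᵐ ω ∂P, (∀ k, 0 ≤ ε k ω) ∧ Integrable (fun ω' => ε (W ω') ω ^ (α + δ)) P ∧
      condMoment P ε W α ω = ENNReal.ofReal (∫ ω', ε (W ω') ω ^ α ∂P) := by
  filter_upwards [ae_all_iff.2 hε0, hfin, condMoment_ae_eq hε hW h (α + δ),
    condMoment_ae_eq hε hW h α] with ω h0 h1 h2 h3
  have hm : Measurable fun ω' => ε (W ω') ω := (measurable_of_countable fun k => ε k ω).comp hW
  rw [h2] at h1
  have hint := integrable_rpow_of_lintegral_lt_top hm (fun ω' => h0 _) (by positivity) h1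
  refine ⟨h0, hint, ?_⟩
  rw [h3, lintegral_ofReal_rpow (fun ω' => h0 _) hα.le
    (integrable_rpow_of_integrable_rpow_add hα hδ hm (fun ω' => h0 _) hint)]

end Freezing

section SupMeasures

variable {E : Type*} [TopologicalSpace E]

theorem smul_supOfPoints (b : ℝ≥0∞) (I : Set ℕ) (x : ℕ → ℝ≥0∞) (u : ℕ → E) :
    b • supOfPoints I x u = supOfPoints I (fun i => b * x i) u := by
  refine SupMeasure.ext_onOpen fun G => ?_
  rw [SupMeasure.smul_onOpen]
  simp only [supOfPoints, ENNReal.mul_iSup]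

variable [SecondCountableTopology E] [MeasurableSpace E] [BorelSpace E] {Ω : Type*}

/-- The rescaled empirical sup-measure is a continuous function of the noisy point process. For
`c ≤ 0` both sides are null, since then no rescaled height is positive. -/
theorem smul_noisySupMeasure {ε Z : ℕ → Ω → ℝ} {Y : ℕ → Ω → ℕ} {U : ℕ → Ω → E} {N : Ω → ℕ} {ω : Ω}
    (hε : ∀ k, 0 ≤ ε k ω) (hZ : ∀ i, 0 ≤ Z i ω) (c : ℝ) :
    ENNReal.ofReal c⁻¹ • noisySupMeasure ε Z Y U N ω
      = (PointMeasure.ofMeasure (noisyPointProcess ε Z Y U N c ω)).toSup := by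
  rw [noisyPointProcess, toSup_ofMeasure_pointSum
    (isRadonPointMeasure_pointSum (Set.finite_Iio _) _ _), noisySupMeasure, smul_supOfPoints]
  congr 1 with i
  rw [← ENNReal.ofReal_mul' (mul_nonneg (hε _) (hZ i)), mul_comm, div_eq_mul_inv]

theorem smul_frechetSupMeasure {a σ : ℝ} (hσ : 0 ≤ σ) {T : ℕ → Ω → ℝ} {Y : ℕ → Ω → ℕ}
    {U : ℕ → Ω → E} {ε : ℕ → Ω → ℝ} {ω : Ω} (hε : ∀ k, ε k ω = σ)
    (h : IsRadonPointMeasure (limitPointProcess a ε T Y U ω)) :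
    ENNReal.ofReal σ • frechetSupMeasure a T U ω
      = (PointMeasure.ofMeasure (limitPointProcess a ε T Y U ω)).toSup := by
  rw [limitPointProcess] at h ⊢
  rw [toSup_ofMeasure_pointSum h, frechetSupMeasure, smul_supOfPoints]
  congr 1 with i
  rw [hε, ENNReal.ofReal_mul hσ]

end SupMeasures

end

/-! ### The limit theorem -/

theorem theorem3p1
    {E : Type*} [MetricSpace E] [LocallyCompactSpace E] [SecondCountableTopology E]
    [MeasurableSpace E] [BorelSpace E] (μ : Measure E) [IsProbabilityMeasure μ]
    {Ω : Type*} [MeasurableSpace Ω] (P : Measure Ω) [IsProbabilityMeasure P]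
    (U : ℕ → Ω → E) (ε : ℕ → Ω → ℝ) (Y : ℕ → Ω → ℕ) (Z : ℕ → Ω → ℝ)
    (N : ℕ → Ω → ℕ) (T : ℕ → Ω → ℝ)
    -- the locations, the signal, the labels and the noise
    (hU : IsIID U P) (hUlaw : ∀ i, P.map (U i) = μ)
    (hε : IsIID ε P) (hε0 : ∀ l, ∀ᵐ ω ∂P, 0 ≤ ε l ω)
    (hY : IsIID Y P)
    (hZ : IsIID Z P) (hZ0 : ∀ i, ∀ᵐ ω ∂P, 0 ≤ Z i ω)
    -- `N n` is a Poisson random variable with mean `n`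
    (hN : ∀ n, Measurable (N n)) (hNlaw : ∀ n : ℕ, P.map (N n) = poissonMeasure (n : ℝ≥0))
    -- the interarrival times of a standard Poisson process
    (hT : IsIID T P) (hTlaw : ∀ i, P.map (T i) = expMeasure 1)
    -- independence of the families
    (hindep : ∀ n, iIndep ![sigmaOf U, sigmaOf ε, sigmaOf Y, sigmaOf Z,
      MeasurableSpace.comap (N n) inferInstance] P)
    (hindepT : iIndep ![sigmaOf U, sigmaOf ε, sigmaOf Y, sigmaOf T] P)
    -- the assumptions of the noise-dominance regime
    (α' : ℝ) (hα' : 0 < α') (hRV : IsRegularlyVarying (tail P (Z 0)) (-α'))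
    (hmoment : ∃ δ : ℝ, 0 < δ ∧ ∀ᵐ ω ∂P, condMoment P ε (Y 0) (α' + δ) ω < ∞)
    (c : ℕ → ℝ) (hc : Tendsto (fun n : ℕ => (n : ℝ) * tail P (Z 0) (c n)) atTop (𝓝 1)) :
    (∀ᵐ ω ∂P, IsRadonPointMeasure (limitPointProcess α' ε T Y U ω)) ∧
    CondTendstoInDistribution (sigmaOf ε) P
      (fun n ω => PointMeasure.ofMeasure (noisyPointProcess ε Z Y U (N n) (c n) ω))
      (fun ω => PointMeasure.ofMeasure (limitPointProcess α' ε T Y U ω)) ∧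
    (∀ᵐ ω ∂P, condMoment P ε (Y 0) α' ω < ∞) ∧
    CondTendstoInDistribution (sigmaOf ε) P
      (fun n ω => ENNReal.ofReal ((c n)⁻¹) • noisySupMeasure ε Z Y U (N n) ω)
      (fun ω => condMoment P ε (Y 0) α' ω ^ (1 / α') • frechetSupMeasure α' T U ω) := by
  obtain ⟨δ, hδ, hfin⟩ := hmoment
  -- the independence relations used below
  let m5 : ℕ → Fin 5 → MeasurableSpace Ω := fun n =>
    ![sigmaOf U, sigmaOf ε, sigmaOf Y, sigmaOf Z, MeasurableSpace.comap (N n) inferInstance]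
  let m4 : Fin 4 → MeasurableSpace Ω := ![sigmaOf U, sigmaOf ε, sigmaOf Y, sigmaOf T]
  have hm5 : ∀ n i, m5 n i ≤ ‹MeasurableSpace Ω› := by
    intro n i
    fin_cases i
    exacts [hU.measurable_seq.comap_le, hε.measurable_seq.comap_le, hY.measurable_seq.comap_le,
      hZ.measurable_seq.comap_le, (hN n).comap_le]
  have hm4 : ∀ i, m4 i ≤ ‹MeasurableSpace Ω› := by
    intro i
    fin_cases i
    exacts [hU.measurable_seq.comap_le, hε.measurable_seq.comap_le, hY.measurable_seq.comap_le,
      hT.measurable_seq.comap_le]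
  have hle5 : ∀ n (B : Set (Fin 5)) i, i ∈ B → m5 n i ≤ ⨆ j ∈ B, m5 n j :=
    fun n _ _ hi => le_biSup (m5 n) hi
  have hle4 : ∀ (B : Set (Fin 4)) i, i ∈ B → m4 i ≤ ⨆ j ∈ B, m4 j :=
    fun _ _ hi => le_biSup m4 hi
  have hYZ : Indep (sigmaOf Y) (sigmaOf Z) P :=
    indep_of_iIndep (hm5 0) (hindep 0) (A := {2}) (B := {3}) (by simp) (hle5 0 _ 2 (by simp))
      (hle5 0 _ 3 (by simp))
  have hYZU : Indep (sigmaOf Y ⊔ sigmaOf Z) (sigmaOf U) P :=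
    indep_of_iIndep (hm5 0) (hindep 0) (A := {2, 3}) (B := {0}) (by simp)
      (sup_le (hle5 0 _ 2 (by simp)) (hle5 0 _ 3 (by simp))) (hle5 0 _ 0 (by simp))
  have hNV : ∀ n, Indep (MeasurableSpace.comap (N n) inferInstance)
      (sigmaOf Y ⊔ sigmaOf Z ⊔ sigmaOf U) P := fun n =>
    indep_of_iIndep (hm5 n) (hindep n) (A := {4}) (B := {2, 3, 0}) (by simp)
      (hle5 n _ 4 (by simp))
      (sup_le (sup_le (hle5 n _ 2 (by simp)) (hle5 n _ 3 (by simp))) (hle5 n _ 0 (by simp)))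
  have hTYU : Indep (sigmaOf T) (sigmaOf Y ⊔ sigmaOf U) P :=
    indep_of_iIndep hm4 hindepT (A := {3}) (B := {2, 0}) (by simp) (hle4 _ 3 (by simp))
      (sup_le (hle4 _ 2 (by simp)) (hle4 _ 0 (by simp)))
  have hYU : Indep (sigmaOf Y) (sigmaOf U) P := indep_of_indep_of_le_left hYZU le_sup_left
  have hεnoisy : ∀ n, IndepFun (fun ω i => ε i ω)
      (fun ω => ((fun i => U i ω), (fun i => Y i ω), (fun i => Z i ω), N n ω)) P := fun n => by
    refine indep_of_iIndep (hm5 n) (hindep n) (A := {1}) (B := {0, 2, 3, 4}) (by simp)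
      (hle5 n _ 1 (by simp)) ?_
    refine (MeasurableSpace.comap_prodMk _ _).trans_le (sup_le (hle5 n _ 0 (by simp)) ?_)
    refine (MeasurableSpace.comap_prodMk _ _).trans_le (sup_le (hle5 n _ 2 (by simp)) ?_)
    exact (MeasurableSpace.comap_prodMk _ _).trans_le
      (sup_le (hle5 n _ 3 (by simp)) (hle5 n _ 4 (by simp)))
  have hεlimit : IndepFun (fun ω i => ε i ω)
      (fun ω => ((fun i => U i ω), (fun i => Y i ω), (fun i => T i ω))) P := by
    refine indep_of_iIndep hm4 hindepT (A := {1}) (B := {0, 2, 3}) (by simp)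
      (hle4 _ 1 (by simp)) ?_
    refine (MeasurableSpace.comap_prodMk _ _).trans_le (sup_le (hle4 _ 0 (by simp)) ?_)
    exact (MeasurableSpace.comap_prodMk _ _).trans_le
      (sup_le (hle4 _ 2 (by simp)) (hle4 _ 3 (by simp)))
  have hεY : IndepFun (fun ω i => ε i ω) (Y 0) P :=
    hεlimit.comp (φ := id) (ψ := fun p : (ℕ → E) × (ℕ → ℕ) × (ℕ → ℝ) => p.2.1 0) measurable_id
      (by fun_prop)
  have hgood := ae_condMoment_eq_ofReal hα' hδ hε.measurable hε0 (hY.measurable 0) hεY hfin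
  have hintα : ∀ ω, (∀ k, 0 ≤ ε k ω) → Integrable (fun ω' => ε (Y 0 ω') ω ^ (α' + δ)) P →
      Integrable (fun ω' => ε (Y 0 ω') ω ^ α') P := fun ω h0 h =>
    integrable_rpow_of_integrable_rpow_add hα' hδ
      ((measurable_of_countable fun k => ε k ω).comp (hY.measurable 0)) (fun ω' => h0 _) h
  -- the constant signal with the same moment of order `α'`
  let G : (ℕ → ℝ) → ℝ := fun x => (∫ ω', x (Y 0 ω') ^ α' ∂P) ^ (1 / α')
  have hG : Measurable G :=
    (measurable_integral_prodMk (hY.measurable 0) (H := fun p : (ℕ → ℝ) × ℕ => p.1 p.2 ^ α')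
      (measurable_from_prod_countable_left fun k =>
        (measurable_pi_apply k).pow_const α')).pow_const _
  have hR : ∀ᵐ ω ∂P, IsRadonPointMeasure (limitPointProcess α' ε T Y U ω) := by
    refine ae_isRadonPointMeasure_of_frozen (G := fun k x => x k) hU.measurable hε.measurable
      hY.measurable hT.measurable hεlimit measurable_pi_apply ?_
    filter_upwards [hgood] with ω ⟨h0, h1, _⟩
    exact ae_isRadonPointMeasure_limitPointProcess hY hT hTlaw hα' h0 (hintα ω h0 h1) U
  have hRG : ∀ᵐ ω ∂P, IsRadonPointMeasure
      (limitPointProcess α' (fun _ ω => G fun i => ε i ω) T Y U ω) := by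
    refine ae_isRadonPointMeasure_of_frozen (G := fun _ => G) hU.measurable hε.measurable
      hY.measurable hT.measurable hεlimit (fun _ => hG) ?_
    filter_upwards [hgood] with ω ⟨h0, h1, _⟩
    exact ae_isRadonPointMeasure_limitPointProcess (e := fun _ => G fun i => ε i ω) hY hT hTlaw hα'
      (fun _ => Real.rpow_nonneg (integral_nonneg fun ω' => Real.rpow_nonneg (h0 _) _) _)
      (integrable_const _) U
  have hmn : ∀ n, Measurable fun ω =>
      PointMeasure.ofMeasure (noisyPointProcess ε Z Y U (N n) (c n) ω) := fun n =>
    measurable_ofMeasure_noisyPointProcess hε.measurable hZ.measurable hY.measurable hU.measurable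
      (hN n) (c n)
  have hfreeze : ∀ f : PointMeasure (PosExt × E) →ᵇ ℝ, ∀ᵐ ω ∂P,
      Tendsto (fun n => (P[fun ω => f (PointMeasure.ofMeasure
        (noisyPointProcess ε Z Y U (N n) (c n) ω)) | sigmaOf ε]) ω) atTop
      (𝓝 (∫ ω', f (PointMeasure.ofMeasure
        (limitPointProcess α' (fun k _ => ε k ω) T Y U ω')) ∂P)) := by
    intro f
    filter_upwards [hgood, ae_all_iff.2 fun n => condExp_noisyPointProcess hU.measurable
      hε.measurable hY.measurable hZ.measurable (hN n) (hεnoisy n) (c n) f] with ω ⟨h0, h1, _⟩ h2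
    simp only [h2]
    exact tendsto_integral_noisyPointProcess hU hY hZ hT hTlaw hN hNlaw hYZ hYZU hNV hTYU hα' hδ
      hRV hc h0 h1 f
  refine ⟨hR, ⟨fun n => (hmn n).aemeasurable, ?_, fun f => ?_⟩, ?_, ?_⟩
  · exact (measurable_ofMeasure_limitPointProcess hε.measurable hT.measurable hY.measurable
      hU.measurable α').aemeasurable
  · filter_upwards [hfreeze f, condExp_limitPointProcess hU.measurable hε.measurable hY.measurable
      hT.measurable hεlimit (G := fun k x => x k) measurable_pi_apply α' f] with ω h1 h2
    rw [h2]
    exact h1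
  · filter_upwards [hgood] with ω ⟨_, _, h⟩
    rw [h]
    exact ENNReal.ofReal_lt_top
  · have hsn : ∀ n, (fun ω => ENNReal.ofReal ((c n)⁻¹) • noisySupMeasure ε Z Y U (N n) ω) =ᵐ[P]
        fun ω => (PointMeasure.ofMeasure (noisyPointProcess ε Z Y U (N n) (c n) ω)).toSup := by
      intro n
      filter_upwards [ae_all_iff.2 hε0, ae_all_iff.2 hZ0] with ω h1 h2
      exact smul_noisySupMeasure h1 h2 (c n)
    have hsl : (fun ω => condMoment P ε (Y 0) α' ω ^ (1 / α') • frechetSupMeasure α' T U ω) =ᵐ[P]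
        fun ω => (PointMeasure.ofMeasure
          (limitPointProcess α' (fun _ ω => G fun i => ε i ω) T Y U ω)).toSup := by
      filter_upwards [hgood, hRG] with ω ⟨h0, _, h1⟩ h2
      have hm0 : 0 ≤ ∫ ω', ε (Y 0 ω') ω ^ α' ∂P :=
        integral_nonneg fun ω' => Real.rpow_nonneg (h0 _) _
      rw [h1, ENNReal.ofReal_rpow_of_nonneg hm0 (by positivity)]
      exact smul_frechetSupMeasure (Real.rpow_nonneg hm0 _) (fun _ => rfl) h2
    refine ⟨fun n => ?_, ?_, fun f => ?_⟩
    · exact (continuous_toSup.measurable.comp (hmn n)).aemeasurable.congr (hsn n).symm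
    · refine (continuous_toSup.measurable.comp (measurable_ofMeasure_limitPointProcess
        (fun _ => hG.comp hε.measurable_seq) hT.measurable hY.measurable hU.measurable
        α')).aemeasurable.congr hsl.symm
    · let g := f.compContinuous ⟨PointMeasure.toSup, continuous_toSup⟩
      filter_upwards [hgood, hfreeze g, condExp_limitPointProcess hU.measurable hε.measurable
        hY.measurable hT.measurable hεlimit (G := fun _ => G) (fun _ => hG) α' g,
        ae_all_iff.2 fun n => condExp_congr_ae (m := sigmaOf ε) ((hsn n).fun_comp f),
        condExp_congr_ae (m := sigmaOf ε) (hsl.fun_comp f)] with ω ⟨h0, h1, _⟩ h2 h3 h4 h5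
      rw [integral_limitPointProcess_eq hU hY hT hTlaw hYU hTYU hα' h0 (hintα ω h0 h1) g] at h2
      refine (h2.congr fun n => (h4 n).symm).trans (le_of_eq ?_)
      exact congrArg 𝓝 (h5.trans h3).symm
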